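/- A broadcast channel with confidential messages (BC-CM) is a memoryless channel $P_{Y_1,Y_2|X}$ from an input alphabet $\mathcal X$ to two output alphabets $\mathcal Y_1,\mathcal Y_2$ (nonempty standard Borel spaces), together with a measurable cost $c:\mathcal X\to[0,\infty]$ and a budget $\Gamma\in[0,\infty]$ ($c=0$ if the input is unconstrained). A code of block length $n\ge1$ and rates $R_1,R_2\ge0$ has message sets $\{1,\dots,\lceil 2^{nR_k}\rceil\}$, $k=1,2$, a stochastic encoder $P_{X^n|W_1,W_2}$ and deterministic decoders $\phi_k:\mathcal Y_k^n\to\{1,\dots,\lceil 2^{nR_k}\rceil\}$. The messages $W_1,W_2$ are independent and uniform, and the code must satisfy $\frac1n\sum_{i=1}^n\mathbb E\,c(X_i)\le\Gamma$. The pair $(R_1,R_2)$ is achievable if for every $\epsilon>0$ there is such a code, of some block length $n\ge 1$, with $$\max_{k}\Pr[\phi_k(Y_k^n)\ne W_k]\le\epsilon,\qquad nR_1-H(W_1|Y_2^n)\le n\epsilon,\qquad nR_2-H(W_2|Y_1^n)\le n\epsilon .$$ The secrecy capacity region $\mathcal C_s$ is the closure of the set of achievable pairs. Information quantities are in bits.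 Let $\mathcal P$ be the set of all channels $P_{\tilde Y_1,\tilde Y_2|X}$ with $P_{\tilde Y_k|X}=P_{Y_k|X}$ for $k=1,2$. For $P_{\tilde Y_1,\tilde Y_2|X}\in\mathcal P$ and an input law $P_X$ let $\mathcal R_O(P_{\tilde Y_1,\tilde Y_2|X},P_X)$ be the set of pairs $(R_1,R_2)$, $R_1,R_2\ge 0$, with $$R_1\le I(X;\tilde Y_1|\tilde Y_2),\qquad R_2\le I(X;\tilde Y_2|\tilde Y_1).$$ Theorem (Sato-type outer bound). (i) For the multi-antenna Gaussian BC-CM, $Y_1=h^{H}X+Z_1$, $Y_2=g^{H}X+Z_2$, with $h,g\in\mathbb C^t$, independent circularly symmetric complex Gaussian noises of mean $0$ and variance $1$, and the power constraint $c(x)=\|x\|^2$, $\Gamma=P\in[0,\infty)$, $$\mathcal C_s\subseteq\bigcap_{P_{\tilde Y_1,\tilde Y_2|X}\in\mathcal P}\ \bigcup_{P_X:\ \mathbb E\,c(X)\le\Gamma}\mathcal R_O\bigl(P_{\tilde Y_1,\tilde Y_2|X},P_X\bigr).$$ (ii) The same inclusion holds for every BC-CM with a finite input alphabet. (iii) For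 an arbitrary BC-CM the inclusion holds with each of the unions $\bigcup_{P_X}$ replaced by its closure in $\mathbb R^2$. -/

import Mathlib

open MeasureTheory ProbabilityTheory InformationTheory
open scoped ENNReal NNReal InnerProductSpace

noncomputable section

/-! ### Information measures (in bits) -/

/-- The conditional mutual information `I(X;Y|Z)` in bits, as an element of `[0,∞]`: the
Kullback-Leibler divergence of the joint law of `(Z,X,Y)` from the law under which `X` and `Y`
are conditionally independent given `Z`, with the same conditional marginals. -/
def condMutualInfo {Ω A B C : Type*} [MeasurableSpace Ω]
    [MeasurableSpace A] [StandardBorelSpace A] [Nonempty A]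
    [MeasurableSpace B] [StandardBorelSpace B] [Nonempty B] [MeasurableSpace C]
    (X : Ω → A) (Y : Ω → B) (Z : Ω → C) (μ : Measure Ω) [IsFiniteMeasure μ] : ℝ≥0∞ :=
  klDiv (μ.map (fun ω => (Z ω, (X ω, Y ω))))
      (μ.map Z ⊗ₘ (condDistrib X Z μ ×ₖ condDistrib Y Z μ)) /
    ENNReal.ofReal (Real.log 2)

/-- The conditional entropy (equivocation) `H(W|Y)` in bits of a random variable `W` with values
in a finite set, given an arbitrary random variable `Y`:
the mean over `y` of the Shannon entropy of the conditional law of `W` given `Y = y`. -/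
def condEntropy {Ω A B : Type*} [MeasurableSpace Ω]
    [Fintype A] [Nonempty A] [MeasurableSpace A] [StandardBorelSpace A] [MeasurableSpace B]
    (W : Ω → A) (Y : Ω → B) (μ : Measure Ω) [IsFiniteMeasure μ] : ℝ :=
  (∫ y, ∑ a, Real.negMulLog ((condDistrib W Y μ y).real {a}) ∂(μ.map Y)) / Real.log 2

/-! ### Memoryless use of a channel -/

/-- `n` independent uses of the channel `K`: given the input word `x`, the outputs are independent
and the `i`-th one has law `K (x i)`. -/
def memoryless {𝒳 𝒴 : Type*} [MeasurableSpace 𝒳] [MeasurableSpace 𝒴]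
    (K : Kernel 𝒳 𝒴) [IsMarkovKernel K] (n : ℕ) : Kernel (Fin n → 𝒳) (Fin n → 𝒴) where
  toFun x := Measure.pi (fun i => K (x i))
  measurable' := by
    refine Measurable.measure_of_isPiSystem_of_isProbabilityMeasure
      generateFrom_pi.symm isPiSystem_pi ?_
    rintro s ⟨u, hu, rfl⟩
    simp only [Set.mem_univ_pi, Set.mem_ofPred_eq] at hu
    simp only [Measure.pi_pi]
    exact Finset.measurable_prod _ fun i _ =>
      (Kernel.measurable_coe K (hu i)).comp (measurable_pi_apply i)

instance {𝒳 𝒴 : Type*} [MeasurableSpace 𝒳] [MeasurableSpace 𝒴]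
    (K : Kernel 𝒳 𝒴) [IsMarkovKernel K] (n : ℕ) : IsMarkovKernel (memoryless K n) :=
  ⟨fun x => inferInstanceAs (IsProbabilityMeasure (Measure.pi (fun i => K (x i))))⟩

/-! ### Secret codes for a broadcast channel -/

/-- The number `⌈2^{nR}⌉` of messages of a code of rate `R` and block length `n`. -/
def messageCount (n : ℕ) (R : ℝ) : ℕ := ⌈(2 : ℝ) ^ ((n : ℝ) * R)⌉₊

instance (n : ℕ) (R : ℝ) : NeZero (messageCount n R) :=
  ⟨(Nat.ceil_pos.2 (Real.rpow_pos_of_pos two_pos _)).ne'⟩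

/-- A secret codebook of block length `n` with message sets of sizes `M₁` and `M₂`: a stochastic
encoder and a deterministic decoder for each user. -/
structure SecretCode (𝒳 𝒴₁ 𝒴₂ : Type*)
    [MeasurableSpace 𝒳] [MeasurableSpace 𝒴₁] [MeasurableSpace 𝒴₂] (M₁ M₂ n : ℕ) where
  /-- the stochastic encoder: the law of the input word given the pair of messages -/
  enc : Kernel (Fin M₁ × Fin M₂) (Fin n → 𝒳)
  enc_markov : IsMarkovKernel enc
  /-- the decoding function of user 1 -/
  dec₁ : (Fin n → 𝒴₁) → Fin M₁
  measurable_dec₁ : Measurable dec₁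
  /-- the decoding function of user 2 -/
  dec₂ : (Fin n → 𝒴₂) → Fin M₂
  measurable_dec₂ : Measurable dec₂

namespace SecretCode

attribute [instance] SecretCode.enc_markov

variable {𝒳 𝒴₁ 𝒴₂ : Type*} [MeasurableSpace 𝒳] [MeasurableSpace 𝒴₁] [MeasurableSpace 𝒴₂]
  {M₁ M₂ n : ℕ}

/-- The sample space of a transmission: the messages, the input word and the output word. -/
abbrev Outcome (𝒳 𝒴₁ 𝒴₂ : Type*) (M₁ M₂ n : ℕ) : Type _ :=
  ((Fin M₁ × Fin M₂) × (Fin n → 𝒳)) × (Fin n → 𝒴₁ × 𝒴₂)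

/-- The joint law of messages, input word and output word: the two messages are independent and
uniform, the input word is drawn by the encoder, and the channel `W` is used `n` times. -/
def law (code : SecretCode 𝒳 𝒴₁ 𝒴₂ M₁ M₂ n) (W : Kernel 𝒳 (𝒴₁ × 𝒴₂)) [IsMarkovKernel W] :
    Measure (Outcome 𝒳 𝒴₁ 𝒴₂ M₁ M₂ n) :=
  (uniformOn (Set.univ : Set (Fin M₁ × Fin M₂)) ⊗ₘ code.enc) ⊗ₘ
    (memoryless W n).comap Prod.snd measurable_snd

instance [NeZero M₁] [NeZero M₂] (code : SecretCode 𝒳 𝒴₁ 𝒴₂ M₁ M₂ n)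
    (W : Kernel 𝒳 (𝒴₁ × 𝒴₂)) [IsMarkovKernel W] : IsProbabilityMeasure (code.law W) := by
  have : IsProbabilityMeasure (uniformOn (Set.univ : Set (Fin M₁ × Fin M₂))) :=
    isProbabilityMeasure_uniformOn Set.finite_univ Set.univ_nonempty
  unfold law
  infer_instance

/-- The message for user 1. -/
def msg₁ (ω : Outcome 𝒳 𝒴₁ 𝒴₂ M₁ M₂ n) : Fin M₁ := ω.1.1.1

/-- The message for user 2. -/
def msg₂ (ω : Outcome 𝒳 𝒴₁ 𝒴₂ M₁ M₂ n) : Fin M₂ := ω.1.1.2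

/-- The channel input at time `i`. -/
def input (i : Fin n) (ω : Outcome 𝒳 𝒴₁ 𝒴₂ M₁ M₂ n) : 𝒳 := ω.1.2 i

/-- The word received by user 1. -/
def out₁ (ω : Outcome 𝒳 𝒴₁ 𝒴₂ M₁ M₂ n) : Fin n → 𝒴₁ := fun i => (ω.2 i).1

/-- The word received by user 2. -/
def out₂ (ω : Outcome 𝒳 𝒴₁ 𝒴₂ M₁ M₂ n) : Fin n → 𝒴₂ := fun i => (ω.2 i).2

/-- The error probability of user 1. -/
def errorProb₁ (code : SecretCode 𝒳 𝒴₁ 𝒴₂ M₁ M₂ n) (W : Kernel 𝒳 (𝒴₁ × 𝒴₂))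
    [IsMarkovKernel W] : ℝ :=
  (code.law W).real {ω | code.dec₁ (out₁ ω) ≠ msg₁ ω}

/-- The error probability of user 2. -/
def errorProb₂ (code : SecretCode 𝒳 𝒴₁ 𝒴₂ M₁ M₂ n) (W : Kernel 𝒳 (𝒴₁ × 𝒴₂))
    [IsMarkovKernel W] : ℝ :=
  (code.law W).real {ω | code.dec₂ (out₂ ω) ≠ msg₂ ω}

/-- The average input cost per channel use is at most `Γ`. -/
def MeetsCost (code : SecretCode 𝒳 𝒴₁ 𝒴₂ M₁ M₂ n) (W : Kernel 𝒳 (𝒴₁ × 𝒴₂))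
    [IsMarkovKernel W] (c : 𝒳 → ℝ≥0∞) (Γ : ℝ≥0∞) : Prop :=
  (∑ i : Fin n, ∫⁻ ω, c (input i ω) ∂(code.law W)) / (n : ℝ≥0∞) ≤ Γ

end SecretCode

/-! ### Secrecy capacity region -/

section Regions

variable {𝒳 𝒴₁ 𝒴₂ : Type*} [MeasurableSpace 𝒳] [MeasurableSpace 𝒴₁] [MeasurableSpace 𝒴₂]

open SecretCode in
/-- Achievability of the rate pair `R` (in bits per channel use) with confidential messages over
the memoryless broadcast channel `W`, under the input constraint "mean cost at most `Γ`". -/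
def IsAchievable (W : Kernel 𝒳 (𝒴₁ × 𝒴₂)) [IsMarkovKernel W] (c : 𝒳 → ℝ≥0∞) (Γ : ℝ≥0∞)
    (R : ℝ × ℝ) : Prop :=
  0 ≤ R.1 ∧ 0 ≤ R.2 ∧
    ∀ ε : ℝ, 0 < ε → ∃ n : ℕ, 0 < n ∧
      ∃ code : SecretCode 𝒳 𝒴₁ 𝒴₂ (messageCount n R.1) (messageCount n R.2) n,
        code.MeetsCost W c Γ ∧
        max (code.errorProb₁ W) (code.errorProb₂ W) ≤ ε ∧
        n * R.1 - condEntropy msg₁ out₂ (code.law W) ≤ n * ε ∧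
        n * R.2 - condEntropy msg₂ out₁ (code.law W) ≤ n * ε

/-- The secrecy capacity region: the closure of the set of achievable rate pairs. -/
def secrecyCapacityRegion (W : Kernel 𝒳 (𝒴₁ × 𝒴₂)) [IsMarkovKernel W] (c : 𝒳 → ℝ≥0∞)
    (Γ : ℝ≥0∞) : Set (ℝ × ℝ) :=
  closure {R | IsAchievable W c Γ R}

/-- `Q ∈ sameMarginals W`: the two marginal channels of `Q` are those of `W`. -/
def sameMarginals (W : Kernel 𝒳 (𝒴₁ × 𝒴₂)) : Set (Kernel 𝒳 (𝒴₁ × 𝒴₂)) :=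
  {Q | Q.fst = W.fst ∧ Q.snd = W.snd}

/-- The input laws of mean cost at most `Γ`. -/
def admissibleInputs (c : 𝒳 → ℝ≥0∞) (Γ : ℝ≥0∞) : Set (ProbabilityMeasure 𝒳) :=
  {p | ∫⁻ x, c x ∂(p : Measure 𝒳) ≤ Γ}

/-- The rate pairs with `R₁ ≤ I(X;Y₁|Y₂)` and `R₂ ≤ I(X;Y₂|Y₁)`, where `X` has law `p` and
`(Y₁,Y₂)` is the output of the channel `Q`. -/
def satoRegion [StandardBorelSpace 𝒳] [Nonempty 𝒳] [StandardBorelSpace 𝒴₁] [Nonempty 𝒴₁]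
    [StandardBorelSpace 𝒴₂] [Nonempty 𝒴₂] (Q : Kernel 𝒳 (𝒴₁ × 𝒴₂)) [IsMarkovKernel Q]
    (p : ProbabilityMeasure 𝒳) : Set (ℝ × ℝ) :=
  {R | 0 ≤ R.1 ∧ 0 ≤ R.2 ∧
    ENNReal.ofReal R.1 ≤ condMutualInfo (fun ω : 𝒳 × 𝒴₁ × 𝒴₂ => ω.1) (fun ω => ω.2.1)
      (fun ω => ω.2.2) ((p : Measure 𝒳) ⊗ₘ Q) ∧
    ENNReal.ofReal R.2 ≤ condMutualInfo (fun ω : 𝒳 × 𝒴₁ × 𝒴₂ => ω.1) (fun ω => ω.2.2)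
      (fun ω => ω.2.1) ((p : Measure 𝒳) ⊗ₘ Q)}

end Regions

/-! ### The multi-antenna Gaussian broadcast channel -/

/-- The circularly symmetric complex Gaussian law with mean `0` and variance `1`: independent
real and imaginary parts, each of variance `1/2`. -/
def complexGaussian : Measure ℂ :=
  ((gaussianReal 0 (1 / 2)).prod (gaussianReal 0 (1 / 2))).map Complex.measurableEquivRealProd.symm

instance : IsProbabilityMeasure complexGaussian :=
  Measure.isProbabilityMeasure_map Complex.measurableEquivRealProd.symm.measurable.aemeasurable

/-- The channel `x ↦ hᴴ x + z` of a single receive antenna, with `z` standard complex Gaussian. -/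
def gaussianLink {t : ℕ} (h : EuclideanSpace ℂ (Fin t)) : Kernel (EuclideanSpace ℂ (Fin t)) ℂ :=
  (Kernel.id ×ₖ Kernel.const _ complexGaussian).map (fun p => ⟪h, p.1⟫_ℂ + p.2)

instance {t : ℕ} (h : EuclideanSpace ℂ (Fin t)) : IsMarkovKernel (gaussianLink h) :=
  Kernel.IsMarkovKernel.map _ (by fun_prop)

/-- The multi-antenna Gaussian broadcast channel `y₁ = hᴴ x + z₁`, `y₂ = gᴴ x + z₂` with
independent noises. -/
def gaussianBC {t : ℕ} (h g : EuclideanSpace ℂ (Fin t)) :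
    Kernel (EuclideanSpace ℂ (Fin t)) (ℂ × ℂ) :=
  gaussianLink h ×ₖ gaussianLink g

instance {t : ℕ} (h g : EuclideanSpace ℂ (Fin t)) : IsMarkovKernel (gaussianBC h g) :=
  inferInstanceAs (IsMarkovKernel (gaussianLink h ×ₖ gaussianLink g))

end

/-! The rate of a user is limited by what its output `Y_a` reveals about the input beyond the other
output `Y_b`. The central quantity is `degradedDiv p Q r`, the relative entropy of `Q` from the
channel in which `Y_a` is redrawn from `Y_b` by `r`. Its minimum over `r` is attained at the true
conditional law of `Y_a` given `Y_b` and equals `I(X;Y_a|Y_b)` in nats (`degradedDiv_eq_add`,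
`condMutualInfo_eq_degradedDiv`). For a fixed `r` it is moreover linear in the input law and
additive over memoryless uses, so that `klDiv_memoryless_le` passes to single letters without a
chain rule for mutual information or a concavity argument.

Converse. Error probability and equivocation see one marginal channel each, so every `Q` with the
right marginals may replace the given channel. Over the degraded channel the decoder of user a works
from a noisy copy of `Y_b^n`, hence knows no more than the eavesdropper. A Fano inequality for
relative entropy (`ofReal_condEntropy_le_klDiv`, from the Donsker-Varadhan bound) turns small error
and large equivocation into a large divergence between the two situations. Averaging the letters of
a code gives one admissible `p` for which, up to `δ`, both rates are bounded by `degradedDiv p Q r`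
for all `Q` and `r` at once (`exists_rateBound_of_mem_secrecyCapacityRegion`). Taking for `r` the
true conditional law proves (iii).

For (i) and (ii) the limit `δ → 0` has to be taken inside the set of input laws, and the freedom in
`Q` and `r` is what makes the bounds continuous. With finitely many letters, the laws range over a
compact simplex, and `r` is slightly perturbed so that the divergence is finite at every letter,
hence continuous in `p`.

In the Gaussian case, Gaussian `Q` and `r` give bounds that depend only on the covariance of the
input, which ranges over a compact set. The limit covariance is realised by a Gaussian input, and
`GaussianBound.le_degradedDiv` returns to an arbitrary `Q`: a quadratic test function in the
Donsker-Varadhan bound shows that, for a Gaussian input and a given noise correlation, jointly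
Gaussian noises are the worst. -/

noncomputable section

/-! ### The Kullback-Leibler divergence -/

section KullbackLeibler

variable {α β : Type*} [MeasurableSpace α] [MeasurableSpace β]

/-- If `ν` integrates `exp F` to at most one, then `klDiv μ ν` is at least the `μ`-mean of `F`
(Donsker-Varadhan). -/
theorem ofReal_integral_le_klDiv {μ ν : Measure α} [IsProbabilityMeasure μ]
    [IsProbabilityMeasure ν] {F : α → ℝ} (hF : Measurable F) (hFi : Integrable F μ)
    (hexp : ∫⁻ x, ENNReal.ofReal (Real.exp (F x)) ∂ν ≤ 1) :
    ENNReal.ofReal (∫ x, F x ∂μ) ≤ klDiv μ ν := by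
  by_cases htop : klDiv μ ν = ∞
  · simp [htop]
  obtain ⟨hac, hint⟩ := klDiv_ne_top_iff.1 htop
  rw [klDiv_of_ac_of_integrable hac hint]
  refine ENNReal.ofReal_le_ofReal ?_
  simp only [probReal_univ, add_sub_cancel_right]
  have hm : Measurable fun x => Real.exp (F x - llr μ ν x) :=
    Real.measurable_exp.comp (hF.sub (measurable_llr μ ν))
  -- The change of measure turns the left side into the `ν`-integral of `exp F` over the set where
  -- the density is nonzero. With `1 + x ≤ exp x` this gives a nonpositive mean of `F - llr μ ν`.
  have hle : ∫⁻ x, ENNReal.ofReal (Real.exp (F x - llr μ ν x)) ∂μ ≤ 1 := by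
    refine le_trans ?_ hexp
    rw [← lintegral_rnDeriv_mul hac hm.ennreal_ofReal.aemeasurable]
    refine lintegral_mono_ae ?_
    filter_upwards [Measure.rnDeriv_lt_top μ ν] with x hx
    by_cases h0 : μ.rnDeriv ν x = 0
    · simp [h0]
    · have hpos : 0 < (μ.rnDeriv ν x).toReal := ENNReal.toReal_pos h0 hx.ne
      rw [← ENNReal.ofReal_toReal hx.ne, ← ENNReal.ofReal_mul hpos.le]
      refine ENNReal.ofReal_le_ofReal (le_of_eq ?_)
      rw [llr_def, Real.exp_sub, Real.exp_log hpos]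
      field_simp
  have hexpi : Integrable (fun x => Real.exp (F x - llr μ ν x)) μ :=
    ⟨hm.aestronglyMeasurable, by
      rw [hasFiniteIntegral_iff_ofReal (.of_forall fun _ => (Real.exp_pos _).le)]
      exact hle.trans_lt ENNReal.one_lt_top⟩
  have h1 : ∫ x, Real.exp (F x - llr μ ν x) ∂μ ≤ 1 := by
    rw [integral_eq_lintegral_of_nonneg_ae (.of_forall fun _ => (Real.exp_pos _).le)
      hm.aestronglyMeasurable]
    exact ENNReal.toReal_le_of_le_ofReal zero_le_one (by simpa using hle)
  have h2 : ∫ x, (F x - llr μ ν x) ∂μ ≤ ∫ x, (Real.exp (F x - llr μ ν x) - 1) ∂μ := by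
    refine integral_mono (hFi.sub hint) (hexpi.sub (integrable_const _)) fun x => ?_
    have := Real.add_one_le_exp (F x - llr μ ν x)
    simp only
    linarith
  rw [integral_sub hFi hint, integral_sub hexpi (integrable_const _)] at h2
  simp only [integral_const, probReal_univ, smul_eq_mul, mul_one] at h2
  linarith

theorem llr_withDensity {μ ν : Measure α} [SigmaFinite ν] {G : α → ℝ≥0∞} (hG : Measurable G)
    (h : μ = ν.withDensity G) : llr μ ν =ᵐ[μ] fun x => Real.log (G x).toReal := by
  have hac : μ ≪ ν := h ▸ withDensity_absolutelyContinuous ν G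
  have : μ.rnDeriv ν =ᵐ[ν] G := h ▸ Measure.rnDeriv_withDensity ν hG
  filter_upwards [hac.ae_le this] with x hx
  simp only [llr_def, hx]

theorem klDiv_withDensity {μ ν : Measure α} [IsProbabilityMeasure μ] [IsProbabilityMeasure ν]
    {G : α → ℝ≥0∞} (hG : Measurable G) (h : μ = ν.withDensity G)
    (hi : Integrable (fun x => Real.log (G x).toReal) μ) :
    klDiv μ ν = ENNReal.ofReal (∫ x, Real.log (G x).toReal ∂μ) := by
  have hac : μ ≪ ν := h ▸ withDensity_absolutelyContinuous ν G
  have hl := llr_withDensity hG h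
  rw [klDiv_of_ac_of_integrable hac ((integrable_congr hl).2 hi), integral_congr_ae hl]
  simp

theorem integrable_log_of_klDiv_ne_top {μ ν : Measure α} [IsProbabilityMeasure μ]
    [IsProbabilityMeasure ν] {G : α → ℝ≥0∞} (hG : Measurable G) (h : μ = ν.withDensity G)
    (hi : klDiv μ ν ≠ ∞) : Integrable (fun x => Real.log (G x).toReal) μ :=
  (integrable_congr (llr_withDensity hG h)).1 (klDiv_ne_top_iff.1 hi).2

/-- Data processing, applied to `g` and then to `h`. Used to reorder coordinates. -/
theorem klDiv_map_of_leftInverse (μ ν : Measure α) [IsFiniteMeasure μ] [IsFiniteMeasure ν]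
    {g : α → β} {h : β → α} (hg : Measurable g) (hh : Measurable h)
    (hgh : Function.LeftInverse h g) : klDiv (μ.map g) (ν.map g) = klDiv μ ν := by
  refine le_antisymm (klDiv_map_le μ ν hg) ?_
  have := klDiv_map_le (μ.map g) (ν.map g) hh
  rwa [Measure.map_map hh hg, Measure.map_map hh hg, hgh.comp_eq_id, Measure.map_id,
    Measure.map_id] at this

/-- If `ν` dominates `c • μ`, then `klDiv μ ν` is at most `log (1 / c)`. -/
theorem klDiv_le_of_smul_le {μ ν : Measure α} [IsProbabilityMeasure μ] [IsProbabilityMeasure ν]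
    {c : ℝ} (hc : 0 < c) (h : ENNReal.ofReal c • μ ≤ ν) :
    klDiv μ ν ≤ ENNReal.ofReal (-Real.log c) := by
  have hc0 : ENNReal.ofReal c ≠ 0 := by simpa using hc
  have hac : μ ≪ ν := by
    intro s hs
    have := h s
    rw [hs, Measure.smul_apply, smul_eq_mul, nonpos_iff_eq_zero, mul_eq_zero] at this
    exact this.resolve_left hc0
  have hg : ∀ᵐ x ∂ν, μ.rnDeriv ν x ≤ ENNReal.ofReal c⁻¹ := by
    refine ae_le_of_forall_setLIntegral_le_of_sigmaFinite (Measure.measurable_rnDeriv μ ν) ?_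
    intro s hs _
    rw [Measure.setLIntegral_rnDeriv hac, setLIntegral_const, ENNReal.ofReal_inv_of_pos hc]
    have := h s
    rw [Measure.smul_apply, smul_eq_mul] at this
    rwa [mul_comm, ← div_eq_mul_inv, ENNReal.le_div_iff_mul_le (.inl hc0) (.inl ENNReal.ofReal_ne_top),
      mul_comm]
  have hle : ∀ᵐ x ∂μ, llr μ ν x ≤ -Real.log c := by
    filter_upwards [hac.ae_le hg, Measure.rnDeriv_pos hac] with x hx hpos
    rw [llr_def, ← Real.log_inv]
    exact Real.log_le_log (ENNReal.toReal_pos hpos.ne' (hx.trans_lt ENNReal.ofReal_lt_top).ne)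
      (ENNReal.toReal_le_of_le_ofReal (by positivity) hx)
  -- The upper bound on `llr` does not make it integrable, since the density may come close to zero.
  -- Finiteness follows instead from `klFun` being bounded on `[0, c⁻¹]`.
  have hfun : klDiv μ ν ≠ ∞ := by
    rw [klDiv_eq_lintegral_klFun_of_ac hac]
    have hb : ∀ᵐ x ∂ν, ENNReal.ofReal (klFun (μ.rnDeriv ν x).toReal) ≤
        ENNReal.ofReal (c⁻¹ * |Real.log c| + 1) := by
      filter_upwards [hg] with x hx
      refine ENNReal.ofReal_le_ofReal ?_
      have h1 : (μ.rnDeriv ν x).toReal ≤ c⁻¹ :=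
        ENNReal.toReal_le_of_le_ofReal (by positivity) hx
      have h0 : 0 ≤ (μ.rnDeriv ν x).toReal := ENNReal.toReal_nonneg
      rw [klFun]
      rcases h0.eq_or_lt with h0 | h0
      · rw [← h0]; simp; positivity
      · have h2 : Real.log (μ.rnDeriv ν x).toReal ≤ |Real.log c| :=
          (Real.log_le_log h0 h1).trans (by rw [Real.log_inv]; exact neg_le_abs _)
        have h3 := mul_le_mul h1 h2
        have : (μ.rnDeriv ν x).toReal * Real.log (μ.rnDeriv ν x).toReal ≤ c⁻¹ * |Real.log c| :=
          (mul_le_mul_of_nonneg_left h2 h0.le).trans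
            (mul_le_mul_of_nonneg_right h1 (abs_nonneg _))
        linarith
    refine ((lintegral_mono_ae hb).trans_lt ?_).ne
    simp [ENNReal.ofReal_lt_top]
  have hint := (klDiv_ne_top_iff.1 hfun).2
  rw [klDiv_of_ac_of_integrable hac hint]
  refine ENNReal.ofReal_le_ofReal ?_
  have := integral_mono_ae hint (integrable_const (-Real.log c)) hle
  simpa using this

end KullbackLeibler

/-! ### Product measures and memoryless channels -/

section Memoryless

variable {𝒳 𝒴 A B Ω : Type*} [MeasurableSpace 𝒳] [MeasurableSpace 𝒴] [MeasurableSpace A]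
  [MeasurableSpace B] [MeasurableSpace Ω] {n : ℕ}

theorem lintegral_pi_prod (μ : Fin n → Measure 𝒴) [∀ i, IsProbabilityMeasure (μ i)]
    {f : Fin n → 𝒴 → ℝ≥0∞} (hf : ∀ i, Measurable (f i)) :
    ∫⁻ y, ∏ i, f i (y i) ∂Measure.pi μ = ∏ i, ∫⁻ y, f i y ∂μ i := by
  refine (lintegral_prod_eq_prod_lintegral_of_indepFun Finset.univ
    (fun i (y : Fin n → 𝒴) => f i (y i))
    (iIndepFun_pi fun i => (hf i).aemeasurable)
    fun i => (hf i).comp (measurable_pi_apply i)).trans ?_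
  refine Finset.prod_congr rfl fun i _ => ?_
  conv_rhs => rw [← (measurePreserving_eval μ i).map_eq,
    lintegral_map (hf i) (measurable_pi_apply i)]

theorem pi_eq_withDensity (μ ν : Fin n → Measure 𝒴) [∀ i, IsProbabilityMeasure (μ i)]
    [∀ i, IsProbabilityMeasure (ν i)] {f : Fin n → 𝒴 → ℝ≥0∞} (hf : ∀ i, Measurable (f i))
    (h : ∀ i, μ i = (ν i).withDensity (f i)) :
    Measure.pi μ = (Measure.pi ν).withDensity fun y => ∏ i, f i (y i) := by
  refine Measure.pi_eq fun s hs => ?_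
  have hS : MeasurableSet (Set.univ.pi s) := MeasurableSet.univ_pi hs
  rw [withDensity_apply _ hS, ← lintegral_indicator hS]
  have : (Set.univ.pi s).indicator (fun y => ∏ i, f i (y i)) =
      fun y => ∏ i, (s i).indicator (f i) (y i) := by
    funext y
    by_cases hy : y ∈ Set.univ.pi s
    · rw [Set.indicator_of_mem hy]
      exact Finset.prod_congr rfl fun i _ => (Set.indicator_of_mem (hy i trivial) _).symm
    · rw [Set.indicator_of_notMem hy]
      obtain ⟨i, hi⟩ : ∃ i, y i ∉ s i := by simpa [Set.mem_pi] using hy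
      exact (Finset.prod_eq_zero (Finset.mem_univ i) (Set.indicator_of_notMem hi _)).symm
  rw [this, lintegral_pi_prod ν fun i => (hf i).indicator (hs i)]
  refine Finset.prod_congr rfl fun i _ => ?_
  rw [lintegral_indicator (hs i), h i, withDensity_apply _ (hs i)]

theorem memoryless_apply (K : Kernel 𝒳 𝒴) [IsMarkovKernel K] (x : Fin n → 𝒳) :
    memoryless K n x = Measure.pi fun i => K (x i) := rfl

theorem memoryless_map (K : Kernel 𝒳 𝒴) [IsMarkovKernel K] {f : 𝒴 → A} (hf : Measurable f)
    (x : Fin n → 𝒳) :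
    (memoryless K n x).map (fun y i => f (y i)) = Measure.pi fun i => (K (x i)).map f := by
  have (i : Fin n) : IsProbabilityMeasure ((K (x i)).map f) :=
    Measure.isProbabilityMeasure_map hf.aemeasurable
  rw [memoryless_apply, Measure.pi_map_pi fun _ => hf.aemeasurable]

/-- Allows a block of degraded outputs to be produced in two stages: the whole first word, then the
second word drawn from it letter by letter. -/
theorem pi_compProd (ν : Fin n → Measure B) [∀ i, IsProbabilityMeasure (ν i)] (r : Kernel B A)
    [IsMarkovKernel r] :
    Measure.pi (fun i => ν i ⊗ₘ r) =
      (Measure.pi ν ⊗ₘ memoryless r n).map fun q i => (q.1 i, q.2 i) := by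
  have hm : Measurable fun (q : (Fin n → B) × (Fin n → A)) (i : Fin n) => (q.1 i, q.2 i) := by
    fun_prop
  refine Measure.pi_eq fun s hs => ?_
  have hS : MeasurableSet (Set.univ.pi s) := MeasurableSet.univ_pi hs
  rw [Measure.map_apply hm hS, Measure.compProd_apply (hm hS)]
  have (b : Fin n → B) : memoryless r n b (Prod.mk b ⁻¹'
      ((fun (q : (Fin n → B) × (Fin n → A)) (i : Fin n) => (q.1 i, q.2 i)) ⁻¹' Set.univ.pi s)) =
      ∏ i, r (b i) (Prod.mk (b i) ⁻¹' s i) := by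
    rw [memoryless_apply, ← Measure.pi_pi]
    congr 1
  simp_rw [this]
  rw [lintegral_pi_prod ν fun i => Kernel.measurable_kernel_prodMk_left (hs i)]
  exact Finset.prod_congr rfl fun i _ => (Measure.compProd_apply (hs i)).symm

/-- Blockwise relative entropy of two memoryless channels is at most `n` times the
single-letter one under the averaged input law. -/
theorem klDiv_memoryless_le [MeasurableSpace.CountablyGenerated 𝒴] (μ : Measure Ω)
    [IsProbabilityMeasure μ] {X : Ω → Fin n → 𝒳} (hX : Measurable X) (hn : n ≠ 0)
    (Q η : Kernel 𝒳 𝒴) [IsMarkovKernel Q] [IsMarkovKernel η] (p : Measure 𝒳)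
    [IsProbabilityMeasure p] (hp : (n : ℝ≥0∞) • p = ∑ i, μ.map fun ω => X ω i) :
    klDiv (μ ⊗ₘ (memoryless Q n).comap X hX) (μ ⊗ₘ (memoryless η n).comap X hX) ≤
      n * klDiv (p ⊗ₘ Q) (p ⊗ₘ η) := by
  by_cases htop : klDiv (p ⊗ₘ Q) (p ⊗ₘ η) = ∞
  · rw [htop, ENNReal.mul_top (by simpa using hn)]; exact le_top
  have hXi (i : Fin n) : Measurable fun ω => X ω i := (measurable_pi_apply i).comp hX
  set g : 𝒳 → 𝒴 → ℝ≥0∞ := Kernel.rnDeriv Q η with hg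
  have hgm : Measurable fun q : 𝒳 × 𝒴 => g q.1 q.2 := Kernel.measurable_rnDeriv Q η
  have hn' : (n : ℝ≥0∞) ≠ 0 := by simpa using hn
  -- Each letter law is dominated by a multiple of the average, so almost sure and integrability
  -- statements under `p` hold at every position.
  have hle (i : Fin n) : μ.map (fun ω => X ω i) ≤ (n : ℝ≥0∞) • p := by
    rw [hp]; exact Finset.single_le_sum (f := fun i => μ.map fun ω => X ω i)
      (fun _ _ => Measure.zero_le _) (Finset.mem_univ i)
  have hac1 (i : Fin n) : μ.map (fun ω => X ω i) ≪ p :=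
    (Measure.absolutelyContinuous_of_le (hle i)).trans Measure.smul_absolutelyContinuous
  have hQη : ∀ᵐ x ∂p, Q x ≪ η x := (klDiv_ne_top_iff.1 htop).1.kernel_of_compProd
  have hQηX : ∀ᵐ ω ∂μ, ∀ i, Q (X ω i) ≪ η (X ω i) := by
    rw [ae_all_iff]
    exact fun i => ae_of_ae_map (hXi i).aemeasurable ((hac1 i).ae_le hQη)
  -- single-letter density
  have hpd : p ⊗ₘ Q = (p ⊗ₘ η).withDensity fun q => g q.1 q.2 := by
    ext s hs
    rw [withDensity_apply _ hs, ← lintegral_indicator hs,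
      Measure.lintegral_compProd (hgm.indicator hs), Measure.compProd_apply hs]
    refine lintegral_congr_ae ?_
    filter_upwards [hQη] with x hx
    have hs' := measurable_prodMk_left (x := x) hs
    rw [← Kernel.withDensity_rnDeriv_eq hx, Kernel.withDensity_apply' _ hgm,
      ← lintegral_indicator hs']
    rfl
  have hint := integrable_log_of_klDiv_ne_top hgm hpd htop
  have hkl := klDiv_withDensity hgm hpd hint
  -- block density
  set G : Ω × (Fin n → 𝒴) → ℝ≥0∞ := fun q => ∏ i, g (X q.1 i) (q.2 i) with hG
  have hGm : Measurable G := by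
    refine Finset.measurable_prod _ fun i _ => hgm.comp (f := fun q : Ω × (Fin n → 𝒴) =>
      (X q.1 i, q.2 i)) ?_
    exact ((hXi i).comp measurable_fst).prodMk ((measurable_pi_apply i).comp measurable_snd)
  have hPd : μ ⊗ₘ (memoryless Q n).comap X hX =
      (μ ⊗ₘ (memoryless η n).comap X hX).withDensity G := by
    ext s hs
    rw [withDensity_apply _ hs, ← lintegral_indicator hs,
      Measure.lintegral_compProd (hGm.indicator hs), Measure.compProd_apply hs]
    refine lintegral_congr_ae ?_
    filter_upwards [hQηX] with ω hω
    have hs' := measurable_prodMk_left (x := ω) hs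
    have h1 := pi_eq_withDensity (fun i => Q (X ω i)) (fun i => η (X ω i))
      (f := fun i => g (X ω i)) (fun i => hgm.comp measurable_prodMk_left) fun i => by
        rw [← Kernel.withDensity_rnDeriv_eq (hω i), Kernel.withDensity_apply _ hgm]
    rw [Kernel.comap_apply, memoryless_apply, h1, withDensity_apply _ hs',
      ← lintegral_indicator hs']
    rfl
  have hmarg (i : Fin n) : (μ ⊗ₘ (memoryless Q n).comap X hX).map
      (fun q => (X q.1 i, q.2 i)) = (μ.map fun ω => X ω i) ⊗ₘ Q := by
    have hm : Measurable fun q : Ω × (Fin n → 𝒴) => (X q.1 i, q.2 i) :=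
      ((hXi i).comp measurable_fst).prodMk ((measurable_pi_apply i).comp measurable_snd)
    refine Measure.ext_of_lintegral _ fun f hf => ?_
    rw [lintegral_map hf hm, Measure.lintegral_compProd (by exact hf.comp hm),
      Measure.lintegral_compProd hf, lintegral_map
      (by exact hf.lintegral_kernel_prod_right') (hXi i)]
    refine lintegral_congr fun ω => ?_
    rw [Kernel.comap_apply, memoryless_apply,
      ← (measurePreserving_eval (fun i => Q (X ω i)) i).map_eq,
      lintegral_map (by exact hf.comp measurable_prodMk_left) (measurable_pi_apply i)]
  have hms : Measurable fun q : 𝒳 × 𝒴 => Real.log (g q.1 q.2).toReal :=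
    Real.measurable_log.comp hgm.ennreal_toReal
  have hmi (i : Fin n) : Measurable fun q : Ω × (Fin n → 𝒴) => (X q.1 i, q.2 i) :=
    ((hXi i).comp measurable_fst).prodMk ((measurable_pi_apply i).comp measurable_snd)
  -- Linearity in the input law is all that single-letterization needs: the block log-density is a
  -- sum over positions, and its mean sees only the sum of the letter laws.
  have hsum : ∑ i, ((μ.map fun ω => X ω i) ⊗ₘ Q) = (n : ℝ≥0∞) • (p ⊗ₘ Q) := by
    ext s hs
    simp only [Measure.coe_finsetSum, Finset.sum_apply, Measure.smul_apply, smul_eq_mul,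
      Measure.compProd_apply hs]
    rw [← smul_eq_mul, ← lintegral_smul_measure, hp, lintegral_finsetSum_measure]
  have hinti (i : Fin n) :
      Integrable (fun q => Real.log (g q.1 q.2).toReal) ((μ.map fun ω => X ω i) ⊗ₘ Q) := by
    refine (hint.smul_measure (c := (n : ℝ≥0∞)) (ENNReal.natCast_ne_top n)).mono_measure ?_
    rw [← hsum]
    exact Finset.single_le_sum (f := fun i => (μ.map fun ω => X ω i) ⊗ₘ Q)
      (fun _ _ => Measure.zero_le _) (Finset.mem_univ i)
  have hintP (i : Fin n) : Integrable (fun q : Ω × (Fin n → 𝒴) =>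
      Real.log (g (X q.1 i) (q.2 i)).toReal) (μ ⊗ₘ (memoryless Q n).comap X hX) := by
    have := hinti i
    rw [← hmarg i] at this
    exact this.comp_measurable (hmi i)
  -- The logarithm of the product splits only where no factor vanishes, because `Real.log 0 = 0`.
  -- This holds almost surely under the numerator law.
  have hpos : ∀ᵐ q ∂(p ⊗ₘ Q), (g q.1 q.2).toReal ≠ 0 := by
    refine Measure.ae_compProd_of_ae_ae
      ((measurableSet_singleton (0 : ℝ)).compl.preimage hgm.ennreal_toReal) ?_
    filter_upwards [hQη] with x hx
    filter_upwards [Kernel.rnDeriv_toReal_pos hx] with y hy using hy.ne'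
  have hposP : ∀ᵐ q ∂(μ ⊗ₘ (memoryless Q n).comap X hX), ∀ i,
      (g (X q.1 i) (q.2 i)).toReal ≠ 0 := by
    rw [ae_all_iff]
    intro i
    have hac : (μ ⊗ₘ (memoryless Q n).comap X hX).map (fun q => (X q.1 i, q.2 i)) ≪ p ⊗ₘ Q := by
      rw [hmarg i]; exact (hac1 i).compProd_left Q
    exact ae_of_ae_map (hmi i).aemeasurable (hac.ae_le hpos)
  have hlog : (fun q => Real.log (G q).toReal) =ᵐ[μ ⊗ₘ (memoryless Q n).comap X hX]
      fun q => ∑ i, Real.log (g (X q.1 i) (q.2 i)).toReal := by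
    filter_upwards [hposP] with q hq
    rw [hG, ENNReal.toReal_prod, Real.log_prod fun i _ => hq i]
  have hGi : Integrable (fun q => Real.log (G q).toReal)
      (μ ⊗ₘ (memoryless Q n).comap X hX) :=
    (integrable_congr hlog).2 (integrable_finsetSum _ fun i _ => hintP i)
  rw [klDiv_withDensity hGm hPd hGi, hkl, integral_congr_ae hlog,
    integral_finsetSum _ fun i _ => hintP i]
  have hval : ∑ i, ∫ q, Real.log (g (X q.1 i) (q.2 i)).toReal
      ∂(μ ⊗ₘ (memoryless Q n).comap X hX) =
      n * ∫ q, Real.log (g q.1 q.2).toReal ∂(p ⊗ₘ Q) := by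
    have h1 : ∫ q, Real.log (g q.1 q.2).toReal ∂((n : ℝ≥0∞) • (p ⊗ₘ Q)) =
        n * ∫ q, Real.log (g q.1 q.2).toReal ∂(p ⊗ₘ Q) := by
      rw [integral_smul_measure]; simp
    rw [← h1, ← hsum, integral_finsetSum_measure fun i _ => hinti i]
    refine Finset.sum_congr rfl fun i _ => ?_
    rw [← hmarg i, integral_map (hmi i).aemeasurable hms.aestronglyMeasurable]
  rw [hval, ENNReal.ofReal_mul (by positivity), ENNReal.ofReal_natCast]

end Memoryless

/-! ### A Fano inequality for the relative entropy -/

section Fano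

variable {Ω B : Type*} [MeasurableSpace Ω] [MeasurableSpace B] {M : ℕ} [NeZero M]

/-- Equivocation is a functional of the joint law of message and observation alone. This is what
permits another channel with the same marginals. -/
theorem condEntropy_congr {Ω' : Type*} [MeasurableSpace Ω'] {P : Measure Ω} {P' : Measure Ω'}
    [IsFiniteMeasure P] [IsFiniteMeasure P'] {U : Ω → Fin M} {V : Ω → B} {U' : Ω' → Fin M}
    {V' : Ω' → B} (hU : Measurable U) (hU' : Measurable U')
    (h : P.map (fun ω => (V ω, U ω)) = P'.map (fun ω => (V' ω, U' ω))) :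
    condEntropy U V P = condEntropy U' V' P' := by
  have hm : P.map V = P'.map V' := by
    have := congrArg Measure.fst h
    rwa [Measure.fst_map_prodMk hU, Measure.fst_map_prodMk hU'] at this
  have hc : condDistrib U V P =ᵐ[P.map V] condDistrib U' V' P' := by
    refine condDistrib_ae_eq_of_measure_eq_compProd V hU.aemeasurable ?_
    rw [h, hm]
    exact (compProd_map_condDistrib hU'.aemeasurable).symm
  unfold condEntropy
  rw [← hm]
  congr 1
  refine integral_congr_ae ?_
  filter_upwards [hc] with y hy
  rw [hy]

/-- Puts equivocation in the form of a mean of `-log P(U|V)`, ready to be part of a Donsker-Varadhan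
test function. Integrability comes from the finite range of `U`, as each `-c log c` is bounded. -/
theorem integral_neg_log_condDistrib (P : Measure Ω) [IsProbabilityMeasure P] {U : Ω → Fin M}
    {V : Ω → B} (hU : Measurable U) (hV : Measurable V) :
    Integrable (fun ω => -Real.log ((condDistrib U V P (V ω)).real {U ω})) P ∧
      ∫ ω, -Real.log ((condDistrib U V P (V ω)).real {U ω}) ∂P =
        Real.log 2 * condEntropy U V P := by
  set c : B → Fin M → ℝ := fun v u => (condDistrib U V P v).real {u} with hc
  have hcm : Measurable fun q : B × Fin M => -Real.log (c q.1 q.2) := by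
    refine measurable_from_prod_countable_left fun u => ?_
    exact (Real.measurable_log.comp
      (Kernel.measurable_coe _ (measurableSet_singleton u)).ennreal_toReal).neg
  have hVU : Measurable fun ω => (V ω, U ω) := hV.prodMk hU
  have hlaw : P.map (fun ω => (V ω, U ω)) = P.map V ⊗ₘ condDistrib U V P :=
    (compProd_map_condDistrib hU.aemeasurable).symm
  have : IsProbabilityMeasure (P.map V) := Measure.isProbabilityMeasure_map hV.aemeasurable
  have hfib (v : B) : ∫ u, -Real.log (c v u) ∂condDistrib U V P v =
      ∑ u, Real.negMulLog (c v u) := by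
    rw [integral_fintype .of_finite]
    refine Finset.sum_congr rfl fun u _ => ?_
    rw [Real.negMulLog, smul_eq_mul]
    simp only [hc]
    ring
  have h01 (v : B) (u : Fin M) : 0 ≤ c v u ∧ c v u ≤ 1 := ⟨measureReal_nonneg, measureReal_le_one⟩
  have hint : Integrable (fun q : B × Fin M => -Real.log (c q.1 q.2))
      (P.map V ⊗ₘ condDistrib U V P) := by
    rw [Measure.integrable_compProd_iff hcm.aestronglyMeasurable]
    refine ⟨.of_forall fun v => .of_finite, ?_⟩
    have heq : (fun v => ∫ u, ‖-Real.log (c v u)‖ ∂condDistrib U V P v) =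
        fun v => ∑ u, Real.negMulLog (c v u) := by
      funext v
      rw [← hfib]
      refine integral_congr_ae (.of_forall fun u => ?_)
      exact Real.norm_of_nonneg (neg_nonneg.2 (Real.log_nonpos (h01 v u).1 (h01 v u).2))
    rw [heq]
    refine integrable_finsetSum _ fun u _ => ?_
    refine .of_mem_Icc 0 1 (Real.continuous_negMulLog.measurable.comp
      (Kernel.measurable_coe _ (measurableSet_singleton u)).ennreal_toReal).aemeasurable
      (.of_forall fun v => ⟨Real.negMulLog_nonneg (h01 v u).1 (h01 v u).2, ?_⟩)
    have := Real.negMulLog_le_one_sub_self (h01 v u).1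
    exact this.trans (by linarith [(h01 v u).1])
  rw [← hlaw] at hint
  refine ⟨hint.comp_measurable hVU, ?_⟩
  have h1 : ∫ ω, -Real.log (c (V ω) (U ω)) ∂P =
      ∫ q, -Real.log (c q.1 q.2) ∂(P.map fun ω => (V ω, U ω)) :=
    (integral_map hVU.aemeasurable hcm.aestronglyMeasurable).symm
  rw [hlaw] at hint
  change ∫ ω, -Real.log (c (V ω) (U ω)) ∂P = _
  rw [h1, hlaw, Measure.integral_compProd hint]
  simp_rw [hfib]
  rw [condEntropy, mul_div_cancel₀ _ (Real.log_pos one_lt_two).ne']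

/-- If `P'` arises from `P` by making the estimate `Ŵ` depend on the side information `V` only,
then `klDiv P P'` is at least the equivocation of `U` given `V`, up to a penalty for the
probability that `Ŵ` differs from `U` under `P`. -/
theorem ofReal_condEntropy_le_klDiv (P P' : Measure Ω) [IsProbabilityMeasure P]
    [IsProbabilityMeasure P'] {U Ŵ : Ω → Fin M} {V : Ω → B} (hU : Measurable U)
    (hV : Measurable V) (hŴ : Measurable Ŵ) (k : Kernel B (Fin M)) [IsMarkovKernel k]
    (hP' : P'.map (fun ω => ((V ω, U ω), Ŵ ω)) =
      P.map (fun ω => (V ω, U ω)) ⊗ₘ k.comap Prod.fst measurable_fst)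
    {ε : ℝ} (hε : 0 < ε) (hε1 : ε < 1) (herr : P.real {ω | Ŵ ω ≠ U ω} ≤ ε) :
    ENNReal.ofReal (Real.log 2 * condEntropy U V P + Real.log (1 - ε) + ε * Real.log (ε / M)) ≤
      klDiv P P' := by
  obtain ⟨hci, hce⟩ := integral_neg_log_condDistrib P hU hV
  set c : B → Fin M → ℝ := fun v u => (condDistrib U V P v).real {u} with hc
  have hM : (0 : ℝ) < M := Nat.cast_pos.2 (NeZero.pos M)
  have hM1 : (1 : ℝ) ≤ M := Nat.one_le_cast.2 (NeZero.pos M)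
  -- A guess of `u` from the estimate `w`: mass `1 - ε` at `w`, the rest uniform. It is positive
  -- everywhere and sums to one over `u`. The test function `F` below is the log-ratio of this guess
  -- to the posterior of `u` given `v`.
  set q : Fin M → Fin M → ℝ := fun u w => (if u = w then 1 - ε else 0) + ε / M with hq
  have hqpos (u w) : 0 < q u w := by
    have : 0 < ε / M := by positivity
    simp only [hq]; split_ifs <;> linarith
  have hqsum (w) : ∑ u, q u w = 1 := by
    simp only [hq, Finset.sum_add_distrib, Finset.sum_ite_eq', Finset.mem_univ, if_true,
      Finset.sum_const, Finset.card_univ, Fintype.card_fin, nsmul_eq_mul]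
    field_simp; ring
  have hcm : Measurable fun q : B × Fin M => -Real.log (c q.1 q.2) := by
    refine measurable_from_prod_countable_left fun u => ?_
    exact (Real.measurable_log.comp
      (Kernel.measurable_coe _ (measurableSet_singleton u)).ennreal_toReal).neg
  have hqm : Measurable fun p : Fin M × Fin M => Real.log (q p.1 p.2) := .of_discrete
  have hVU : Measurable fun ω => (V ω, U ω) := hV.prodMk hU
  set F : (B × Fin M) × Fin M → ℝ := fun p => Real.log (q p.1.2 p.2) + -Real.log (c p.1.1 p.1.2)
    with hF
  have hFm : Measurable F :=
    (hqm.comp ((measurable_snd.comp measurable_fst).prodMk measurable_snd)).add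
      (hcm.comp measurable_fst)
  have hT : Measurable fun ω => ((V ω, U ω), Ŵ ω) := hVU.prodMk hŴ
  -- Under `P'`, the estimate is conditionally independent of `u` given `v`. Summing over `u` first,
  -- the posterior cancels and the column of `q` sums to one, whatever the kernel `k`. Only an
  -- inequality results, because terms of zero posterior are lost.
  have hexp : ∫⁻ ω, ENNReal.ofReal (Real.exp (F ((V ω, U ω), Ŵ ω))) ∂P' ≤ 1 := by
    have hEm : Measurable fun p => ENNReal.ofReal (Real.exp (F p)) :=
      (Real.measurable_exp.comp hFm).ennreal_ofReal
    have hlaw : P.map (fun ω => (V ω, U ω)) = P.map V ⊗ₘ condDistrib U V P :=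
      (compProd_map_condDistrib hU.aemeasurable).symm
    have : IsProbabilityMeasure (P.map V) := Measure.isProbabilityMeasure_map hV.aemeasurable
    rw [← lintegral_map (μ := P') hEm hT, hP', hlaw,
      Measure.lintegral_compProd hEm, Measure.lintegral_compProd (by
        exact hEm.lintegral_kernel_prod_right')]
    refine (lintegral_mono (g := fun _ => 1) fun v => ?_).trans (by simp)
    simp only [lintegral_fintype, Kernel.comap_apply]
    have hterm (u w : Fin M) : ENNReal.ofReal (Real.exp (F ((v, u), w))) *
        condDistrib U V P v {u} ≤ ENNReal.ofReal (q u w) := by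
      have hcu : condDistrib U V P v {u} = ENNReal.ofReal (c v u) := by
        simp [hc, measureReal_def]
      rw [hcu, ← ENNReal.ofReal_mul (Real.exp_pos _).le]
      refine ENNReal.ofReal_le_ofReal ?_
      simp only [hF]
      rw [Real.exp_add, Real.exp_log (hqpos u w), Real.exp_neg]
      have h0 : 0 ≤ c v u := measureReal_nonneg
      rcases h0.eq_or_lt with h | h
      · rw [← h]; simpa using (hqpos u w).le
      · rw [Real.exp_log h]; field_simp; exact le_rfl
    calc ∑ u, (∑ w, ENNReal.ofReal (Real.exp (F ((v, u), w))) * k v {w}) *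
          condDistrib U V P v {u}
        = ∑ w, k v {w} * ∑ u, ENNReal.ofReal (Real.exp (F ((v, u), w))) *
          condDistrib U V P v {u} := by
          simp_rw [Finset.sum_mul, Finset.mul_sum]
          rw [Finset.sum_comm]
          refine Finset.sum_congr rfl fun w _ => Finset.sum_congr rfl fun u _ => ?_
          ring
      _ ≤ ∑ w, k v {w} * 1 := by
          gcongr with w
          refine (Finset.sum_le_sum fun u _ => hterm u w).trans ?_
          rw [← ENNReal.ofReal_sum_of_nonneg fun u _ => (hqpos u w).le, hqsum]; simp
      _ = 1 := by
          simp only [mul_one]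
          rw [sum_measure_singleton]; simp
  have hqi : Integrable (fun ω => Real.log (q (U ω) (Ŵ ω))) P := by
    have : Integrable (fun p : Fin M × Fin M => Real.log (q p.1 p.2))
      (P.map fun ω => (U ω, Ŵ ω)) := .of_finite
    exact this.comp_measurable (hU.prodMk hŴ)
  have hFi : Integrable (fun ω => F ((V ω, U ω), Ŵ ω)) P := hqi.add hci
  refine le_trans (ENNReal.ofReal_le_ofReal ?_)
    (ofReal_integral_le_klDiv (hFm.comp hT) hFi hexp)
  have hsplit : ∫ ω, F ((V ω, U ω), Ŵ ω) ∂P =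
      ∫ ω, Real.log (q (U ω) (Ŵ ω)) ∂P + Real.log 2 * condEntropy U V P := by
    rw [← hce]; exact integral_add hqi hci
  have hE : MeasurableSet {ω | Ŵ ω ≠ U ω} := (measurableSet_eq_fun hŴ hU).compl
  have hlogε : Real.log (ε / M) ≤ 0 :=
    Real.log_nonpos (by positivity) ((div_le_one hM).2 (hε1.le.trans hM1))
  have hlog1 : Real.log (1 - ε) ≤ 0 := Real.log_nonpos (by linarith) (by linarith)
  have hlow : Real.log (1 - ε) + ε * Real.log (ε / M) ≤ ∫ ω, Real.log (q (U ω) (Ŵ ω)) ∂P := by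
    have hle : ∀ ω, Real.log (1 - ε) + {ω | Ŵ ω ≠ U ω}.indicator (fun _ => Real.log (ε / M)) ω ≤
        Real.log (q (U ω) (Ŵ ω)) := by
      intro ω
      by_cases h : Ŵ ω = U ω
      · rw [Set.indicator_of_notMem (by simpa using h), add_zero]
        refine Real.log_le_log (by linarith) ?_
        simp only [hq, h, if_true]
        linarith [show 0 < ε / M by positivity]
      · rw [Set.indicator_of_mem (by simpa using h)]
        simp only [hq, if_neg (Ne.symm h), zero_add]
        linarith
    have hi : Integrable ({ω | Ŵ ω ≠ U ω}.indicator fun _ => Real.log (ε / M)) P :=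
      (integrable_const _).indicator hE
    have := integral_mono ((integrable_const _).add hi) hqi hle
    simp only [Pi.add_apply] at this
    rw [integral_add (integrable_const _) hi, integral_indicator_const _ hE] at this
    simp only [integral_const, probReal_univ, smul_eq_mul, one_mul] at this
    refine le_trans ?_ this
    have := mul_le_mul_of_nonpos_right herr hlogε
    linarith
  simp only [Function.comp_def]
  rw [hsplit]
  linarith

end Fano

/-! ### The converse for secret codes -/

section Degraded

variable {𝒳 A B : Type*} [MeasurableSpace 𝒳] [MeasurableSpace A] [MeasurableSpace B]

/-- The channel whose first output is that of `Q`, while its second output is drawn by `r` from the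
first one only. -/
def degraded (Q : Kernel 𝒳 (B × A)) (r : Kernel B A) : Kernel 𝒳 (B × A) :=
  Q.fst ⊗ₖ Kernel.prodMkLeft 𝒳 r

instance (Q : Kernel 𝒳 (B × A)) [IsMarkovKernel Q] (r : Kernel B A) [IsMarkovKernel r] :
    IsMarkovKernel (degraded Q r) :=
  inferInstanceAs (IsMarkovKernel (Q.fst ⊗ₖ Kernel.prodMkLeft 𝒳 r))

theorem degraded_apply (Q : Kernel 𝒳 (B × A)) [IsMarkovKernel Q] (r : Kernel B A)
    [IsMarkovKernel r] (x : 𝒳) : degraded Q r x = Q.fst x ⊗ₘ r := by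
  rw [degraded, Kernel.compProd_apply_eq_compProd_sectR]
  congr 1

/-- The relative entropy, under the input law `p`, of the channel `Q` from the channel with the
same first output in which the second output is drawn by `r` from the first one. -/
def degradedDiv (p : Measure 𝒳) (Q : Kernel 𝒳 (B × A)) (r : Kernel B A) : ℝ≥0∞ :=
  klDiv (p ⊗ₘ Q) (p ⊗ₘ degraded Q r)

end Degraded

section Converse

variable {Ω 𝒳 𝒴 𝒴' A B : Type*} [MeasurableSpace Ω] [MeasurableSpace 𝒳] [MeasurableSpace 𝒴]
  [MeasurableSpace 𝒴'] [MeasurableSpace A] [MeasurableSpace B] {n M : ℕ}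

/-- The joint law of the data of a transmission and the output word seen through `f` depends on the
channel through the law of the observed output symbol only. -/
theorem map_memoryless_congr (μ : Measure Ω) [IsProbabilityMeasure μ] {X : Ω → Fin n → 𝒳}
    (hX : Measurable X) (K : Kernel 𝒳 𝒴) [IsMarkovKernel K] (K' : Kernel 𝒳 𝒴')
    [IsMarkovKernel K'] {f : 𝒴 → A} {f' : 𝒴' → A} (hf : Measurable f) (hf' : Measurable f')
    (h : K.map f = K'.map f') :
    (μ ⊗ₘ (memoryless K n).comap X hX).map (fun q => (fun i => f (q.2 i), q.1)) =
      (μ ⊗ₘ (memoryless K' n).comap X hX).map (fun q => (fun i => f' (q.2 i), q.1)) := by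
  refine Measure.ext_of_lintegral _ fun φ hφ => ?_
  have hm : Measurable fun q : Ω × (Fin n → 𝒴) => (fun i => f (q.2 i), q.1) := by fun_prop
  have hm' : Measurable fun q : Ω × (Fin n → 𝒴') => (fun i => f' (q.2 i), q.1) := by fun_prop
  rw [lintegral_map hφ hm, lintegral_map hφ hm', Measure.lintegral_compProd (by exact hφ.comp hm),
    Measure.lintegral_compProd (by exact hφ.comp hm')]
  refine lintegral_congr fun ω => ?_
  have e : (memoryless K n (X ω)).map (fun y i => f (y i)) =
      (memoryless K' n (X ω)).map (fun y i => f' (y i)) := by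
    rw [memoryless_map K hf, memoryless_map K' hf']
    congr 1
    funext i
    rw [← Kernel.map_apply _ hf, h, Kernel.map_apply _ hf']
  have hφω : Measurable fun a => φ (a, ω) := hφ.comp measurable_prodMk_right
  have h1 := lintegral_map (μ := memoryless K n (X ω)) hφω
    (g := fun y i => f (y i)) (by fun_prop)
  have h2 := lintegral_map (μ := memoryless K' n (X ω)) hφω
    (g := fun y i => f' (y i)) (by fun_prop)
  rw [Kernel.comap_apply, Kernel.comap_apply, ← h1, ← h2, e]

/-- Over the degraded channel the second word is drawn from the first one alone, so the decoded
message is a randomised function of the first word. This supplies the hypothesis on `P'` in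
`ofReal_condEntropy_le_klDiv`. -/
theorem map_degraded (μ : Measure Ω) [IsProbabilityMeasure μ] {X : Ω → Fin n → 𝒳}
    (hX : Measurable X) (Q : Kernel 𝒳 (B × A)) [IsMarkovKernel Q] (r : Kernel B A)
    [IsMarkovKernel r] {u : Ω → Fin M} (hu : Measurable u) {dec : (Fin n → A) → Fin M}
    (hdec : Measurable dec) :
    (μ ⊗ₘ (memoryless (degraded Q r) n).comap X hX).map
        (fun q => (((fun i => (q.2 i).1), u q.1), dec fun i => (q.2 i).2)) =
      (μ ⊗ₘ (memoryless Q n).comap X hX).map (fun q => ((fun i => (q.2 i).1), u q.1)) ⊗ₘ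
        ((memoryless r n).map dec).comap Prod.fst measurable_fst := by
  have : IsMarkovKernel ((memoryless r n).map dec) := Kernel.IsMarkovKernel.map _ hdec
  have hm : Measurable fun q : Ω × (Fin n → B × A) =>
      ((((fun i => (q.2 i).1) : Fin n → B), u q.1), dec fun i => (q.2 i).2) := by fun_prop
  have hm' : Measurable fun q : Ω × (Fin n → B × A) =>
      (((fun i => (q.2 i).1) : Fin n → B), u q.1) := by fun_prop
  refine Measure.ext_of_lintegral _ fun φ hφ => ?_
  have hκ : Measurable fun a => ∫⁻ b, φ (a, b) ∂(((memoryless r n).map dec).comap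
      (Prod.fst : (Fin n → B) × Fin M → _) measurable_fst) a := hφ.lintegral_kernel_prod_right'
  rw [lintegral_map hφ hm, Measure.lintegral_compProd (by exact hφ.comp hm),
    Measure.lintegral_compProd hφ, lintegral_map hκ hm',
    Measure.lintegral_compProd (by exact hκ.comp hm')]
  refine lintegral_congr fun ω => ?_
  simp only [Kernel.comap_apply]
  have hz : Measurable fun (q : (Fin n → B) × (Fin n → A)) (i : Fin n) => (q.1 i, q.2 i) := by
    fun_prop
  have e1 : memoryless (degraded Q r) n (X ω) =
      (memoryless Q.fst n (X ω) ⊗ₘ memoryless r n).map fun q i => (q.1 i, q.2 i) := by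
    rw [memoryless_apply, memoryless_apply, ← pi_compProd]
    simp_rw [degraded_apply]
  have e2 : memoryless Q.fst n (X ω) = (memoryless Q n (X ω)).map fun y i => (y i).1 := by
    rw [memoryless_map Q measurable_fst, memoryless_apply]
    simp_rw [Kernel.fst_apply]
  have hφ1 : Measurable fun y : Fin n → B × A =>
      φ ((((fun i => (y i).1) : Fin n → B), u ω), dec fun i => (y i).2) := by fun_prop
  rw [e1, lintegral_map hφ1 hz, Measure.lintegral_compProd (by exact hφ1.comp hz), e2]
  have hκω : Measurable fun b : Fin n → B => ∫⁻ w, φ ((b, u ω), w) ∂((memoryless r n).map dec b) :=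
    hκ.comp (measurable_prodMk_right (y := u ω))
  rw [show (fun b : Fin n → B => ∫⁻ a : Fin n → A,
      φ ((fun i => ((b, a).1 i, (b, a).2 i).1, u ω), dec fun i => ((b, a).1 i, (b, a).2 i).2)
        ∂(memoryless r n) b) =
      fun b => ∫⁻ w, φ ((b, u ω), w) ∂((memoryless r n).map dec b) from ?_]
  · rw [lintegral_map hκω (by fun_prop)]
  · funext b
    rw [Kernel.map_apply _ hdec, lintegral_map (by exact hφ.comp measurable_prodMk_left) hdec]

/-- Single-letter bound on the equivocation of a message decodable from the second outputs, given
the first outputs. -/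
theorem condEntropy_le_degradedDiv [NeZero M] [MeasurableSpace.CountablyGenerated A]
    [MeasurableSpace.CountablyGenerated B] (μ : Measure Ω) [IsProbabilityMeasure μ]
    {X : Ω → Fin n → 𝒳} (hX : Measurable X) (hn : n ≠ 0) (Q : Kernel 𝒳 (B × A)) [IsMarkovKernel Q]
    (r : Kernel B A) [IsMarkovKernel r] (p : Measure 𝒳) [IsProbabilityMeasure p]
    (hp : (n : ℝ≥0∞) • p = ∑ i, μ.map fun ω => X ω i) {u : Ω → Fin M} (hu : Measurable u)
    {dec : (Fin n → A) → Fin M} (hdec : Measurable dec) {ε : ℝ} (hε : 0 < ε) (hε1 : ε < 1)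
    (herr : (μ ⊗ₘ (memoryless Q n).comap X hX).real {q | dec (fun i => (q.2 i).2) ≠ u q.1} ≤ ε) :
    ENNReal.ofReal (Real.log 2 * condEntropy (fun q : Ω × (Fin n → B × A) => u q.1)
      (fun q i => (q.2 i).1) (μ ⊗ₘ (memoryless Q n).comap X hX) + Real.log (1 - ε) +
        ε * Real.log (ε / M)) ≤ n * degradedDiv p Q r := by
  have : IsMarkovKernel ((memoryless r n).map dec) := Kernel.IsMarkovKernel.map _ hdec
  refine (ofReal_condEntropy_le_klDiv _ (μ ⊗ₘ (memoryless (degraded Q r) n).comap X hX)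
    (U := fun q => u q.1) (Ŵ := fun q => dec fun i => (q.2 i).2) (V := fun q i => (q.2 i).1)
    (by fun_prop) (by fun_prop) (by fun_prop) ((memoryless r n).map dec)
    (map_degraded μ hX Q r hu hdec) hε hε1 herr).trans ?_
  exact klDiv_memoryless_le μ hX hn Q (degraded Q r) p hp

end Converse

/-! ### Exchanging the channel for one with the same marginals, and normalising by the block length
-/

section Rates

variable {Ω 𝒳 𝒴 A B : Type*} [MeasurableSpace Ω] [MeasurableSpace 𝒳] [MeasurableSpace 𝒴]
  [MeasurableSpace A] [MeasurableSpace B] {n M : ℕ}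

/-- Sato's observation: decoding involves only the output seen through `f`, and equivocation only
the output seen through `g`, so both may be computed with `Q` however it correlates the two. General
`f` and `g` let the lemma serve both users. -/
theorem condEntropy_le_degradedDiv_of_marginals [NeZero M]
    [MeasurableSpace.CountablyGenerated A] [MeasurableSpace.CountablyGenerated B] (μ : Measure Ω)
    [IsProbabilityMeasure μ] {X : Ω → Fin n → 𝒳} (hX : Measurable X) (hn : n ≠ 0)
    (W : Kernel 𝒳 𝒴) [IsMarkovKernel W] {f : 𝒴 → A} {g : 𝒴 → B} (hf : Measurable f)
    (hg : Measurable g) (Q : Kernel 𝒳 (B × A)) [IsMarkovKernel Q] (hQg : Q.fst = W.map g)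
    (hQf : Q.snd = W.map f) (r : Kernel B A) [IsMarkovKernel r] (p : Measure 𝒳)
    [IsProbabilityMeasure p] (hp : (n : ℝ≥0∞) • p = ∑ i, μ.map fun ω => X ω i) {u : Ω → Fin M}
    (hu : Measurable u) {dec : (Fin n → A) → Fin M} (hdec : Measurable dec) {ε : ℝ} (hε : 0 < ε)
    (hε1 : ε < 1)
    (herr : (μ ⊗ₘ (memoryless W n).comap X hX).real {q | dec (fun i => f (q.2 i)) ≠ u q.1} ≤ ε) :
    ENNReal.ofReal (Real.log 2 * condEntropy (fun q : Ω × (Fin n → 𝒴) => u q.1)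
      (fun q i => g (q.2 i)) (μ ⊗ₘ (memoryless W n).comap X hX) + Real.log (1 - ε) +
        ε * Real.log (ε / M)) ≤ n * degradedDiv p Q r := by
  have hsnd := map_memoryless_congr μ hX Q W (f := Prod.snd) measurable_snd hf
    (by rw [← Kernel.snd_eq, hQf])
  have hfst := map_memoryless_congr μ hX Q W (f := Prod.fst) measurable_fst hg
    (by rw [← Kernel.fst_eq, hQg])
  have herr' : (μ ⊗ₘ (memoryless Q n).comap X hX).real
      {q | dec (fun i => (q.2 i).2) ≠ u q.1} ≤ ε := by
    refine le_of_eq_of_le ?_ herr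
    have hs : MeasurableSet {q : (Fin n → A) × Ω | dec q.1 ≠ u q.2} :=
      (measurableSet_eq_fun (by fun_prop) (by fun_prop)).compl
    have := congrArg (fun ν => ν.real {q : (Fin n → A) × Ω | dec q.1 ≠ u q.2}) hsnd
    rwa [map_measureReal_apply (by fun_prop) hs, map_measureReal_apply (by fun_prop) hs] at this
  have hent : condEntropy (fun q : Ω × (Fin n → 𝒴) => u q.1)
      (fun q i => g (q.2 i)) (μ ⊗ₘ (memoryless W n).comap X hX) =
      condEntropy (fun q : Ω × (Fin n → B × A) => u q.1)
      (fun q i => (q.2 i).1) (μ ⊗ₘ (memoryless Q n).comap X hX) := by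
    refine condEntropy_congr (by fun_prop) (by fun_prop) ?_
    have := congrArg (fun ν => ν.map (Prod.map id u)) hfst.symm
    rwa [Measure.map_map (by fun_prop) (by fun_prop), Measure.map_map (by fun_prop) (by fun_prop)]
      at this
  rw [hent]
  exact condEntropy_le_degradedDiv μ hX hn Q r p hp hu hdec hε hε1 herr'

/-- Since `2 ^ (n R) ≥ 1`, rounding up at most doubles it, which costs one bit. -/
theorem log_messageCount_le (n : ℕ) {R : ℝ} (hR : 0 ≤ R) :
    Real.log (messageCount n R) ≤ (n * R + 1) * Real.log 2 := by
  have h1 : (1 : ℝ) ≤ 2 ^ ((n : ℝ) * R) := Real.one_le_rpow one_le_two (by positivity)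
  have h2 : (messageCount n R : ℝ) ≤ 2 ^ ((n : ℝ) * R + 1) := by
    have := (Nat.ceil_lt_add_one (a := (2 : ℝ) ^ ((n : ℝ) * R)) (by positivity)).le
    rw [Real.rpow_add two_pos, Real.rpow_one, messageCount]
    linarith
  have h3 : (0 : ℝ) < messageCount n R := Nat.cast_pos.2 (NeZero.pos _)
  rw [← Real.log_rpow two_pos]
  exact Real.log_le_log h3 h2

/-- The rate lost in the converse at error level `ε`, in nats. -/
def ratePenalty (R ε : ℝ) : ℝ :=
  ε * Real.log 2 - Real.log (1 - ε) - ε * Real.log ε + ε * (R + 1) * Real.log 2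

theorem tendsto_ratePenalty (R : ℝ) : Filter.Tendsto (ratePenalty R) (nhds 0) (nhds 0) := by
  have h : ContinuousAt (ratePenalty R) 0 := by
    have h1 : ContinuousAt (fun ε : ℝ => Real.log (1 - ε)) 0 :=
      ContinuousAt.log (by fun_prop) (by simp)
    have h2 : ContinuousAt (fun ε : ℝ => ε * Real.log ε) 0 := Real.continuous_mul_log.continuousAt
    unfold ratePenalty
    fun_prop
  have := h.tendsto
  simpa [ratePenalty] using this

/-- Achievability gives no control over `n`, so the loss must not depend on it. Terms that do not
grow with `n` are therefore replaced by `n` times themselves, using `n ≥ 1`, before dividing. -/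
theorem ofReal_rate_le [NeZero M] (hn : n ≠ 0) {R ε H : ℝ} (hε : 0 < ε)
    (hε1 : ε < 1) (hM : Real.log M ≤ (n * R + 1) * Real.log 2) (hH : n * R - H ≤ n * ε)
    {D : ℝ≥0∞} (hD : ENNReal.ofReal (Real.log 2 * H + Real.log (1 - ε) + ε * Real.log (ε / M)) ≤
      n * D) :
    ENNReal.ofReal (R * Real.log 2 - ratePenalty R ε) ≤ D := by
  have hn0 : (n : ℝ≥0∞) ≠ 0 := by simpa using hn
  have hn1 : (1 : ℝ) ≤ n := Nat.one_le_cast.2 (Nat.pos_of_ne_zero hn)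
  have hM0 : (M : ℝ) ≠ 0 := Nat.cast_ne_zero.2 (NeZero.ne M)
  have hkey : n * (R * Real.log 2 - ratePenalty R ε) ≤
      Real.log 2 * H + Real.log (1 - ε) + ε * Real.log (ε / M) := by
    have hl2 : 0 < Real.log 2 := Real.log_pos one_lt_two
    have h1 : Real.log (1 - ε) ≤ 0 := Real.log_nonpos (by linarith) (by linarith)
    have h2 : ε * Real.log ε ≤ 0 :=
      mul_nonpos_of_nonneg_of_nonpos hε.le (Real.log_nonpos hε.le hε1.le)
    rw [Real.log_div hε.ne' hM0]
    have h3 := mul_le_mul_of_nonneg_left hM hε.le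
    have h4 := mul_le_mul_of_nonneg_left hH hl2.le
    have h5 : n * (Real.log (1 - ε) + ε * Real.log ε) ≤ Real.log (1 - ε) + ε * Real.log ε := by
      nlinarith
    have h6 : ε * Real.log 2 ≤ n * (ε * Real.log 2) := by
      have : 0 ≤ ε * Real.log 2 := by positivity
      nlinarith
    unfold ratePenalty
    nlinarith
  have := (ENNReal.ofReal_le_ofReal hkey).trans hD
  rw [ENNReal.ofReal_mul (by positivity), ENNReal.ofReal_natCast] at this
  exact (ENNReal.mul_le_mul_iff_right hn0 (ENNReal.natCast_ne_top n)).1 this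

end Rates

/-! ### From codes to a common admissible input law -/

section Outer

variable {𝒳 𝒴₁ 𝒴₂ : Type*} [MeasurableSpace 𝒳] [MeasurableSpace 𝒴₁] [MeasurableSpace 𝒴₂]

/-- The bound on the rate of one user, up to `δ`, furnished by every channel with the right
marginals and every degradation of it; `Wb` is the channel of the other user and `Wa` the one of the
user. -/
def RateBound {A B : Type*} [MeasurableSpace A] [MeasurableSpace B] (p : Measure 𝒳)
    (Wb : Kernel 𝒳 B) (Wa : Kernel 𝒳 A) (R : ℝ) : Prop :=
  ∀ Q : Kernel 𝒳 (B × A), IsMarkovKernel Q → Q.fst = Wb → Q.snd = Wa →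
    ∀ r : Kernel B A, IsMarkovKernel r → ENNReal.ofReal (R * Real.log 2) ≤ degradedDiv p Q r

theorem RateBound.mono {A B : Type*} [MeasurableSpace A] [MeasurableSpace B] {p : Measure 𝒳}
    {Wb : Kernel 𝒳 B} {Wa : Kernel 𝒳 A} {R R' : ℝ} (h : RateBound p Wb Wa R) (hR : R' ≤ R) :
    RateBound p Wb Wa R' := fun Q hQ hb ha r hr =>
  (ENNReal.ofReal_le_ofReal (mul_le_mul_of_nonneg_right hR
    (Real.log_pos one_lt_two).le)).trans (h Q hQ hb ha r hr)

/-- The average law of the input symbols of a word of random law `μ`. -/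
theorem exists_average_input {Ω : Type*} [MeasurableSpace Ω] {n : ℕ} (hn : n ≠ 0) (μ : Measure Ω)
    [IsProbabilityMeasure μ] {X : Ω → Fin n → 𝒳} (hX : Measurable X) :
    ∃ p : Measure 𝒳, IsProbabilityMeasure p ∧ (n : ℝ≥0∞) • p = ∑ i, μ.map fun ω => X ω i := by
  have hn0 : (n : ℝ≥0∞) ≠ 0 := by simpa using hn
  refine ⟨(n : ℝ≥0∞)⁻¹ • ∑ i, μ.map fun ω => X ω i, ⟨?_⟩, ?_⟩
  · have (i : Fin n) : μ.map (fun ω => X ω i) Set.univ = 1 := by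
      rw [Measure.map_apply (by fun_prop) MeasurableSet.univ]; simp
    simp [Measure.smul_apply, this, ENNReal.inv_mul_cancel hn0 (ENNReal.natCast_ne_top n)]
  · rw [smul_smul, ENNReal.mul_inv_cancel hn0 (ENNReal.natCast_ne_top n), one_smul]

open SecretCode in
-- One `ε` makes both penalties smaller than `δ log 2`, and `p` is the average letter law of one
-- code for that `ε`. Hence the same `p` serves both users, every `Q` and every `r`.
theorem exists_rateBound_of_isAchievable [StandardBorelSpace 𝒴₁] [StandardBorelSpace 𝒴₂]
    {W : Kernel 𝒳 (𝒴₁ × 𝒴₂)} [IsMarkovKernel W] {c : 𝒳 → ℝ≥0∞} (hc : Measurable c) {Γ : ℝ≥0∞}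
    {R : ℝ × ℝ} (hR : IsAchievable W c Γ R) {δ : ℝ} (hδ : 0 < δ) :
    ∃ p ∈ admissibleInputs c Γ, RateBound (p : Measure 𝒳) W.snd W.fst (R.1 - δ) ∧
      RateBound (p : Measure 𝒳) W.fst W.snd (R.2 - δ) := by
  obtain ⟨hR1, hR2, hach⟩ := hR
  have hl2 : 0 < Real.log 2 := Real.log_pos one_lt_two
  have hev : ∀ᶠ ε in nhdsWithin (0 : ℝ) (Set.Ioi 0), ratePenalty R.1 ε < δ * Real.log 2 ∧
      ratePenalty R.2 ε < δ * Real.log 2 ∧ ε < 1 ∧ 0 < ε := by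
    have hpos : 0 < δ * Real.log 2 := by positivity
    refine Filter.Eventually.and ?_ (Filter.Eventually.and ?_ (Filter.Eventually.and ?_ ?_))
    · exact nhdsWithin_le_nhds ((tendsto_ratePenalty R.1).eventually_lt_const hpos)
    · exact nhdsWithin_le_nhds ((tendsto_ratePenalty R.2).eventually_lt_const hpos)
    · exact nhdsWithin_le_nhds (eventually_lt_nhds one_pos)
    · exact self_mem_nhdsWithin
  obtain ⟨ε, hp1, hp2, hε1, hε⟩ := hev.exists
  obtain ⟨n, hn, code, hcost, herr, hH1, hH2⟩ := hach ε hε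
  have hn0 : n ≠ 0 := hn.ne'
  set μ := uniformOn (Set.univ : Set (Fin (messageCount n R.1) × Fin (messageCount n R.2))) ⊗ₘ
    code.enc with hμ
  have : IsProbabilityMeasure (uniformOn
      (Set.univ : Set (Fin (messageCount n R.1) × Fin (messageCount n R.2)))) :=
    isProbabilityMeasure_uniformOn Set.finite_univ Set.univ_nonempty
  have : IsProbabilityMeasure μ := by rw [hμ]; infer_instance
  have hlaw : code.law W = μ ⊗ₘ (memoryless W n).comap Prod.snd measurable_snd := rfl
  obtain ⟨p, hpp, hp⟩ := exists_average_input hn0 μ (X := Prod.snd) measurable_snd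
  refine ⟨⟨p, hpp⟩, ?_, ?_, ?_⟩
  · have hint (i : Fin n) : ∫⁻ ω, c (input i ω) ∂(code.law W) =
        ∫⁻ x, c x ∂(μ.map fun ω => ω.2 i) := by
      have h1 : (code.law W).map Prod.fst = μ := by
        rw [hlaw]; exact Measure.fst_compProd _ _
      have hci : Measurable fun ω : (Fin (messageCount n R.1) × Fin (messageCount n R.2)) ×
        (Fin n → 𝒳) => c (ω.2 i) := by fun_prop
      rw [lintegral_map hc (by fun_prop), ← h1, lintegral_map hci measurable_fst]
      rfl
    have hsum : (n : ℝ≥0∞) * ∫⁻ x, c x ∂p = ∑ i, ∫⁻ ω, c (input i ω) ∂(code.law W) := by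
      rw [← smul_eq_mul, ← lintegral_smul_measure, hp, lintegral_finsetSum_measure]
      exact Finset.sum_congr rfl fun i _ => (hint i).symm
    have hn0' : (n : ℝ≥0∞) ≠ 0 := by simpa using hn0
    change ∫⁻ x, c x ∂p ≤ Γ
    refine le_trans (le_of_eq ?_) hcost
    rw [← hsum, mul_comm, ENNReal.mul_div_cancel_right hn0' (ENNReal.natCast_ne_top n)]
  -- User 1 decodes from the first output of `W` and is to be hidden from the second, so here `Q`
  -- lists the outputs in the opposite order.
  · intro Q hQ hb ha r hr
    refine (ENNReal.ofReal_le_ofReal ?_).trans (ofReal_rate_le hn0 hε hε1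
      (log_messageCount_le n hR1) hH1 (condEntropy_le_degradedDiv_of_marginals μ measurable_snd hn0
        W (f := Prod.fst) (g := Prod.snd) measurable_fst measurable_snd Q
        (by rw [hb, Kernel.snd_eq]) (by rw [ha, Kernel.fst_eq]) r p hp
        (u := fun ω => ω.1.1) (by fun_prop) code.measurable_dec₁ hε hε1
        ((le_max_left _ _).trans herr)))
    linarith
  · intro Q hQ hb ha r hr
    refine (ENNReal.ofReal_le_ofReal ?_).trans (ofReal_rate_le hn0 hε hε1
      (log_messageCount_le n hR2) hH2 (condEntropy_le_degradedDiv_of_marginals μ measurable_snd hn0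
        W (f := Prod.snd) (g := Prod.fst) measurable_snd measurable_fst Q
        (by rw [hb, Kernel.fst_eq]) (by rw [ha, Kernel.snd_eq]) r p hp
        (u := fun ω => ω.1.2) (by fun_prop) code.measurable_dec₂ hε hε1
        ((le_max_right _ _).trans herr)))
    linarith

/-- The converse: near every point of the secrecy capacity region, both rates are bounded by means
of a common admissible input law. -/
theorem exists_rateBound_of_mem_secrecyCapacityRegion [StandardBorelSpace 𝒴₁]
    [StandardBorelSpace 𝒴₂] {W : Kernel 𝒳 (𝒴₁ × 𝒴₂)} [IsMarkovKernel W] {c : 𝒳 → ℝ≥0∞}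
    (hc : Measurable c) {Γ : ℝ≥0∞} {R : ℝ × ℝ} (hR : R ∈ secrecyCapacityRegion W c Γ) :
    0 ≤ R.1 ∧ 0 ≤ R.2 ∧ ∀ δ : ℝ, 0 < δ → ∃ p ∈ admissibleInputs c Γ,
      RateBound (p : Measure 𝒳) W.snd W.fst (R.1 - δ) ∧
        RateBound (p : Measure 𝒳) W.fst W.snd (R.2 - δ) := by
  have hcl : closure {R | IsAchievable W c Γ R} ⊆ {R : ℝ × ℝ | 0 ≤ R.1 ∧ 0 ≤ R.2} :=
    closure_minimal (fun R hR => ⟨hR.1, hR.2.1⟩)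
      ((isClosed_le continuous_const continuous_fst).inter
        (isClosed_le continuous_const continuous_snd))
  refine ⟨(hcl hR).1, (hcl hR).2, fun δ hδ => ?_⟩
  obtain ⟨R', hR', hd⟩ := Metric.mem_closure_iff.1 hR (δ / 2) (half_pos hδ)
  obtain ⟨p, hp, h1, h2⟩ := exists_rateBound_of_isAchievable hc hR' (half_pos hδ)
  rw [Prod.dist_eq, max_lt_iff, Real.dist_eq, Real.dist_eq, abs_lt, abs_lt] at hd
  exact ⟨p, hp, h1.mono (by linarith [hd.1.2]), h2.mono (by linarith [hd.2.2])⟩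

end Outer

/-! ### Conditional mutual information as a relative entropy of channels -/

section CondMutualInfo

theorem condMutualInfo_map {Ω Ω' A B C : Type*} [MeasurableSpace Ω] [MeasurableSpace Ω']
    [MeasurableSpace A] [StandardBorelSpace A] [Nonempty A]
    [MeasurableSpace B] [StandardBorelSpace B] [Nonempty B] [MeasurableSpace C]
    {X : Ω' → A} {Y : Ω' → B} {Z : Ω' → C} (hX : Measurable X) (hY : Measurable Y)
    (hZ : Measurable Z) {T : Ω → Ω'} (hT : Measurable T) {μ : Measure Ω} [IsFiniteMeasure μ] {ν : Measure Ω'}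
    [IsFiniteMeasure ν] (hν : ν = μ.map T) :
    condMutualInfo X Y Z ν =
      condMutualInfo (fun ω => X (T ω)) (fun ω => Y (T ω)) (fun ω => Z (T ω)) μ := by
  subst hν
  unfold condMutualInfo
  simp only [condDistrib]
  rw [Measure.map_map (by fun_prop) hT, Measure.map_map hZ hT]
  simp_rw [Measure.map_map (hZ.prodMk hX) hT, Measure.map_map (hZ.prodMk hY) hT]
  rfl

variable {𝒳 A B : Type*} [MeasurableSpace 𝒳] [MeasurableSpace A] [MeasurableSpace B]

theorem map_fst_output (p : Measure 𝒳) [IsProbabilityMeasure p] (Q : Kernel 𝒳 (B × A))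
    [IsMarkovKernel Q] : (p ⊗ₘ Q).map (fun ω => (ω.1, ω.2.1)) = p ⊗ₘ Q.fst := by
  refine Measure.ext_of_lintegral _ fun φ hφ => ?_
  have hm : Measurable fun ω : 𝒳 × B × A => (ω.1, ω.2.1) := by fun_prop
  rw [lintegral_map hφ hm, Measure.lintegral_compProd (by exact hφ.comp hm),
    Measure.lintegral_compProd hφ]
  refine lintegral_congr fun x => ?_
  rw [Kernel.fst_apply, lintegral_map (by exact hφ.comp measurable_prodMk_left) measurable_fst]

variable [StandardBorelSpace 𝒳] [Nonempty 𝒳]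

/-- The input and the first output have the same joint law as under `Q`; it is disintegrated
backwards, output before input. The second output then depends on the first one only. -/
theorem lintegral_degraded (p : Measure 𝒳) [IsProbabilityMeasure p] (Q : Kernel 𝒳 (B × A))
    [IsMarkovKernel Q] (r : Kernel B A) [IsMarkovKernel r] {φ : 𝒳 × B × A → ℝ≥0∞}
    (hφ : Measurable φ) :
    ∫⁻ ω, φ ω ∂(p ⊗ₘ degraded Q r) =
      ∫⁻ q, ∫⁻ a, φ (q.2, q.1, a) ∂r q.1 ∂((p ⊗ₘ Q).map (fun ω => ω.2.1) ⊗ₘ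
        condDistrib (fun ω : 𝒳 × B × A => ω.1) (fun ω => ω.2.1) (p ⊗ₘ Q)) := by
  have hψ : Measurable fun q : B × 𝒳 => ∫⁻ a, φ (q.2, q.1, a) ∂r q.1 := by
    have : Measurable fun q : (B × 𝒳) × A => φ (q.1.2, q.1.1, q.2) := by fun_prop
    exact this.lintegral_kernel_prod_right' (κ := r.comap Prod.fst measurable_fst)
  have hsw : (p ⊗ₘ Q).map (fun ω => (ω.2.1, ω.1)) = (p ⊗ₘ Q.fst).map Prod.swap := by
    rw [← map_fst_output, Measure.map_map measurable_swap (by fun_prop)]; rfl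
  rw [compProd_map_condDistrib (by fun_prop), hsw, lintegral_map hψ measurable_swap,
    Measure.lintegral_compProd hφ, Measure.lintegral_compProd (by exact hψ.comp measurable_swap)]
  refine lintegral_congr fun x => ?_
  rw [degraded_apply, Measure.lintegral_compProd (by exact hφ.comp measurable_prodMk_left)]
  rfl

/-- Input, first output and second output form a Markov chain under the degraded channel. For `r =
outputKernel p Q` this law is exactly the reference measure in `condMutualInfo`. -/
theorem map_compProd_degraded (p : Measure 𝒳) [IsProbabilityMeasure p] (Q : Kernel 𝒳 (B × A))
    [IsMarkovKernel Q] (r : Kernel B A) [IsMarkovKernel r] :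
    (p ⊗ₘ degraded Q r).map (fun ω => (ω.2.1, (ω.1, ω.2.2))) =
      (p ⊗ₘ Q).map (fun ω => ω.2.1) ⊗ₘ
        (condDistrib (fun ω : 𝒳 × B × A => ω.1) (fun ω => ω.2.1) (p ⊗ₘ Q) ×ₖ r) := by
  refine Measure.ext_of_lintegral _ fun φ hφ => ?_
  have hm : Measurable fun ω : 𝒳 × B × A => (ω.2.1, (ω.1, ω.2.2)) := by fun_prop
  have hψ : Measurable fun q : B × 𝒳 => ∫⁻ a, φ (q.1, q.2, a) ∂r q.1 := by
    have : Measurable fun q : (B × 𝒳) × A => φ (q.1.1, q.1.2, q.2) := by fun_prop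
    exact this.lintegral_kernel_prod_right' (κ := r.comap Prod.fst measurable_fst)
  rw [lintegral_map hφ hm, lintegral_degraded p Q r (by exact hφ.comp hm),
    Measure.lintegral_compProd hφ, Measure.lintegral_compProd hψ]
  refine lintegral_congr fun b => ?_
  rw [Kernel.prod_apply, lintegral_prod _ (by fun_prop)]

variable [StandardBorelSpace A] [Nonempty A]

/-- The conditional law of the second output of `Q` given the first, under the input law `p`. -/
def outputKernel (p : Measure 𝒳) [IsProbabilityMeasure p] (Q : Kernel 𝒳 (B × A))
    [IsMarkovKernel Q] : Kernel B A :=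
  condDistrib (fun ω : 𝒳 × B × A => ω.2.2) (fun ω => ω.2.1) (p ⊗ₘ Q)

instance (p : Measure 𝒳) [IsProbabilityMeasure p] (Q : Kernel 𝒳 (B × A)) [IsMarkovKernel Q] :
    IsMarkovKernel (outputKernel p Q) := by
  unfold outputKernel; infer_instance

theorem condMutualInfo_eq_degradedDiv (p : Measure 𝒳) [IsProbabilityMeasure p]
    (Q : Kernel 𝒳 (B × A)) [IsMarkovKernel Q] :
    condMutualInfo (fun ω : 𝒳 × B × A => ω.1) (fun ω => ω.2.2) (fun ω => ω.2.1) (p ⊗ₘ Q) =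
      degradedDiv p Q (outputKernel p Q) / ENNReal.ofReal (Real.log 2) := by
  unfold condMutualInfo degradedDiv
  rw [← outputKernel, ← map_compProd_degraded]
  congr 1
  exact klDiv_map_of_leftInverse _ _ (h := fun q : B × 𝒳 × A => (q.2.1, q.1, q.2.2))
    (by fun_prop) (by fun_prop) fun _ => rfl

/-- Chain rule with the output pair first and the input second. Under the degraded law, the input
given both outputs follows `ξ`, which does not involve `r`, so `r` affects the output term only.
That term vanishes at `outputKernel p Q`, which is therefore the minimiser. -/
theorem degradedDiv_eq_add (p : Measure 𝒳) [IsProbabilityMeasure p] (Q : Kernel 𝒳 (B × A))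
    [IsMarkovKernel Q] (r : Kernel B A) [IsMarkovKernel r] :
    degradedDiv p Q r = klDiv ((p ⊗ₘ Q).map (fun ω => ω.2))
        ((p ⊗ₘ Q).map (fun ω => ω.2.1) ⊗ₘ r) + degradedDiv p Q (outputKernel p Q) := by
  set κ := condDistrib (fun ω : 𝒳 × B × A => ω.1) (fun ω => ω.2) (p ⊗ₘ Q)
  set ξ := condDistrib (fun ω : 𝒳 × B × A => ω.1) (fun ω => ω.2.1) (p ⊗ₘ Q)
  have hprob : IsProbabilityMeasure ((p ⊗ₘ Q).map (fun ω => ω.2)) :=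
    Measure.isProbabilityMeasure_map (by fun_prop)
  have hprob' : IsProbabilityMeasure ((p ⊗ₘ Q).map (fun ω => ω.2.1)) :=
    Measure.isProbabilityMeasure_map (by fun_prop)
  have key (r : Kernel B A) [IsMarkovKernel r] : degradedDiv p Q r =
      klDiv ((p ⊗ₘ Q).map (fun ω => ω.2)) ((p ⊗ₘ Q).map (fun ω => ω.2.1) ⊗ₘ r) +
        klDiv ((p ⊗ₘ Q).map (fun ω => ω.2) ⊗ₘ κ)
          ((p ⊗ₘ Q).map (fun ω => ω.2) ⊗ₘ ξ.comap Prod.fst measurable_fst) := by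
    rw [← klDiv_compProd_eq_add, degradedDiv, compProd_map_condDistrib (by fun_prop)]
    -- Conditional independence read in the other order: first output, then second output by `r`,
    -- then input by `ξ`.
    have : ((p ⊗ₘ Q).map (fun ω => ω.2.1) ⊗ₘ r) ⊗ₘ ξ.comap Prod.fst measurable_fst =
        (p ⊗ₘ degraded Q r).map fun ω => (ω.2, ω.1) := by
      refine Measure.ext_of_lintegral _ fun φ hφ => ?_
      have hm : Measurable fun ω : 𝒳 × B × A => (ω.2, ω.1) := by fun_prop
      have h1 : Measurable fun q : B × A => ∫⁻ x, φ (q, x) ∂ξ q.1 :=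
        hφ.lintegral_kernel_prod_right' (κ := ξ.comap Prod.fst measurable_fst)
      have h2 : Measurable fun q : B × 𝒳 => ∫⁻ a, φ ((q.1, a), q.2) ∂r q.1 := by
        have : Measurable fun q : (B × 𝒳) × A => φ ((q.1.1, q.2), q.1.2) := by fun_prop
        exact this.lintegral_kernel_prod_right' (κ := r.comap Prod.fst measurable_fst)
      rw [lintegral_map hφ hm, lintegral_degraded p Q r (by exact hφ.comp hm),
        Measure.lintegral_compProd hφ, Measure.lintegral_compProd (by exact h1),
        Measure.lintegral_compProd h2]
      refine lintegral_congr fun b => ?_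
      simp only [Kernel.comap_apply]
      exact lintegral_lintegral_swap (by fun_prop)
    rw [this]
    exact (klDiv_map_of_leftInverse _ _ (h := fun q : (B × A) × 𝒳 => (q.2, q.1))
      (by fun_prop) (by fun_prop) fun _ => rfl).symm
  have h0 : (p ⊗ₘ Q).map (fun ω => ω.2.1) ⊗ₘ outputKernel p Q = (p ⊗ₘ Q).map (fun ω => ω.2) := by
    rw [outputKernel, compProd_map_condDistrib (by fun_prop)]
  rw [key r, key (outputKernel p Q), h0, klDiv_self, zero_add]

theorem ofReal_le_condMutualInfo {p : Measure 𝒳} [IsProbabilityMeasure p]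
    {Q : Kernel 𝒳 (B × A)} [IsMarkovKernel Q] {R : ℝ}
    (h : ENNReal.ofReal (R * Real.log 2) ≤ degradedDiv p Q (outputKernel p Q)) :
    ENNReal.ofReal R ≤
      condMutualInfo (fun ω : 𝒳 × B × A => ω.1) (fun ω => ω.2.2) (fun ω => ω.2.1) (p ⊗ₘ Q) := by
  have hl : 0 < Real.log 2 := Real.log_pos one_lt_two
  rw [condMutualInfo_eq_degradedDiv, ENNReal.le_div_iff_mul_le (by simp [hl]) (by simp),
    ← ENNReal.ofReal_mul' hl.le]
  exact h

end CondMutualInfo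

/-! ### Membership in the Sato region, and the bound up to closure -/

section SatoRegion

variable {𝒳 𝒴₁ 𝒴₂ : Type*} [MeasurableSpace 𝒳] [MeasurableSpace 𝒴₁] [MeasurableSpace 𝒴₂]
  [StandardBorelSpace 𝒳] [Nonempty 𝒳] [StandardBorelSpace 𝒴₁] [Nonempty 𝒴₁]
  [StandardBorelSpace 𝒴₂] [Nonempty 𝒴₂]

/-- The two rate conditions differ by the roles of the outputs, so one lemma is applied to `Q` and
to `Q.swapRight`. -/
theorem mem_satoRegion {Q : Kernel 𝒳 (𝒴₁ × 𝒴₂)} [IsMarkovKernel Q] {p : ProbabilityMeasure 𝒳}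
    {R : ℝ × ℝ} (h1 : 0 ≤ R.1) (h2 : 0 ≤ R.2)
    (h1' : ENNReal.ofReal (R.1 * Real.log 2) ≤
      degradedDiv (p : Measure 𝒳) Q.swapRight (outputKernel (p : Measure 𝒳) Q.swapRight))
    (h2' : ENNReal.ofReal (R.2 * Real.log 2) ≤
      degradedDiv (p : Measure 𝒳) Q (outputKernel (p : Measure 𝒳) Q)) :
    R ∈ satoRegion Q p := by
  refine ⟨h1, h2, ?_, ofReal_le_condMutualInfo h2'⟩
  have hs : (p : Measure 𝒳) ⊗ₘ Q.swapRight =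
      ((p : Measure 𝒳) ⊗ₘ Q).map (Prod.map id Prod.swap) := by
    refine Measure.ext_of_lintegral _ fun φ hφ => ?_
    have hm : Measurable (Prod.map id Prod.swap : 𝒳 × 𝒴₁ × 𝒴₂ → 𝒳 × 𝒴₂ × 𝒴₁) := by fun_prop
    rw [lintegral_map hφ hm, Measure.lintegral_compProd hφ,
      Measure.lintegral_compProd (by exact hφ.comp hm)]
    refine lintegral_congr fun x => ?_
    rw [Kernel.swapRight_apply, lintegral_map (by exact hφ.comp measurable_prodMk_left)
      measurable_swap]
    rfl
  have := ofReal_le_condMutualInfo h1'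
  rw [condMutualInfo_map (by fun_prop) (by fun_prop) (by fun_prop) (by fun_prop) hs] at this
  exact this

/-- The outer bound for arbitrary channels, up to the closure of the union. -/
theorem secrecyCapacityRegion_subset_closure {W : Kernel 𝒳 (𝒴₁ × 𝒴₂)} [IsMarkovKernel W]
    {c : 𝒳 → ℝ≥0∞} (hc : Measurable c) {Γ : ℝ≥0∞} (Q : Kernel 𝒳 (𝒴₁ × 𝒴₂)) [IsMarkovKernel Q]
    (hQ : Q ∈ sameMarginals W) :
    secrecyCapacityRegion W c Γ ⊆ closure (⋃ p ∈ admissibleInputs c Γ, satoRegion Q p) := by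
  intro R hR
  obtain ⟨h1, h2, h⟩ := exists_rateBound_of_mem_secrecyCapacityRegion hc hR
  rw [Metric.mem_closure_iff]
  intro δ hδ
  obtain ⟨p, hp, hb1, hb2⟩ := h (δ / 2) (half_pos hδ)
  -- The approximating pair is truncated at zero, since the Sato region contains nonnegative pairs
  -- only.
  have hmax (x : ℝ) {D : ℝ≥0∞} (hD : ENNReal.ofReal (x * Real.log 2) ≤ D) :
      ENNReal.ofReal (max x 0 * Real.log 2) ≤ D := by
    rcases le_total x 0 with hx | hx
    · simp [max_eq_right hx]
    · rwa [max_eq_left hx]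
  refine ⟨(max (R.1 - δ / 2) 0, max (R.2 - δ / 2) 0), Set.mem_biUnion hp (mem_satoRegion
    (le_max_right _ _) (le_max_right _ _) (hmax _ (hb1 _ inferInstance ?_ ?_ _ inferInstance))
    (hmax _ (hb2 Q inferInstance hQ.1 hQ.2 _ inferInstance))), ?_⟩
  · rw [Kernel.fst_swapRight, hQ.2]
  · rw [Kernel.snd_swapRight, hQ.1]
  · rw [Prod.dist_eq, max_lt_iff, Real.dist_eq, Real.dist_eq, abs_lt, abs_lt]
    simp only
    refine ⟨⟨?_, ?_⟩, ⟨?_, ?_⟩⟩ <;>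
      rcases max_choice (R.1 - δ / 2) 0 with e | e <;>
      rcases max_choice (R.2 - δ / 2) 0 with e' | e' <;>
      have := le_max_left (R.1 - δ / 2) 0 <;> have := le_max_left (R.2 - δ / 2) 0 <;>
      rw [e] at * <;> rw [e'] at * <;> linarith

end SatoRegion

/-! ### Finite input alphabets -/

section FiniteAlphabet

open Filter Topology

/-- By the chain rule, giving `ν` the first marginal of `μ` removes exactly the divergence of the
marginals. -/
theorem klDiv_fst_compProd_le {A B : Type*} [MeasurableSpace A] [StandardBorelSpace A] [Nonempty A]
    [MeasurableSpace B] (μ ν : Measure (B × A)) [IsProbabilityMeasure μ] [IsProbabilityMeasure ν]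
    (r : Kernel B A) [IsMarkovKernel r] (h : ν.fst ⊗ₘ r = ν) :
    klDiv μ (μ.fst ⊗ₘ r) ≤ klDiv μ ν := by
  conv_rhs => rw [← h, ← μ.disintegrate μ.condKernel, klDiv_compProd_eq_add]
  rw [μ.disintegrate μ.condKernel]
  exact le_add_self

variable {𝒳 A B : Type*} [MeasurableSpace 𝒳] [MeasurableSpace A] [MeasurableSpace B] [Fintype 𝒳]
  [MeasurableSingletonClass 𝒳]

/-- Finiteness is required at every letter, not only on the support of `p`. The divergence is then a
linear function of the letter probabilities with finite coefficients, hence continuous in `p`. -/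
theorem klDiv_compProd_of_finite {𝒴 : Type*} [MeasurableSpace 𝒴] (p : Measure 𝒳)
    [IsProbabilityMeasure p] (Q η : Kernel 𝒳 𝒴) [IsMarkovKernel Q] [IsMarkovKernel η]
    (h : ∀ x, klDiv (Q x) (η x) ≠ ∞) :
    klDiv (p ⊗ₘ Q) (p ⊗ₘ η) = ENNReal.ofReal (∑ x, p.real {x} * (klDiv (Q x) (η x)).toReal) := by
  set g : 𝒳 → 𝒴 → ℝ≥0∞ := Kernel.rnDeriv Q η with hg
  have hgm : Measurable fun q : 𝒳 × 𝒴 => g q.1 q.2 := Kernel.measurable_rnDeriv Q η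
  have hd (x : 𝒳) : Q x = (η x).withDensity (g x) := by
    rw [← Kernel.withDensity_rnDeriv_eq (klDiv_ne_top_iff.1 (h x)).1, Kernel.withDensity_apply _ hgm]
  have hgx (x : 𝒳) : Measurable (g x) := hgm.comp measurable_prodMk_left
  have hpd : p ⊗ₘ Q = (p ⊗ₘ η).withDensity fun q => g q.1 q.2 := by
    ext s hs
    rw [withDensity_apply _ hs, ← lintegral_indicator hs,
      Measure.lintegral_compProd (hgm.indicator hs), Measure.compProd_apply hs]
    refine lintegral_congr fun x => ?_
    rw [hd x, withDensity_apply _ (measurable_prodMk_left hs),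
      ← lintegral_indicator (measurable_prodMk_left hs)]
    rfl
  have hix (x : 𝒳) : Integrable (fun y => Real.log (g x y).toReal) (Q x) :=
    integrable_log_of_klDiv_ne_top (hgx x) (hd x) (h x)
  have hkx (x : 𝒳) : (klDiv (Q x) (η x)).toReal = ∫ y, Real.log (g x y).toReal ∂Q x := by
    have hac := (klDiv_ne_top_iff.1 (h x)).1
    rw [toReal_klDiv_of_measure_eq hac (by simp), integral_congr_ae (llr_withDensity (hgx x) (hd x))]
  have hi : Integrable (fun q : 𝒳 × 𝒴 => Real.log (g q.1 q.2).toReal) (p ⊗ₘ Q) := by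
    have hm : Measurable fun q : 𝒳 × 𝒴 => Real.log (g q.1 q.2).toReal :=
      Real.measurable_log.comp hgm.ennreal_toReal
    rw [Measure.integrable_compProd_iff hm.aestronglyMeasurable]
    exact ⟨.of_forall hix, .of_finite⟩
  rw [klDiv_withDensity hgm hpd hi, Measure.integral_compProd hi, integral_fintype .of_finite]
  simp_rw [hkx, smul_eq_mul]

/-- The conditional law belonging to `p` itself may give infinite divergence at letters of zero
`p`-mass, which approximating input laws can still use. So `r` is taken from the input law `(1 - t)
p + t u` with `u` uniform. The uniform part dominates `t / N` times each `Q x` and makes all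
divergences finite. The other part dominates `1 - t` times the true output law, so the excess is at
most `-log (1 - t)`. -/
theorem exists_degradation_of_finite [StandardBorelSpace A] [Nonempty A] [Nonempty 𝒳]
    (p : Measure 𝒳) [IsProbabilityMeasure p] (Q : Kernel 𝒳 (B × A)) [IsMarkovKernel Q] {t : ℝ}
    (ht : 0 < t) (ht1 : t < 1) :
    ∃ r : Kernel B A, IsMarkovKernel r ∧ (∀ x, klDiv (Q x) (degraded Q r x) ≠ ∞) ∧
      klDiv ((p ⊗ₘ Q).map (fun ω => ω.2)) ((p ⊗ₘ Q).map (fun ω => ω.2.1) ⊗ₘ r) ≤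
        ENNReal.ofReal (-Real.log (1 - t)) := by
  set u : Measure 𝒳 := uniformOn Set.univ
  have hu : IsProbabilityMeasure u :=
    isProbabilityMeasure_uniformOn Set.finite_univ Set.univ_nonempty
  set N : ℝ := (Fintype.card 𝒳 : ℝ)
  have hN : 0 < N := Nat.cast_pos.2 Fintype.card_pos
  set ν : Measure (B × A) := ENNReal.ofReal (1 - t) • (p ⊗ₘ Q).snd + ENNReal.ofReal t • (u ⊗ₘ Q).snd
    with hν
  have hνp : IsProbabilityMeasure ν := ⟨by
    rw [hν, Measure.add_apply, Measure.smul_apply, Measure.smul_apply, measure_univ, measure_univ,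
      smul_eq_mul, smul_eq_mul, mul_one, mul_one, ← ENNReal.ofReal_add (by linarith) ht.le]
    simp⟩
  refine ⟨ν.condKernel, inferInstance, fun x => ?_, ?_⟩
  · have hux : u {x} = ENNReal.ofReal N⁻¹ := by
      rw [ENNReal.ofReal_inv_of_pos hN]
      simp [u, N, uniformOn_univ]
    have hle : ENNReal.ofReal (t * N⁻¹) • Q x ≤ ν := by
      rw [ENNReal.ofReal_mul ht.le, mul_smul, hν]
      refine le_trans ?_ (Measure.le_add_left le_rfl)
      gcongr
      refine Measure.le_iff.2 fun s hs => ?_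
      rw [Measure.smul_apply, smul_eq_mul, Measure.snd_apply hs,
        Measure.compProd_apply (measurable_snd hs), lintegral_fintype, ← hux, mul_comm]
      exact Finset.single_le_sum (f := fun x => Q x (Prod.mk x ⁻¹' (Prod.snd ⁻¹' s)) * u {x})
        (fun _ _ => zero_le) (Finset.mem_univ x)
    rw [degraded_apply, Kernel.fst_apply]
    refine (lt_of_le_of_lt (klDiv_fst_compProd_le (Q x) ν ν.condKernel
      (ν.disintegrate ν.condKernel)) ?_).ne
    exact (klDiv_le_of_smul_le (by positivity) hle).trans_lt ENNReal.ofReal_lt_top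
  · have h1 : (p ⊗ₘ Q).map (fun ω => ω.2.1) = ((p ⊗ₘ Q).map fun ω => ω.2).fst := by
      rw [Measure.fst, Measure.map_map (by fun_prop) (by fun_prop)]; rfl
    have : IsProbabilityMeasure ((p ⊗ₘ Q).map fun ω => ω.2) :=
      Measure.isProbabilityMeasure_map (by fun_prop)
    rw [h1]
    refine (klDiv_fst_compProd_le _ ν ν.condKernel (ν.disintegrate ν.condKernel)).trans
      (klDiv_le_of_smul_le (by linarith) ?_)
    exact Measure.le_add_right le_rfl

/-- Two limits in order: with `t`, and hence `r`, fixed, the bound passes to `p₀` by continuity;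
then `degradedDiv_eq_add` exchanges `r` for the optimal kernel at the cost `-log (1 - t)`, and `t →
0`. -/
theorem ofReal_le_degradedDiv_of_tendsto [StandardBorelSpace 𝒳] [Nonempty 𝒳] [StandardBorelSpace A]
    [Nonempty A] {p : ℕ → Measure 𝒳} [∀ k, IsProbabilityMeasure (p k)] {p₀ : Measure 𝒳}
    [IsProbabilityMeasure p₀] (hp : ∀ x, Tendsto (fun k => (p k).real {x}) atTop (𝓝 (p₀.real {x})))
    {δ : ℕ → ℝ} (hδ : Tendsto δ atTop (𝓝 0)) {R : ℝ} {Wb : Kernel 𝒳 B} {Wa : Kernel 𝒳 A}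
    (h : ∀ k, RateBound (p k) Wb Wa (R - δ k)) (Q : Kernel 𝒳 (B × A)) [IsMarkovKernel Q]
    (hb : Q.fst = Wb) (ha : Q.snd = Wa) :
    ENNReal.ofReal (R * Real.log 2) ≤ degradedDiv p₀ Q (outputKernel p₀ Q) := by
  have hstep : ∀ t : ℝ, 0 < t → t < 1 → ENNReal.ofReal (R * Real.log 2) ≤
      ENNReal.ofReal (-Real.log (1 - t)) + degradedDiv p₀ Q (outputKernel p₀ Q) := by
    intro t ht ht1
    obtain ⟨r, hr, hfin, hkl⟩ := exists_degradation_of_finite p₀ Q ht ht1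
    have h1 (k : ℕ) : (R - δ k) * Real.log 2 ≤
        ∑ x, (p k).real {x} * (klDiv (Q x) (degraded Q r x)).toReal := by
      have := h k Q inferInstance hb ha r hr
      rw [degradedDiv, klDiv_compProd_of_finite _ _ _ hfin] at this
      exact (ENNReal.ofReal_le_ofReal_iff (by positivity)).1 this
    have h2 : R * Real.log 2 ≤ ∑ x, p₀.real {x} * (klDiv (Q x) (degraded Q r x)).toReal := by
      refine le_of_tendsto_of_tendsto' (f := fun k => (R - δ k) * Real.log 2) ?_
        (tendsto_finsetSum _ fun x _ => (hp x).mul_const _) h1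
      simpa using (hδ.const_sub R).mul_const (Real.log 2)
    calc ENNReal.ofReal (R * Real.log 2) ≤ degradedDiv p₀ Q r := by
          rw [degradedDiv, klDiv_compProd_of_finite _ _ _ hfin]
          exact ENNReal.ofReal_le_ofReal h2
      _ ≤ _ := by
          rw [degradedDiv_eq_add]
          gcongr
  have hlim : Tendsto (fun t : ℝ => ENNReal.ofReal (-Real.log (1 - t)) +
      degradedDiv p₀ Q (outputKernel p₀ Q)) (𝓝[>] 0)
      (𝓝 (0 + degradedDiv p₀ Q (outputKernel p₀ Q))) := by
    refine Tendsto.add ?_ tendsto_const_nhds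
    have : ContinuousAt (fun t : ℝ => ENNReal.ofReal (-Real.log (1 - t))) 0 := by
      refine ENNReal.continuous_ofReal.continuousAt.comp (ContinuousAt.neg ?_)
      exact ContinuousAt.log (by fun_prop) (by simp)
    have := this.tendsto
    simp only [sub_zero, Real.log_one, neg_zero, ENNReal.ofReal_zero] at this
    exact this.mono_left nhdsWithin_le_nhds
  rw [zero_add] at hlim
  refine ge_of_tendsto hlim ?_
  filter_upwards [self_mem_nhdsWithin, nhdsWithin_le_nhds (eventually_lt_nhds one_pos)] with t h1 h2
    using hstep t h1 h2

theorem exists_subseq_tendsto_of_finite (p : ℕ → Measure 𝒳) [∀ k, IsProbabilityMeasure (p k)] :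
    ∃ (p₀ : Measure 𝒳) (φ : ℕ → ℕ), IsProbabilityMeasure p₀ ∧ StrictMono φ ∧
      ∀ x, Tendsto (fun k => (p (φ k)).real {x}) atTop (𝓝 (p₀.real {x})) := by
  have hmem (k : ℕ) : (fun x => (p k).real {x}) ∈ stdSimplex ℝ 𝒳 :=
    ⟨fun _ => measureReal_nonneg, by rw [sum_measureReal_singleton]; simp⟩
  obtain ⟨w, hw, φ, hφ, hlim⟩ := (isCompact_stdSimplex ℝ 𝒳).tendsto_subseq hmem
  set p₀ : Measure 𝒳 := ∑ x, ENNReal.ofReal (w x) • Measure.dirac x with hp₀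
  have hsing (x : 𝒳) : p₀ {x} = ENNReal.ofReal (w x) := by
    classical
    simp [hp₀, Measure.coe_finsetSum, Finset.sum_apply, Set.indicator_apply]
  refine ⟨p₀, φ, ⟨?_⟩, hφ, fun x => ?_⟩
  · simp [hp₀, Measure.coe_finsetSum, Finset.sum_apply,
      ← ENNReal.ofReal_sum_of_nonneg fun x _ => hw.1 x, hw.2]
  · rw [measureReal_def, hsing, ENNReal.toReal_ofReal (hw.1 x)]
    exact (tendsto_pi_nhds.1 hlim) x

theorem lintegral_le_of_tendsto {p : ℕ → Measure 𝒳} [∀ k, IsProbabilityMeasure (p k)]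
    {p₀ : Measure 𝒳} [IsProbabilityMeasure p₀]
    (hp : ∀ x, Tendsto (fun k => (p k).real {x}) atTop (𝓝 (p₀.real {x}))) {c : 𝒳 → ℝ≥0∞}
    {Γ : ℝ≥0∞} (h : ∀ k, ∫⁻ x, c x ∂p k ≤ Γ) : ∫⁻ x, c x ∂p₀ ≤ Γ := by
  classical
  have hp' (x : 𝒳) : Tendsto (fun k => p k {x}) atTop (𝓝 (p₀ {x})) := by
    have := ENNReal.tendsto_ofReal (hp x)
    simpa [measureReal_def] using this
  simp only [lintegral_fintype] at h ⊢
  -- Letters of zero limit mass are dropped: if `c x = ∞`, the product `c x * p k {x}` need not tend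
  -- to `∞ * 0 = 0`. Dropping them only lowers the cost.
  have hs : Tendsto (fun k => ∑ x, if p₀ {x} = 0 then 0 else c x * p k {x}) atTop
      (𝓝 (∑ x, c x * p₀ {x})) := by
    refine tendsto_finsetSum _ fun x _ => ?_
    split_ifs with h0
    · simp [h0]
    · exact ENNReal.Tendsto.const_mul (hp' x) (.inl h0)
  refine le_of_tendsto' hs fun k => (Finset.sum_le_sum fun x _ => ?_).trans (h k)
  split_ifs <;> simp

end FiniteAlphabet

section FiniteAlphabet

open Filter Topology

variable {𝒳 𝒴₁ 𝒴₂ : Type*} [MeasurableSpace 𝒳] [MeasurableSpace 𝒴₁] [MeasurableSpace 𝒴₂]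
  [StandardBorelSpace 𝒳] [Nonempty 𝒳] [StandardBorelSpace 𝒴₁] [Nonempty 𝒴₁]
  [StandardBorelSpace 𝒴₂] [Nonempty 𝒴₂]

/-- The outer bound for finite input alphabets. -/
theorem secrecyCapacityRegion_subset_of_finite [Finite 𝒳] {W : Kernel 𝒳 (𝒴₁ × 𝒴₂)}
    [IsMarkovKernel W] (c : 𝒳 → ℝ≥0∞) (Γ : ℝ≥0∞) (Q : Kernel 𝒳 (𝒴₁ × 𝒴₂)) [IsMarkovKernel Q]
    (hQ : Q ∈ sameMarginals W) :
    secrecyCapacityRegion W c Γ ⊆ ⋃ p ∈ admissibleInputs c Γ, satoRegion Q p := by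
  intro R hR
  have := Fintype.ofFinite 𝒳
  obtain ⟨h1, h2, h⟩ := exists_rateBound_of_mem_secrecyCapacityRegion (c := c) .of_discrete hR
  choose p hp hb1 hb2 using fun k : ℕ => h (1 / ((k : ℝ) + 1)) (by positivity)
  obtain ⟨p₀, φ, hp₀, hφ, hlim⟩ := exists_subseq_tendsto_of_finite fun k => (p k : Measure 𝒳)
  have hδ : Tendsto (fun k => 1 / ((φ k : ℝ) + 1)) atTop (𝓝 0) :=
    tendsto_one_div_add_atTop_nhds_zero_nat.comp hφ.tendsto_atTop
  refine Set.mem_biUnion (x := (⟨p₀, hp₀⟩ : ProbabilityMeasure 𝒳))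
    (lintegral_le_of_tendsto hlim fun k => hp (φ k)) (mem_satoRegion h1 h2 ?_ ?_)
  · exact ofReal_le_degradedDiv_of_tendsto hlim hδ (fun k => hb1 (φ k)) Q.swapRight
      (by rw [Kernel.fst_swapRight, hQ.2]) (by rw [Kernel.snd_swapRight, hQ.1])
  · exact ofReal_le_degradedDiv_of_tendsto hlim hδ (fun k => hb2 (φ k)) Q hQ.1 hQ.2

end FiniteAlphabet

/-! ### Complex Gaussian laws -/

section ComplexGaussian

theorem measurableEquivRealProd_symm_eq (p : ℝ × ℝ) :
    Complex.measurableEquivRealProd.symm p = ⟨p.1, p.2⟩ := rfl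

theorem map_re_complexGaussian :
    complexGaussian.map Complex.re = gaussianReal 0 (1 / 2) := by
  have : complexGaussian.map Complex.re =
      ((gaussianReal 0 (1 / 2)).prod (gaussianReal 0 (1 / 2))).fst := by
    rw [complexGaussian, Measure.map_map (by fun_prop) (by fun_prop)]; rfl
  rw [this, Measure.fst_prod]

theorem map_im_complexGaussian :
    complexGaussian.map Complex.im = gaussianReal 0 (1 / 2) := by
  have : complexGaussian.map Complex.im =
      ((gaussianReal 0 (1 / 2)).prod (gaussianReal 0 (1 / 2))).snd := by
    rw [complexGaussian, Measure.map_map (by fun_prop) (by fun_prop)]; rfl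
  rw [this, Measure.snd_prod]

theorem integral_sq_gaussianReal (v : ℝ≥0) :
    Integrable (fun x : ℝ => x ^ 2) (gaussianReal 0 v) ∧ ∫ x, x ^ 2 ∂gaussianReal 0 v = v := by
  have h2 : MemLp id 2 (gaussianReal 0 v) := memLp_id_gaussianReal' 2 (by simp)
  refine ⟨h2.integrable_sq, ?_⟩
  have := variance_id_gaussianReal (μ := 0) (v := v)
  rw [variance_eq_integral aemeasurable_id] at this
  simpa using this

theorem integrable_re_complexGaussian : Integrable Complex.re complexGaussian := by
  have h : Integrable id (gaussianReal 0 (1 / 2)) := (memLp_id_gaussianReal 1).integrable (by simp)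
  rw [← map_re_complexGaussian] at h
  exact h.comp_measurable Complex.measurable_re

theorem integrable_im_complexGaussian : Integrable Complex.im complexGaussian := by
  have h : Integrable id (gaussianReal 0 (1 / 2)) := (memLp_id_gaussianReal 1).integrable (by simp)
  rw [← map_im_complexGaussian] at h
  exact h.comp_measurable Complex.measurable_im

theorem integral_re_complexGaussian : ∫ z, z.re ∂complexGaussian = 0 := by
  have h := integral_id_gaussianReal (μ := 0) (v := 1 / 2)
  rwa [← map_re_complexGaussian, integral_map (by fun_prop) (by fun_prop)] at h

theorem integral_im_complexGaussian : ∫ z, z.im ∂complexGaussian = 0 := by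
  have h := integral_id_gaussianReal (μ := 0) (v := 1 / 2)
  rwa [← map_im_complexGaussian, integral_map (by fun_prop) (by fun_prop)] at h

theorem integral_norm_sq_complexGaussian :
    Integrable (fun z : ℂ => ‖z‖ ^ 2) complexGaussian ∧ ∫ z, ‖z‖ ^ 2 ∂complexGaussian = 1 := by
  obtain ⟨hi, he⟩ := integral_sq_gaussianReal (1 / 2)
  have hir : Integrable (fun z : ℂ => z.re ^ 2) complexGaussian := by
    rw [← map_re_complexGaussian] at hi
    exact hi.comp_measurable Complex.measurable_re
  have hii : Integrable (fun z : ℂ => z.im ^ 2) complexGaussian := by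
    rw [← map_im_complexGaussian] at hi
    exact hi.comp_measurable Complex.measurable_im
  have her : ∫ z, z.re ^ 2 ∂complexGaussian = 1 / 2 := by
    rw [← map_re_complexGaussian, integral_map (by fun_prop) (by fun_prop)] at he
    simpa using he
  have hei : ∫ z, z.im ^ 2 ∂complexGaussian = 1 / 2 := by
    rw [← map_im_complexGaussian, integral_map (by fun_prop) (by fun_prop)] at he
    simpa using he
  have hn : (fun z : ℂ => ‖z‖ ^ 2) = fun z => z.re ^ 2 + z.im ^ 2 := by
    funext z; rw [Complex.sq_norm, Complex.normSq_apply]; ring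
  rw [hn]
  refine ⟨hir.add hii, ?_⟩
  rw [integral_add hir hii, her, hei]; norm_num

theorem norm_sq_add_mul (c e z : ℂ) : ‖c + e * z‖ ^ 2 =
    ‖c‖ ^ 2 + 2 * ((starRingEnd ℂ c * e).re * z.re - (starRingEnd ℂ c * e).im * z.im) +
      ‖e‖ ^ 2 * ‖z‖ ^ 2 := by
  simp only [Complex.sq_norm, Complex.normSq_apply, Complex.add_re, Complex.add_im, Complex.mul_re,
    Complex.mul_im, Complex.conj_re, Complex.conj_im]
  ring

theorem lintegral_norm_sq_add_mul (c e : ℂ) :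
    ∫⁻ z, ENNReal.ofReal (‖c + e * z‖ ^ 2) ∂complexGaussian =
      ENNReal.ofReal (‖c‖ ^ 2 + ‖e‖ ^ 2) := by
  obtain ⟨hi, he⟩ := integral_norm_sq_complexGaussian
  have h1 : Integrable (fun z : ℂ => 2 * ((starRingEnd ℂ c * e).re * z.re -
      (starRingEnd ℂ c * e).im * z.im)) complexGaussian :=
    ((integrable_re_complexGaussian.const_mul _).sub
      (integrable_im_complexGaussian.const_mul _)).const_mul _
  have h2 : Integrable (fun z : ℂ => ‖c‖ ^ 2 + 2 * ((starRingEnd ℂ c * e).re * z.re -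
      (starRingEnd ℂ c * e).im * z.im)) complexGaussian := (integrable_const _).add h1
  have h3 : Integrable (fun z : ℂ => ‖c + e * z‖ ^ 2) complexGaussian := by
    simp_rw [norm_sq_add_mul]
    exact h2.add (hi.const_mul _)
  rw [← ofReal_integral_eq_lintegral_ofReal h3 (.of_forall fun _ => by positivity)]
  congr 1
  simp_rw [norm_sq_add_mul]
  rw [integral_add h2 (hi.const_mul _), integral_add (integrable_const _) h1,
    integral_const_mul, integral_const_mul, he, integral_sub
    (integrable_re_complexGaussian.const_mul _) (integrable_im_complexGaussian.const_mul _),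
    integral_const_mul, integral_const_mul, integral_re_complexGaussian,
    integral_im_complexGaussian]
  simp

/-- The circularly symmetric complex Gaussian law of mean `m` and variance `s`. -/
def complexNormal (m : ℂ) (s : ℝ) : Measure ℂ :=
  complexGaussian.map fun z => m + (√s : ℝ) * z

instance (m : ℂ) (s : ℝ) : IsProbabilityMeasure (complexNormal m s) :=
  Measure.isProbabilityMeasure_map (by fun_prop)

theorem lintegral_complexNormal (m : ℂ) (s : ℝ) {φ : ℂ → ℝ≥0∞} (hφ : Measurable φ) :
    ∫⁻ y, φ y ∂complexNormal m s = ∫⁻ z, φ (m + (√s : ℝ) * z) ∂complexGaussian := by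
  rw [complexNormal, lintegral_map hφ (by fun_prop)]

theorem complexNormal_eq_map_prod (m : ℂ) {s : ℝ} (hs : 0 ≤ s) :
    complexNormal m s = ((gaussianReal m.re (s / 2).toNNReal).prod
      (gaussianReal m.im (s / 2).toNNReal)).map Complex.measurableEquivRealProd.symm := by
  have hg (c : ℝ) : (gaussianReal 0 (1 / 2)).map (fun x => c + √s * x) =
      gaussianReal c (s / 2).toNNReal := by
    have : (fun x => c + √s * x) = (fun x => c + x) ∘ fun x => √s * x := rfl
    rw [this, ← Measure.map_map (by fun_prop) (by fun_prop), gaussianReal_map_const_mul,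
      gaussianReal_map_const_add]
    congr 1
    · ring
    · ext
      simp [Real.sq_sqrt hs, Real.coe_toNNReal _ (div_nonneg hs zero_le_two)]
      ring
  rw [← hg m.re, ← hg m.im, Measure.map_prod_map _ _ (by fun_prop) (by fun_prop),
    Measure.map_map (by fun_prop) (by fun_prop), complexNormal, complexGaussian,
    Measure.map_map (by fun_prop) (by fun_prop)]
  congr 1
  funext p
  apply Complex.ext <;> simp

/-- The density of a complex Gaussian law. -/
def complexNormalPDF (m : ℂ) (s : ℝ) (y : ℂ) : ℝ :=
  (Real.pi * s)⁻¹ * Real.exp (-‖y - m‖ ^ 2 / s)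

theorem complexNormalPDF_eq_mul (m : ℂ) {s : ℝ} (hs : 0 < s) (y : ℂ) :
    complexNormalPDF m s y = gaussianPDFReal m.re (s / 2).toNNReal y.re *
      gaussianPDFReal m.im (s / 2).toNNReal y.im := by
  have h2 : 2 * (s / 2) = s := by ring
  have h3 : 2 * Real.pi * (s / 2) = Real.pi * s := by ring
  simp only [complexNormalPDF, gaussianPDFReal, Real.coe_toNNReal _ (half_pos hs).le, h2, h3]
  rw [Complex.sq_norm, Complex.normSq_apply]
  have : (√(Real.pi * s))⁻¹ * Real.exp (-(y.re - m.re) ^ 2 / s) *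
      ((√(Real.pi * s))⁻¹ * Real.exp (-(y.im - m.im) ^ 2 / s)) =
      (√(Real.pi * s) * √(Real.pi * s))⁻¹ *
        (Real.exp (-(y.re - m.re) ^ 2 / s) * Real.exp (-(y.im - m.im) ^ 2 / s)) := by
    rw [mul_inv]; ring
  rw [this, Real.mul_self_sqrt (by positivity), ← Real.exp_add]
  congr 2
  simp only [Complex.sub_re, Complex.sub_im]
  ring

theorem complexNormal_eq_withDensity (m : ℂ) {s : ℝ} (hs : 0 < s) :
    complexNormal m s = volume.withDensity fun y => ENNReal.ofReal (complexNormalPDF m s y) := by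
  have hv : (s / 2).toNNReal ≠ 0 := by simpa using hs
  have hpm : Measurable fun y => ENNReal.ofReal (complexNormalPDF m s y) := by
    unfold complexNormalPDF; fun_prop
  refine Measure.ext_of_lintegral _ fun φ hφ => ?_
  rw [complexNormal_eq_map_prod m hs.le, lintegral_map hφ (by fun_prop),
    gaussianReal_of_var_ne_zero _ hv, gaussianReal_of_var_ne_zero _ hv,
    prod_withDensity (measurable_gaussianPDF _ _) (measurable_gaussianPDF _ _),
    lintegral_withDensity_eq_lintegral_mul _ (by fun_prop) (by fun_prop),
    lintegral_withDensity_eq_lintegral_mul _ hpm hφ,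
    ← (Complex.volume_preserving_equiv_real_prod.symm).lintegral_comp (hpm.mul hφ)]
  refine lintegral_congr fun p => ?_
  simp only [Pi.mul_apply, complexNormalPDF_eq_mul m hs, gaussianPDF,
    measurableEquivRealProd_symm_eq]
  rw [ENNReal.ofReal_mul (gaussianPDFReal_nonneg _ _ _)]

/-- The log-density of `complexNormal m₁ d` with respect to `complexNormal m₂ s`. -/
theorem complexNormal_eq_withDensity_complexNormal (m₁ m₂ : ℂ) {d s : ℝ} (hd : 0 < d)
    (hs : 0 < s) :
    complexNormal m₁ d = (complexNormal m₂ s).withDensity fun y =>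
      ENNReal.ofReal (Real.exp (Real.log (s / d) - ‖y - m₁‖ ^ 2 / d + ‖y - m₂‖ ^ 2 / s)) := by
  have hpm (m : ℂ) (s : ℝ) : Measurable fun y => ENNReal.ofReal (complexNormalPDF m s y) := by
    unfold complexNormalPDF; fun_prop
  rw [complexNormal_eq_withDensity m₁ hd, complexNormal_eq_withDensity m₂ hs,
    ← withDensity_mul _ (hpm m₂ s) (by fun_prop)]
  congr 1
  funext y
  rw [Pi.mul_apply, ← ENNReal.ofReal_mul (by unfold complexNormalPDF; positivity)]
  congr 1
  rw [Real.exp_add, Real.exp_sub, Real.exp_log (by positivity), complexNormalPDF, complexNormalPDF,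
    neg_div, neg_div, Real.exp_neg, Real.exp_neg]
  have h1 := Real.exp_pos (‖y - m₁‖ ^ 2 / d)
  have h2 := Real.exp_pos (‖y - m₂‖ ^ 2 / s)
  have := Real.pi_pos
  field_simp

/-- Completing the square: the integrand times the density is a constant times the density of mean
`2vc/(d+2v)` and variance `vd/(d+2v)`. The factors 2 appear because `exp (-x²/d)` belongs to
variance `d/2`. Variance zero is a point mass and is treated separately. -/
theorem lintegral_exp_gaussianReal (c : ℝ) (v : ℝ≥0) {d : ℝ} (hd : 0 < d) :
    ∫⁻ x, ENNReal.ofReal (Real.exp (-(c - x) ^ 2 / d)) ∂gaussianReal 0 v =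
      ENNReal.ofReal (√(d / (d + 2 * v)) * Real.exp (-c ^ 2 / (d + 2 * v))) := by
  have hm : Measurable fun x => ENNReal.ofReal (Real.exp (-(c - x) ^ 2 / d)) := by fun_prop
  rcases eq_or_ne v 0 with rfl | hv
  · simp [gaussianReal_zero_var, lintegral_dirac' _ hm, hd.ne']
  have hv' : (0 : ℝ) < v := NNReal.coe_pos.2 (pos_iff_ne_zero.2 hv)
  have hs : 0 < d + 2 * (v : ℝ) := by positivity
  set v' : ℝ≥0 := (v * d / (d + 2 * v)).toNNReal with hv'd
  have hv'c : (v' : ℝ) = v * d / (d + 2 * v) := Real.coe_toNNReal _ (by positivity)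
  have hv'0 : v' ≠ 0 := by
    rw [← NNReal.coe_ne_zero, hv'c]; positivity
  rw [gaussianReal_of_var_ne_zero _ hv,
    lintegral_withDensity_eq_lintegral_mul _ (measurable_gaussianPDF _ _) hm]
  have hpt (x : ℝ) : (gaussianPDF 0 v * fun x => ENNReal.ofReal (Real.exp (-(c - x) ^ 2 / d))) x =
      ENNReal.ofReal (√(d / (d + 2 * v)) * Real.exp (-c ^ 2 / (d + 2 * v))) *
        gaussianPDF (2 * v * c / (d + 2 * v)) v' x := by
    rw [Pi.mul_apply, gaussianPDF, gaussianPDF, ← ENNReal.ofReal_mul (gaussianPDFReal_nonneg _ _ _),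
      ← ENNReal.ofReal_mul (by positivity)]
    congr 1
    rw [gaussianPDFReal, gaussianPDFReal, hv'c]
    have e1 : √(d / (d + 2 * v)) * (√(2 * Real.pi * (v * d / (d + 2 * v))))⁻¹ =
        (√(2 * Real.pi * v))⁻¹ := by
      rw [← Real.sqrt_inv, ← Real.sqrt_inv, ← Real.sqrt_mul (by positivity)]
      congr 1
      have := Real.pi_pos
      field_simp
    have e2 : -(x - 0) ^ 2 / (2 * v) + -(c - x) ^ 2 / d = -c ^ 2 / (d + 2 * v) +
        -(x - 2 * v * c / (d + 2 * v)) ^ 2 / (2 * (v * d / (d + 2 * v))) := by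
      field_simp
      ring
    rw [mul_assoc, ← Real.exp_add, e2, ← e1, Real.exp_add]
    ring
  rw [lintegral_congr hpt, lintegral_const_mul _ (measurable_gaussianPDF _ _),
    lintegral_gaussianPDF_eq_one _ hv'0, mul_one]

theorem lintegral_exp_complexNormal (c : ℂ) {d t : ℝ} (hd : 0 < d) (ht : 0 ≤ t) :
    ∫⁻ y, ENNReal.ofReal (Real.exp (-‖c - y‖ ^ 2 / d)) ∂complexNormal 0 t =
      ENNReal.ofReal (d / (d + t) * Real.exp (-‖c‖ ^ 2 / (d + t))) := by
  have hm : Measurable fun y : ℂ => ENNReal.ofReal (Real.exp (-‖c - y‖ ^ 2 / d)) := by fun_prop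
  have hpt (p : ℝ × ℝ) :
      ENNReal.ofReal (Real.exp (-‖c - Complex.measurableEquivRealProd.symm p‖ ^ 2 / d)) =
      ENNReal.ofReal (Real.exp (-(c.re - p.1) ^ 2 / d)) *
        ENNReal.ofReal (Real.exp (-(c.im - p.2) ^ 2 / d)) := by
    rw [← ENNReal.ofReal_mul (Real.exp_pos _).le, ← Real.exp_add, Complex.sq_norm,
      Complex.normSq_apply, measurableEquivRealProd_symm_eq]
    congr 2
    simp only [Complex.sub_re, Complex.sub_im]
    ring
  have h2 : d + 2 * ((t / 2).toNNReal : ℝ) = d + t := by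
    rw [Real.coe_toNNReal _ (by positivity)]; ring
  rw [complexNormal_eq_map_prod 0 ht, lintegral_map hm (by fun_prop), lintegral_congr hpt,
    lintegral_prod_mul (f := fun x : ℝ => ENNReal.ofReal (Real.exp (-(c.re - x) ^ 2 / d)))
      (g := fun y : ℝ => ENNReal.ofReal (Real.exp (-(c.im - y) ^ 2 / d)))
      (by fun_prop) (by fun_prop), Complex.zero_re, Complex.zero_im,
    lintegral_exp_gaussianReal _ _ hd, lintegral_exp_gaussianReal _ _ hd, h2,
    ← ENNReal.ofReal_mul (by positivity)]
  congr 1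
  have h3 : √(d / (d + t)) * √(d / (d + t)) = d / (d + t) := Real.mul_self_sqrt (by positivity)
  rw [mul_mul_mul_comm, h3, ← Real.exp_add, Complex.sq_norm, Complex.normSq_apply]
  congr 2
  ring

theorem charFunDual_complexGaussian (ℓ : StrongDual ℝ ℂ) :
    charFunDual complexGaussian ℓ = Complex.exp (-((ℓ 1 ^ 2 + ℓ Complex.I ^ 2 : ℝ) : ℂ) / 4) := by
  have hℓ (p : ℝ × ℝ) :
      ℓ (Complex.measurableEquivRealProd.symm p) = p.1 * ℓ 1 + p.2 * ℓ Complex.I := by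
    have : Complex.measurableEquivRealProd.symm p = p.1 • (1 : ℂ) + p.2 • Complex.I := by
      apply Complex.ext <;> simp
    rw [this, map_add, map_smul, map_smul, smul_eq_mul, smul_eq_mul]
  have hint : charFunDual complexGaussian ℓ = ∫ p : ℝ × ℝ,
      Complex.exp (p.1 * ℓ 1 * Complex.I) * Complex.exp (p.2 * ℓ Complex.I * Complex.I)
        ∂((gaussianReal 0 (1 / 2)).prod (gaussianReal 0 (1 / 2))) := by
    rw [charFunDual_apply, complexGaussian, integral_map (by fun_prop)
      (by fun_prop)]
    refine integral_congr_ae (.of_forall fun p => ?_)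
    simp only
    rw [hℓ, ← Complex.exp_add]
    push_cast
    ring_nf
  have h1 (t : ℝ) : ∫ x : ℝ, Complex.exp (x * t * Complex.I) ∂gaussianReal 0 (1 / 2) =
      Complex.exp (-(t : ℂ) ^ 2 / 4) := by
    have := charFun_gaussianReal (μ := 0) (v := 1 / 2) t
    rw [charFun_apply_real] at this
    simp only [mul_comm (t : ℂ)] at this
    rw [this]
    congr 1
    push_cast
    ring
  rw [hint, integral_prod_mul (fun x : ℝ => Complex.exp (x * ℓ 1 * Complex.I))
    (fun x : ℝ => Complex.exp (x * ℓ Complex.I * Complex.I)), h1, h1, ← Complex.exp_add]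
  push_cast
  ring_nf

end ComplexGaussian

/-! ### Linear images of independent complex Gaussian variables -/

section LinearImages

/-- This is the exponent contributed to a characteristic function by one circularly symmetric
variable entering two combinations with coefficients `α` and `β`. The cross term involves only `α *
conj β`, so it sums to zero for uncorrelated combinations. -/
theorem StrongDual.apply_mul_sq_add (ℓ ℓ' : StrongDual ℝ ℂ) (α β : ℂ) :
    (ℓ α + ℓ' β) ^ 2 + (ℓ (α * Complex.I) + ℓ' (β * Complex.I)) ^ 2 =
      ‖α‖ ^ 2 * (ℓ 1 ^ 2 + ℓ Complex.I ^ 2) + ‖β‖ ^ 2 * (ℓ' 1 ^ 2 + ℓ' Complex.I ^ 2) +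
      2 * ((α * starRingEnd ℂ β).re * (ℓ 1 * ℓ' 1 + ℓ Complex.I * ℓ' Complex.I) +
        (α * starRingEnd ℂ β).im * (ℓ Complex.I * ℓ' 1 - ℓ 1 * ℓ' Complex.I)) := by
  have key (f : StrongDual ℝ ℂ) (z : ℂ) : f z = z.re * f 1 + z.im * f Complex.I := by
    have : z = z.re • (1 : ℂ) + z.im • Complex.I := by apply Complex.ext <;> simp
    conv_lhs => rw [this]
    rw [map_add, map_smul, map_smul, smul_eq_mul, smul_eq_mul]
  rw [key ℓ α, key ℓ (α * Complex.I), key ℓ' β, key ℓ' (β * Complex.I), Complex.sq_norm,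
    Complex.sq_norm, Complex.normSq_apply, Complex.normSq_apply]
  simp only [Complex.mul_re, Complex.mul_im, Complex.I_re, Complex.I_im, Complex.conj_re,
    Complex.conj_im]
  ring

theorem charFunDual_complexNormal_zero {s : ℝ} (hs : 0 ≤ s) (ℓ : StrongDual ℝ ℂ) :
    charFunDual (complexNormal 0 s) ℓ =
      Complex.exp (-((s * (ℓ 1 ^ 2 + ℓ Complex.I ^ 2) : ℝ) : ℂ) / 4) := by
  have h : (fun z : ℂ => (0 : ℂ) + (√s : ℝ) * z) = (√s • ContinuousLinearMap.id ℝ ℂ : ℂ →L[ℝ] ℂ) := by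
    funext z; simp
  rw [complexNormal, h, charFunDual_map, charFunDual_complexGaussian]
  congr 4
  simp [mul_pow, Real.sq_sqrt hs]
  ring

/-- The real-linear map `(z, z₀) ↦ (∑ αⱼ zⱼ + α₀ z₀, ∑ βⱼ zⱼ + β₀ z₀)`. -/
def pairCombination {ι : Type*} [Fintype ι] (α β : ι → ℂ) (α₀ β₀ : ℂ) :
    (ι → ℂ) × ℂ →L[ℝ] ℂ × ℂ :=
  ((∑ j, α j • (ContinuousLinearMap.proj (R := ℂ) j ∘L ContinuousLinearMap.fst ℂ (ι → ℂ) ℂ) +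
      α₀ • ContinuousLinearMap.snd ℂ (ι → ℂ) ℂ).prod
    (∑ j, β j • (ContinuousLinearMap.proj (R := ℂ) j ∘L ContinuousLinearMap.fst ℂ (ι → ℂ) ℂ) +
      β₀ • ContinuousLinearMap.snd ℂ (ι → ℂ) ℂ)).restrictScalars ℝ

theorem pairCombination_apply {ι : Type*} [Fintype ι] (α β : ι → ℂ) (α₀ β₀ : ℂ)
    (q : (ι → ℂ) × ℂ) : pairCombination α β α₀ β₀ q =
      (∑ j, α j * q.1 j + α₀ * q.2, ∑ j, β j * q.1 j + β₀ * q.2) := by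
  simp [pairCombination]

/-- Two uncorrelated linear combinations of independent standard complex Gaussian variables are
independent complex Gaussian variables. -/
theorem map_pairCombination {ι : Type*} [Fintype ι] (α β : ι → ℂ) (α₀ β₀ : ℂ)
    (h : ∑ j, α j * starRingEnd ℂ (β j) + α₀ * starRingEnd ℂ β₀ = 0) :
    ((Measure.pi fun _ : ι => complexGaussian).prod complexGaussian).map
      (fun q => (∑ j, α j * q.1 j + α₀ * q.2, ∑ j, β j * q.1 j + β₀ * q.2)) =
    (complexNormal 0 (∑ j, ‖α j‖ ^ 2 + ‖α₀‖ ^ 2)).prod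
      (complexNormal 0 (∑ j, ‖β j‖ ^ 2 + ‖β₀‖ ^ 2)) := by
  classical
  simp_rw [← pairCombination_apply]
  refine Measure.ext_of_charFunDual (funext fun ℓ => ?_)
  rw [charFunDual_map, charFunDual_prod, charFunDual_prod, charFunDual_pi,
    charFunDual_complexNormal_zero (by positivity), charFunDual_complexNormal_zero (by positivity)]
  simp_rw [charFunDual_complexGaussian]
  rw [← Complex.exp_sum, ← Complex.exp_add, ← Complex.exp_add]
  congr 1
  set ℓ₁ := ℓ ∘SL ContinuousLinearMap.inl ℝ ℂ ℂ
  set ℓ₂ := ℓ ∘SL ContinuousLinearMap.inr ℝ ℂ ℂ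
  have hℓ (p : ℂ × ℂ) : ℓ p = ℓ₁ p.1 + ℓ₂ p.2 := by
    simp [ℓ₁, ℓ₂, ← map_add]
  have hj (j : ι) (z : ℂ) : ((ℓ ∘SL pairCombination α β α₀ β₀) ∘SL
      ContinuousLinearMap.inl ℝ (ι → ℂ) ℂ ∘SL ContinuousLinearMap.single ℝ (fun _ => ℂ) j) z =
      ℓ₁ (α j * z) + ℓ₂ (β j * z) := by
    simp [pairCombination_apply, hℓ, Pi.single_apply]
  have h0 (z : ℂ) : ((ℓ ∘SL pairCombination α β α₀ β₀) ∘SL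
      ContinuousLinearMap.inr ℝ (ι → ℂ) ℂ) z = ℓ₁ (α₀ * z) + ℓ₂ (β₀ * z) := by
    simp [pairCombination_apply, hℓ]
  have hre := congrArg Complex.re h
  have him := congrArg Complex.im h
  simp only [Complex.add_re, Complex.add_im, Complex.re_sum, Complex.im_sum, Complex.zero_re,
    Complex.zero_im] at hre him
  simp only [ContinuousLinearMap.comp_assoc, h0] at hj h0 ⊢
  simp only [hj, mul_one, StrongDual.apply_mul_sq_add]
  rw [← Finset.sum_div, ← add_div, ← add_div, Finset.sum_neg_distrib, ← neg_add, ← neg_add,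
    ← Complex.ofReal_sum, ← Complex.ofReal_add, ← Complex.ofReal_add]
  congr 3
  simp only [Finset.sum_add_distrib, ← Finset.mul_sum, ← Finset.sum_mul]
  linear_combination 2 * (ℓ₁ 1 * ℓ₂ 1 + ℓ₁ Complex.I * ℓ₂ Complex.I) * hre +
    2 * (ℓ₁ Complex.I * ℓ₂ 1 - ℓ₁ 1 * ℓ₂ Complex.I) * him

theorem map_sum_complexGaussian {ι : Type*} [Fintype ι] (α : ι → ℂ) :
    (Measure.pi fun _ : ι => complexGaussian).map (fun q => ∑ j, α j * q j) =
      complexNormal 0 (∑ j, ‖α j‖ ^ 2) := by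
  have h := congrArg Measure.fst (map_pairCombination α 0 0 0 (by simp))
  rw [Measure.fst_prod, Measure.fst, Measure.map_map (by fun_prop) (by fun_prop)] at h
  simp only [norm_zero, ne_eq, OfNat.ofNat_ne_zero, not_false_eq_true, zero_pow, add_zero] at h
  rw [← h]
  have h2 : (Prod.fst ∘ fun q : (ι → ℂ) × ℂ => (∑ j, α j * q.1 j + 0 * q.2,
      ∑ j, (0 : ι → ℂ) j * q.1 j + 0 * q.2)) = (fun q => ∑ j, α j * q j) ∘ Prod.fst := by
    funext q; simp
  rw [h2, ← Measure.map_map (by fun_prop) (by fun_prop)]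
  congr 1
  exact (Measure.fst_prod (μ := Measure.pi fun _ : ι => complexGaussian)
    (ν := complexGaussian)).symm

theorem map_add_mul_complexGaussian {ρ τ : ℂ} (h : ‖ρ‖ ^ 2 + ‖τ‖ ^ 2 = 1) :
    (complexGaussian.prod complexGaussian).map (fun q => ρ * q.1 + τ * q.2) = complexGaussian := by
  have hL : (fun q : ℂ × ℂ => ρ * q.1 + τ * q.2) = ((ρ • ContinuousLinearMap.fst ℂ ℂ ℂ +
      τ • ContinuousLinearMap.snd ℂ ℂ ℂ).restrictScalars ℝ : ℂ × ℂ →L[ℝ] ℂ) := by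
    funext q; simp
  rw [hL]
  refine Measure.ext_of_charFunDual (funext fun ℓ => ?_)
  rw [charFunDual_map, charFunDual_prod]
  simp_rw [charFunDual_complexGaussian]
  rw [← Complex.exp_add, ← add_div, ← neg_add, ← Complex.ofReal_add]
  congr 4
  have h1 := StrongDual.apply_mul_sq_add ℓ 0 ρ 0
  have h2 := StrongDual.apply_mul_sq_add ℓ 0 τ 0
  simp at h1 h2
  simp
  linear_combination h1 + h2 + h * (ℓ 1 ^ 2 + ℓ Complex.I ^ 2)

end LinearImages

/-! ### Evaluation of the rate bound for jointly Gaussian noises -/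

section CoupledLink

theorem integrable_of_lintegral_ofReal {α : Type*} [MeasurableSpace α] {μ : Measure α}
    {f : α → ℝ} (hf : Measurable f) (h0 : ∀ x, 0 ≤ f x) {c : ℝ} (hc : 0 ≤ c)
    (h : ∫⁻ x, ENNReal.ofReal (f x) ∂μ = ENNReal.ofReal c) :
    Integrable f μ ∧ ∫ x, f x ∂μ = c := by
  refine ⟨(lintegral_ofReal_ne_top_iff_integrable hf.aestronglyMeasurable
    (.of_forall h0)).1 (by simp [h]), ?_⟩
  rw [integral_eq_lintegral_of_nonneg_ae (.of_forall h0) hf.aestronglyMeasurable, h,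
    ENNReal.toReal_ofReal hc]

/-- The kernel `x ↦ F (x, Z)` with `Z` of law `μ`. -/
def noiseKernel {A B C : Type*} [MeasurableSpace A] [MeasurableSpace B] [MeasurableSpace C]
    (μ : Measure B) (F : A × B → C) : Kernel A C :=
  (Kernel.id ×ₖ Kernel.const _ μ).map F

section NoiseKernel

variable {A B C : Type*} [MeasurableSpace A] [MeasurableSpace B] [MeasurableSpace C]

theorem isMarkovKernel_noiseKernel (μ : Measure B) [IsProbabilityMeasure μ] {F : A × B → C}
    (hF : Measurable F) : IsMarkovKernel (noiseKernel μ F) :=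
  Kernel.IsMarkovKernel.map _ hF

theorem lintegral_noiseKernel (μ : Measure B) [IsProbabilityMeasure μ] {F : A × B → C}
    (hF : Measurable F) (x : A) {φ : C → ℝ≥0∞} (hφ : Measurable φ) :
    ∫⁻ y, φ y ∂noiseKernel μ F x = ∫⁻ z, φ (F (x, z)) ∂μ := by
  rw [noiseKernel, Kernel.lintegral_map _ hF _ hφ, Kernel.prod_apply, Kernel.id_apply,
    Kernel.const_apply, lintegral_prod _ (by fun_prop), lintegral_dirac']
  exact Measurable.lintegral_prod_right' (f := fun p : A × B => φ (F p)) (by fun_prop)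

end NoiseKernel

variable {t : ℕ}

theorem lintegral_gaussianLink (h x : EuclideanSpace ℂ (Fin t)) {φ : ℂ → ℝ≥0∞}
    (hφ : Measurable φ) :
    ∫⁻ y, φ y ∂gaussianLink h x = ∫⁻ z, φ (⟪h, x⟫_ℂ + z) ∂complexGaussian :=
  lintegral_noiseKernel _ (by fun_prop) x hφ

/-- The degrading channel `y ↦ a y + √s z`. -/
def scaledLink (a : ℂ) (s : ℝ) : Kernel ℂ ℂ :=
  noiseKernel complexGaussian fun p => a * p.1 + (√s : ℝ) * p.2

instance (a : ℂ) (s : ℝ) : IsMarkovKernel (scaledLink a s) :=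
  isMarkovKernel_noiseKernel _ (by fun_prop)

theorem scaledLink_apply (a : ℂ) (s : ℝ) (y : ℂ) : scaledLink a s y = complexNormal (a * y) s :=
  Measure.ext_of_lintegral _ fun φ hφ => by
    rw [scaledLink, lintegral_noiseKernel _ (by fun_prop) _ hφ, lintegral_complexNormal _ _ hφ]

/-- The channel `x ↦ (⟪g, x⟫ + z₂, ⟪h, x⟫ + ρ z₂ + √d w)` with correlated Gaussian noises. -/
def coupledLink (h g : EuclideanSpace ℂ (Fin t)) (ρ : ℂ) (d : ℝ) :
    Kernel (EuclideanSpace ℂ (Fin t)) (ℂ × ℂ) :=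
  noiseKernel (complexGaussian.prod complexGaussian) fun p =>
    (⟪g, p.1⟫_ℂ + p.2.1, ⟪h, p.1⟫_ℂ + ρ * p.2.1 + (√d : ℝ) * p.2.2)

instance (h g : EuclideanSpace ℂ (Fin t)) (ρ : ℂ) (d : ℝ) : IsMarkovKernel (coupledLink h g ρ d) :=
  isMarkovKernel_noiseKernel _ (by fun_prop)

theorem fst_coupledLink (h g : EuclideanSpace ℂ (Fin t)) (ρ : ℂ) (d : ℝ) :
    (coupledLink h g ρ d).fst = gaussianLink g := by
  refine Kernel.ext fun x => Measure.ext_of_lintegral _ fun φ hφ => ?_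
  rw [Kernel.lintegral_fst _ _ hφ, coupledLink, lintegral_noiseKernel _ (by fun_prop) _
    (by fun_prop), lintegral_gaussianLink _ _ hφ, lintegral_prod _ (by fun_prop)]
  simp

theorem snd_coupledLink (h g : EuclideanSpace ℂ (Fin t)) {ρ : ℂ} {d : ℝ} (hd : 0 ≤ d)
    (hρ : ‖ρ‖ ^ 2 + d = 1) : (coupledLink h g ρ d).snd = gaussianLink h := by
  refine Kernel.ext fun x => Measure.ext_of_lintegral _ fun φ hφ => ?_
  rw [Kernel.lintegral_snd _ _ hφ, coupledLink, lintegral_noiseKernel _ (by fun_prop) _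
    (by fun_prop), lintegral_gaussianLink _ _ hφ]
  conv_rhs => rw [← map_add_mul_complexGaussian (ρ := ρ) (τ := (√d : ℝ))
    (by rw [Complex.norm_real, Real.norm_eq_abs, sq_abs, Real.sq_sqrt hd, hρ])]
  rw [lintegral_map (by fun_prop) (by fun_prop)]
  simp only [add_assoc]

/-- The logarithm of the density of the output of `coupledLink h g ρ d` with respect to that of its
degradation by `scaledLink a s`. -/
def coupledLogDensity (h g : EuclideanSpace ℂ (Fin t)) (ρ : ℂ) (d : ℝ) (a : ℂ) (s : ℝ)
    (ω : EuclideanSpace ℂ (Fin t) × ℂ × ℂ) : ℝ :=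
  Real.log (s / d) - ‖ω.2.2 - (⟪h, ω.1⟫_ℂ + ρ * (ω.2.1 - ⟪g, ω.1⟫_ℂ))‖ ^ 2 / d +
    ‖ω.2.2 - a * ω.2.1‖ ^ 2 / s

@[fun_prop]
theorem measurable_coupledLogDensity (h g : EuclideanSpace ℂ (Fin t)) (ρ : ℂ) (d : ℝ) (a : ℂ)
    (s : ℝ) : Measurable (coupledLogDensity h g ρ d a s) := by
  unfold coupledLogDensity; fun_prop

theorem lintegral_compProd_coupledLink (p : Measure (EuclideanSpace ℂ (Fin t)))
    [IsProbabilityMeasure p] (h g : EuclideanSpace ℂ (Fin t)) (ρ : ℂ) (d : ℝ)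
    {φ : EuclideanSpace ℂ (Fin t) × ℂ × ℂ → ℝ≥0∞} (hφ : Measurable φ) :
    ∫⁻ ω, φ ω ∂(p ⊗ₘ coupledLink h g ρ d) = ∫⁻ x, ∫⁻ z, ∫⁻ w,
      φ (x, ⟪g, x⟫_ℂ + z, ⟪h, x⟫_ℂ + ρ * z + (√d : ℝ) * w)
        ∂complexGaussian ∂complexGaussian ∂p := by
  rw [Measure.lintegral_compProd hφ]
  refine lintegral_congr fun x => ?_
  rw [coupledLink, lintegral_noiseKernel _ (by fun_prop) _ (by fun_prop),
    lintegral_prod _ (by fun_prop)]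

theorem lintegral_compProd_degraded (p : Measure (EuclideanSpace ℂ (Fin t)))
    [IsProbabilityMeasure p] (Q : Kernel (EuclideanSpace ℂ (Fin t)) (ℂ × ℂ)) [IsMarkovKernel Q]
    {g : EuclideanSpace ℂ (Fin t)} (hQ : Q.fst = gaussianLink g) (r : Kernel ℂ ℂ)
    [IsMarkovKernel r] {φ : EuclideanSpace ℂ (Fin t) × ℂ × ℂ → ℝ≥0∞} (hφ : Measurable φ) :
    ∫⁻ ω, φ ω ∂(p ⊗ₘ degraded Q r) = ∫⁻ x, ∫⁻ z, ∫⁻ y, φ (x, ⟪g, x⟫_ℂ + z, y)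
      ∂r (⟪g, x⟫_ℂ + z) ∂complexGaussian ∂p := by
  rw [Measure.lintegral_compProd hφ]
  refine lintegral_congr fun x => ?_
  rw [degraded_apply, Measure.lintegral_compProd (by fun_prop), hQ, lintegral_gaussianLink]
  exact Measurable.lintegral_kernel_prod_right' (f := fun q : ℂ × ℂ => φ (x, q)) (by fun_prop)

/-- Given the input and the first noise, the second output is complex normal under both laws: mean
`⟪h, x⟫ + ρ z` and variance `d` under the coupled channel, mean `a` times the first output and
variance `s` under the degraded one. The density is the ratio of these two. -/
theorem compProd_coupledLink_eq_withDensity (p : Measure (EuclideanSpace ℂ (Fin t)))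
    [IsProbabilityMeasure p] (h g : EuclideanSpace ℂ (Fin t)) (ρ : ℂ) {d : ℝ} (hd : 0 < d)
    (a : ℂ) {s : ℝ} (hs : 0 < s) :
    p ⊗ₘ coupledLink h g ρ d = (p ⊗ₘ degraded (coupledLink h g ρ d) (scaledLink a s)).withDensity
      fun ω => ENNReal.ofReal (Real.exp (coupledLogDensity h g ρ d a s ω)) := by
  have hm : Measurable fun ω => ENNReal.ofReal (Real.exp (coupledLogDensity h g ρ d a s ω)) := by
    fun_prop
  refine Measure.ext_of_lintegral _ fun φ hφ => ?_
  rw [lintegral_withDensity_eq_lintegral_mul _ hm hφ, lintegral_compProd_coupledLink _ _ _ _ _ hφ,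
    lintegral_compProd_degraded p _ (fst_coupledLink h g ρ d) _ (hm.mul hφ)]
  refine lintegral_congr fun x => lintegral_congr fun z => ?_
  rw [← lintegral_complexNormal (φ := fun y => φ (x, ⟪g, x⟫_ℂ + z, y)) _ _ (by fun_prop),
    complexNormal_eq_withDensity_complexNormal _ (a * (⟪g, x⟫_ℂ + z)) hd hs,
    lintegral_withDensity_eq_lintegral_mul _ (by fun_prop) (by fun_prop), scaledLink_apply]
  refine lintegral_congr fun y => ?_
  simp only [Pi.mul_apply, coupledLogDensity, add_sub_cancel_left]

/-- The second moment of the input in direction `w`. -/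
def inputPower (p : Measure (EuclideanSpace ℂ (Fin t))) (w : EuclideanSpace ℂ (Fin t)) : ℝ :=
  ∫ x, ‖⟪w, x⟫_ℂ‖ ^ 2 ∂p

theorem inner_sub_conj_smul (h g x : EuclideanSpace ℂ (Fin t)) (a : ℂ) :
    ⟪h - starRingEnd ℂ a • g, x⟫_ℂ = ⟪h, x⟫_ℂ - a * ⟪g, x⟫_ℂ := by
  rw [inner_sub_left, inner_smul_left, Complex.conj_conj]

/-- The log-density is quadratic, so two second moments fix its mean under any law `μ`. This serves
the Gaussian coupling and, later, arbitrary couplings. -/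
theorem integrable_coupledLogDensity {μ : Measure (EuclideanSpace ℂ (Fin t) × ℂ × ℂ)}
    [IsProbabilityMeasure μ] {h g : EuclideanSpace ℂ (Fin t)} {ρ a : ℂ} (d s : ℝ)
    (h1 : Integrable (fun ω => ‖ω.2.2 - (⟪h, ω.1⟫_ℂ + ρ * (ω.2.1 - ⟪g, ω.1⟫_ℂ))‖ ^ 2) μ)
    (h2 : Integrable (fun ω => ‖ω.2.2 - a * ω.2.1‖ ^ 2) μ) :
    Integrable (coupledLogDensity h g ρ d a s) μ ∧
    ∫ ω, coupledLogDensity h g ρ d a s ω ∂μ = Real.log (s / d) -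
      (∫ ω, ‖ω.2.2 - (⟪h, ω.1⟫_ℂ + ρ * (ω.2.1 - ⟪g, ω.1⟫_ℂ))‖ ^ 2 ∂μ) / d +
      (∫ ω, ‖ω.2.2 - a * ω.2.1‖ ^ 2 ∂μ) / s := by
  have h3 : Integrable (fun ω => Real.log (s / d) -
      ‖ω.2.2 - (⟪h, ω.1⟫_ℂ + ρ * (ω.2.1 - ⟪g, ω.1⟫_ℂ))‖ ^ 2 / d) μ :=
    (integrable_const _).sub (h1.div_const d)
  refine ⟨h3.add (h2.div_const s), ?_⟩
  unfold coupledLogDensity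
  rw [integral_add h3 (h2.div_const s), integral_sub (integrable_const _) (h1.div_const d),
    integral_div, integral_div]
  simp

/-- An arbitrary input law enters the quadratic log-density only through its power in the direction
`h - conj a • g`. This reduces the converse to finitely many parameters of the input. -/
theorem degradedDiv_coupledLink (p : Measure (EuclideanSpace ℂ (Fin t)))
    [IsProbabilityMeasure p] (hp : ∀ w, Integrable (fun x => ‖⟪w, x⟫_ℂ‖ ^ 2) p)
    (h g : EuclideanSpace ℂ (Fin t)) (ρ : ℂ) {d : ℝ} (hd : 0 < d)
    (a : ℂ) {s : ℝ} (hs : 0 < s) :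
    degradedDiv p (coupledLink h g ρ d) (scaledLink a s) = ENNReal.ofReal (Real.log (s / d) - 1 +
      (inputPower p (h - starRingEnd ℂ a • g) + ‖ρ - a‖ ^ 2 + d) / s) := by
  set w := h - starRingEnd ℂ a • g with hw
  have hwp : ∫⁻ x, ENNReal.ofReal (‖⟪w, x⟫_ℂ‖ ^ 2) ∂p = ENNReal.ofReal (inputPower p w) :=
    (ofReal_integral_eq_lintegral_ofReal (hp w) (.of_forall fun _ => by positivity)).symm
  have hw0 : 0 ≤ inputPower p w := integral_nonneg fun _ => by positivity
  have hsd : ‖((√d : ℝ) : ℂ)‖ ^ 2 = d := by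
    rw [Complex.norm_real, Real.norm_eq_abs, sq_abs, Real.sq_sqrt hd.le]
  obtain ⟨hi1, he1⟩ := integrable_of_lintegral_ofReal (μ := p ⊗ₘ coupledLink h g ρ d)
    (f := fun ω => ‖ω.2.2 - (⟪h, ω.1⟫_ℂ + ρ * (ω.2.1 - ⟪g, ω.1⟫_ℂ))‖ ^ 2) (by fun_prop)
    (fun _ => by positivity) hd.le (by
      rw [lintegral_compProd_coupledLink _ _ _ _ _ (by fun_prop)]
      simp only [add_sub_cancel_left]
      have := lintegral_norm_sq_add_mul 0 (√d : ℝ)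
      simp only [zero_add, hsd, norm_zero, ne_eq, OfNat.ofNat_ne_zero, not_false_eq_true,
        zero_pow] at this
      simp only [this, lintegral_const, measure_univ, mul_one])
  obtain ⟨hi2, he2⟩ := integrable_of_lintegral_ofReal (μ := p ⊗ₘ coupledLink h g ρ d)
    (f := fun ω => ‖ω.2.2 - a * ω.2.1‖ ^ 2) (c := inputPower p w + ‖ρ - a‖ ^ 2 + d) (by fun_prop)
    (fun _ => by positivity) (by positivity) (by
      rw [lintegral_compProd_coupledLink _ _ _ _ _ (by fun_prop)]
      -- The residual splits into a signal part and two independent centred noises, whose powers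
      -- add.
      have hpt (x : EuclideanSpace ℂ (Fin t)) (z v : ℂ) :
          ⟪h, x⟫_ℂ + ρ * z + (√d : ℝ) * v - a * (⟪g, x⟫_ℂ + z) =
          (⟪w, x⟫_ℂ + (ρ - a) * z) + (√d : ℝ) * v := by
        rw [hw, inner_sub_conj_smul]; ring
      simp only [hpt, lintegral_norm_sq_add_mul, hsd]
      simp only [ENNReal.ofReal_add (sq_nonneg _) hd.le]
      simp_rw [lintegral_add_right _ measurable_const, lintegral_norm_sq_add_mul]
      simp only [ENNReal.ofReal_add (sq_nonneg _) (sq_nonneg _), lintegral_const, measure_univ,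
        mul_one]
      rw [lintegral_add_right _ measurable_const, hwp,
        ENNReal.ofReal_add (by positivity) hd.le, ENNReal.ofReal_add hw0 (by positivity)]
      simp)
  obtain ⟨hint, heq⟩ := integrable_coupledLogDensity d s hi1 hi2
  have hlog (ω) : Real.log (ENNReal.ofReal (Real.exp (coupledLogDensity h g ρ d a s ω))).toReal =
      coupledLogDensity h g ρ d a s ω := by
    rw [ENNReal.toReal_ofReal (Real.exp_pos _).le, Real.log_exp]
  have hmar : IsMarkovKernel (degraded (coupledLink h g ρ d) (scaledLink a s)) := by
    unfold degraded; infer_instance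
  rw [degradedDiv, klDiv_withDensity (by fun_prop)
    (compProd_coupledLink_eq_withDensity p h g ρ hd a hs) (by simpa only [hlog] using hint)]
  simp only [hlog, heq, he1, he2, div_self hd.ne']

/-- The rate bound, evaluated for jointly Gaussian noises. -/
theorem RateBound.le_gaussian {p : Measure (EuclideanSpace ℂ (Fin t))}
    [IsProbabilityMeasure p] (hp : ∀ w, Integrable (fun x => ‖⟪w, x⟫_ℂ‖ ^ 2) p)
    {h g : EuclideanSpace ℂ (Fin t)} {R : ℝ} (hR : RateBound p (gaussianLink g) (gaussianLink h) R)
    {ρ : ℂ} {d : ℝ} (hd : 0 < d) (hρ : ‖ρ‖ ^ 2 + d = 1) (a : ℂ) {s : ℝ} (hs : 0 < s) :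
    ENNReal.ofReal (R * Real.log 2) ≤ ENNReal.ofReal (Real.log (s / d) - 1 +
      (inputPower p (h - starRingEnd ℂ a • g) + ‖ρ - a‖ ^ 2 + d) / s) := by
  rw [← degradedDiv_coupledLink p hp h g ρ hd a hs]
  exact hR _ inferInstance (fst_coupledLink h g ρ d) (snd_coupledLink h g hd.le hρ) _ inferInstance

end CoupledLink

/-! ### Second moments of the input and compactness -/

section SecondMoments

variable {t : ℕ}

/-- The power in direction `w` of `∑ⱼ Gⱼ vⱼ` for independent standard variables `Gⱼ`. -/
def vectorPower (v : Fin t → EuclideanSpace ℂ (Fin t)) (w : EuclideanSpace ℂ (Fin t)) : ℝ :=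
  ∑ j, ‖⟪w, v j⟫_ℂ‖ ^ 2

open scoped ComplexOrder MatrixOrder Matrix.Norms.L2Operator in
theorem Matrix.PosSemidef.exists_conjTranspose_mul_self {A : Matrix (Fin t) (Fin t) ℂ}
    (hA : A.PosSemidef) : ∃ B : Matrix (Fin t) (Fin t) ℂ, A = B.conjTranspose * B :=
  CStarAlgebra.nonneg_iff_eq_star_mul_self.mp hA.nonneg

theorem norm_inner_sq_eq_sum (w x : EuclideanSpace ℂ (Fin t)) :
    ((‖⟪w, x⟫_ℂ‖ ^ 2 : ℝ) : ℂ) =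
      ∑ a, ∑ b, starRingEnd ℂ (w a) * (x a * starRingEnd ℂ (x b)) * w b := by
  rw [← Complex.normSq_eq_norm_sq, ← Complex.mul_conj, PiLp.inner_apply, map_sum,
    Finset.sum_mul_sum]
  simp only [RCLike.inner_apply, map_mul, Complex.conj_conj]
  exact Finset.sum_congr rfl fun a _ => Finset.sum_congr rfl fun b _ => by ring

theorem integrable_coord_mul_conj {p : Measure (EuclideanSpace ℂ (Fin t))}
    (hp : Integrable (fun x => ‖x‖ ^ 2) p) (a b : Fin t) :
    Integrable (fun x : EuclideanSpace ℂ (Fin t) => x a * starRingEnd ℂ (x b)) p := by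
  refine hp.mono' (by fun_prop) (.of_forall fun x => ?_)
  rw [norm_mul, RCLike.norm_conj, sq]
  exact mul_le_mul (PiLp.norm_apply_le x a) (PiLp.norm_apply_le x b) (norm_nonneg _) (norm_nonneg _)

theorem integrable_norm_inner_sq {p : Measure (EuclideanSpace ℂ (Fin t))}
    (hp : Integrable (fun x => ‖x‖ ^ 2) p) (w : EuclideanSpace ℂ (Fin t)) :
    Integrable (fun x => ‖⟪w, x⟫_ℂ‖ ^ 2) p := by
  refine (hp.const_mul (‖w‖ ^ 2)).mono' (by fun_prop) (.of_forall fun x => ?_)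
  rw [Real.norm_of_nonneg (by positivity), ← mul_pow]
  gcongr
  exact norm_inner_le_norm w x

open scoped ComplexOrder in
/-- The second moments of an input law are those of a combination of `t` vectors with independent
standard coefficients. -/
theorem exists_vectors_inputPower_eq {p : Measure (EuclideanSpace ℂ (Fin t))}
    (hp : Integrable (fun x => ‖x‖ ^ 2) p) :
    ∃ v : Fin t → EuclideanSpace ℂ (Fin t), (∀ w, inputPower p w = vectorPower v w) ∧
      ∑ j, ‖v j‖ ^ 2 = ∫ x, ‖x‖ ^ 2 ∂p := by
  set K : Matrix (Fin t) (Fin t) ℂ := fun a b => ∫ x, x a * starRingEnd ℂ (x b) ∂p with hK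
  have hform (w : Fin t → ℂ) : ∑ a, ∑ b, starRingEnd ℂ (w a) * K a b * w b =
      ((∫ x, ‖⟪(WithLp.toLp 2 w : EuclideanSpace ℂ (Fin t)), x⟫_ℂ‖ ^ 2 ∂p : ℝ) : ℂ) := by
    have hi (a b : Fin t) := ((integrable_coord_mul_conj hp a b).const_mul
      (starRingEnd ℂ (w a))).mul_const (w b)
    rw [← integral_complex_ofReal]
    simp only [norm_inner_sq_eq_sum]
    rw [integral_finsetSum _ fun a _ => integrable_finsetSum _ fun b _ => hi a b]
    refine Finset.sum_congr rfl fun a _ => ?_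
    rw [integral_finsetSum _ fun b _ => hi a b]
    refine Finset.sum_congr rfl fun b _ => ?_
    rw [integral_mul_const, integral_const_mul]
  have hherm : K.IsHermitian := by
    ext a b
    rw [Matrix.conjTranspose_apply, hK, Complex.star_def, ← integral_conj]
    simp [mul_comm]
  have hpsd : K.PosSemidef := by
    refine .of_dotProduct_mulVec_nonneg hherm fun w => ?_
    have : star w ⬝ᵥ (K.mulVec w) = ∑ a, ∑ b, starRingEnd ℂ (w a) * K a b * w b := by
      simp only [dotProduct, Matrix.mulVec, Finset.mul_sum, Pi.star_apply, Complex.star_def,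
        mul_assoc]
    rw [this, hform]
    exact Complex.zero_le_real.2 (integral_nonneg fun _ => by positivity)
  obtain ⟨B, hB⟩ := hpsd.exists_conjTranspose_mul_self
  -- Conjugated rows of the factor `B` in `K = Bᴴ B`, so that `K` is the sum of the rank-one
  -- matrices `v j (v j)ᴴ`.
  set v : Fin t → EuclideanSpace ℂ (Fin t) := fun j => WithLp.toLp 2 fun a =>
    starRingEnd ℂ (B j a) with hv
  have hKv (a b : Fin t) : K a b = ∑ j, v j a * starRingEnd ℂ (v j b) := by
    rw [hB, Matrix.mul_apply]
    simp [hv, Matrix.conjTranspose_apply]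
  refine ⟨v, fun w => ?_, ?_⟩
  · have h1 := hform w
    rw [← Complex.ofReal_inj, inputPower, vectorPower, Complex.ofReal_sum]
    refine h1.symm.trans ?_
    simp only [norm_inner_sq_eq_sum, hKv, Finset.mul_sum, Finset.sum_mul]
    conv_rhs => rw [Finset.sum_comm]
    refine Finset.sum_congr rfl fun a _ => ?_
    rw [Finset.sum_comm]
  · have hdiag (a : Fin t) : ∫ x, ‖x a‖ ^ 2 ∂p = ∑ j, ‖v j a‖ ^ 2 := by
      have := hKv a a
      simp only [hK, Complex.mul_conj, Complex.normSq_eq_norm_sq] at this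
      rw [integral_complex_ofReal, ← Complex.ofReal_sum] at this
      exact_mod_cast this
    simp only [EuclideanSpace.norm_sq_eq]
    rw [Finset.sum_comm, integral_finsetSum]
    · exact Finset.sum_congr rfl fun a _ => (hdiag a).symm
    · intro a _
      refine hp.mono' (by fun_prop) (.of_forall fun x => ?_)
      rw [Real.norm_of_nonneg (by positivity)]
      gcongr
      exact PiLp.norm_apply_le x a

/-- The rate `R` satisfies the bound of `RateBound.le_gaussian` for the input `∑ⱼ Gⱼ vⱼ`. -/
def GaussianBound (h g : EuclideanSpace ℂ (Fin t)) (v : Fin t → EuclideanSpace ℂ (Fin t))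
    (R : ℝ) : Prop :=
  ∀ (ρ : ℂ) (d : ℝ) (a : ℂ) (s : ℝ), 0 < d → ‖ρ‖ ^ 2 + d = 1 → 0 < s →
    ENNReal.ofReal (R * Real.log 2) ≤ ENNReal.ofReal (Real.log (s / d) - 1 +
      (vectorPower v (h - starRingEnd ℂ a • g) + ‖ρ - a‖ ^ 2 + d) / s)

theorem continuous_vectorPower (w : EuclideanSpace ℂ (Fin t)) :
    Continuous fun v => vectorPower v w := by
  unfold vectorPower; fun_prop

open Filter Topology in
-- For each fixed choice of the parameters the bound is continuous in the vectors and the rate, and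
-- no uniformity is needed.
theorem GaussianBound.of_tendsto {h g : EuclideanSpace ℂ (Fin t)}
    {v : ℕ → Fin t → EuclideanSpace ℂ (Fin t)} {v₀ : Fin t → EuclideanSpace ℂ (Fin t)}
    {R : ℕ → ℝ} {R₀ : ℝ} (hv : Tendsto v atTop (𝓝 v₀)) (hR : Tendsto R atTop (𝓝 R₀))
    (hb : ∀ k, GaussianBound h g (v k) (R k)) : GaussianBound h g v₀ R₀ := by
  intro ρ d a s hd hρ hs
  refine le_of_tendsto_of_tendsto (ENNReal.tendsto_ofReal (hR.mul_const _))
    (ENNReal.tendsto_ofReal (Tendsto.const_add _ (Tendsto.div_const (Tendsto.add_const _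
      (Tendsto.add_const _ (((continuous_vectorPower _).tendsto v₀).comp hv))) s)))
    (.of_forall fun k => hb k ρ d a s hd hρ hs)

theorem integrable_norm_sq_of_mem_admissibleInputs {P : ℝ≥0}
    {p : ProbabilityMeasure (EuclideanSpace ℂ (Fin t))}
    (hp : p ∈ admissibleInputs (fun x : EuclideanSpace ℂ (Fin t) => ‖x‖ₑ ^ 2) P) :
    Integrable (fun x => ‖x‖ ^ 2) (p : Measure (EuclideanSpace ℂ (Fin t))) ∧
      ∫ x, ‖x‖ ^ 2 ∂(p : Measure (EuclideanSpace ℂ (Fin t))) ≤ P := by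
  have he (x : EuclideanSpace ℂ (Fin t)) : ‖x‖ₑ ^ 2 = ENNReal.ofReal (‖x‖ ^ 2) := by
    rw [ENNReal.ofReal_pow (norm_nonneg _), ofReal_norm]
  simp only [admissibleInputs, Set.mem_ofPred_eq, he] at hp
  refine ⟨(lintegral_ofReal_ne_top_iff_integrable (by fun_prop)
    (.of_forall fun _ => by positivity)).1 (hp.trans_lt ENNReal.coe_lt_top).ne, ?_⟩
  rw [integral_eq_lintegral_of_nonneg_ae (.of_forall fun _ => by positivity) (by fun_prop)]
  exact ENNReal.toReal_le_of_le_ofReal P.2 (by simpa using hp)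

theorem isCompact_setOf_sum_norm_sq_le (P : ℝ) :
    IsCompact {v : Fin t → EuclideanSpace ℂ (Fin t) | ∑ j, ‖v j‖ ^ 2 ≤ P} := by
  refine Metric.isCompact_of_isClosed_isBounded (isClosed_le (by fun_prop) continuous_const)
    ((Metric.isBounded_closedBall (x := 0) (r := √P)).subset fun v hv => ?_)
  rw [mem_closedBall_zero_iff, pi_norm_le_iff_of_nonneg (Real.sqrt_nonneg _)]
  exact fun j => Real.le_sqrt_of_sq_le
    ((Finset.single_le_sum (f := fun j => ‖v j‖ ^ 2) (fun _ _ => by positivity)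
      (Finset.mem_univ j)).trans hv)

open Filter Topology in
-- Second moments need not survive a weak limit of input laws. The limit is taken instead along
-- factors `v` of the covariances, which the power constraint confines to a compact set.
theorem exists_vectors_gaussianBound (h g : EuclideanSpace ℂ (Fin t)) (P : ℝ≥0) {R : ℝ × ℝ}
    (hR : R ∈ secrecyCapacityRegion (gaussianBC h g) (fun x => ‖x‖ₑ ^ 2) P) :
    0 ≤ R.1 ∧ 0 ≤ R.2 ∧ ∃ v : Fin t → EuclideanSpace ℂ (Fin t), ∑ j, ‖v j‖ ^ 2 ≤ P ∧
      GaussianBound h g v R.1 ∧ GaussianBound g h v R.2 := by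
  obtain ⟨h1, h2, hδ⟩ := exists_rateBound_of_mem_secrecyCapacityRegion (by fun_prop) hR
  refine ⟨h1, h2, ?_⟩
  have hfst : (gaussianBC h g).fst = gaussianLink h := Kernel.fst_prod _ _
  have hsnd : (gaussianBC h g).snd = gaussianLink g := Kernel.snd_prod _ _
  rw [hfst, hsnd] at hδ
  have hk (k : ℕ) : ∃ v : Fin t → EuclideanSpace ℂ (Fin t), ∑ j, ‖v j‖ ^ 2 ≤ (P : ℝ) ∧
      GaussianBound h g v (R.1 - 1 / ((k : ℝ) + 1)) ∧
      GaussianBound g h v (R.2 - 1 / ((k : ℝ) + 1)) := by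
    obtain ⟨p, hp, hb1, hb2⟩ := hδ (1 / ((k : ℝ) + 1)) (by positivity)
    obtain ⟨hpi, hpP⟩ := integrable_norm_sq_of_mem_admissibleInputs hp
    obtain ⟨v, hv, hvs⟩ := exists_vectors_inputPower_eq hpi
    refine ⟨v, hvs.trans_le hpP, ?_, ?_⟩ <;> intro ρ d a s hd hρ hs <;> rw [← hv]
    · exact hb1.le_gaussian (integrable_norm_inner_sq hpi) hd hρ a hs
    · exact hb2.le_gaussian (integrable_norm_inner_sq hpi) hd hρ a hs
  choose v hvP hv1 hv2 using hk
  obtain ⟨v₀, hv₀, φ, hφ, hlim⟩ := (isCompact_setOf_sum_norm_sq_le (P : ℝ)).tendsto_subseq hvP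
  have hc (r : ℝ) : Tendsto (fun k => r - 1 / ((φ k : ℝ) + 1)) atTop (𝓝 r) := by
    simpa using (tendsto_one_div_add_atTop_nhds_zero_nat.comp hφ.tendsto_atTop).const_sub r
  exact ⟨v₀, hv₀, .of_tendsto hlim (hc _) fun k => hv1 (φ k),
    .of_tendsto hlim (hc _) fun k => hv2 (φ k)⟩

end SecondMoments

/-! ### Gaussian inputs -/

section GaussianInput

variable {t : ℕ}

/-- The law of `∑ⱼ Gⱼ vⱼ` for independent standard complex Gaussian variables `Gⱼ`. -/
def gaussianInput (v : Fin t → EuclideanSpace ℂ (Fin t)) : Measure (EuclideanSpace ℂ (Fin t)) :=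
  (Measure.pi fun _ => complexGaussian).map fun q => ∑ j, q j • v j

instance (v : Fin t → EuclideanSpace ℂ (Fin t)) : IsProbabilityMeasure (gaussianInput v) :=
  Measure.isProbabilityMeasure_map (Measurable.aemeasurable (by fun_prop))

theorem inner_sum_smul (v : Fin t → EuclideanSpace ℂ (Fin t)) (w : EuclideanSpace ℂ (Fin t))
    (q : Fin t → ℂ) : ⟪w, ∑ j, q j • v j⟫_ℂ = ∑ j, ⟪w, v j⟫_ℂ * q j := by
  rw [inner_sum]
  exact Finset.sum_congr rfl fun j _ => by rw [inner_smul_right, mul_comm]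

theorem vectorPower_nonneg (v : Fin t → EuclideanSpace ℂ (Fin t)) (w : EuclideanSpace ℂ (Fin t)) :
    0 ≤ vectorPower v w :=
  Finset.sum_nonneg fun _ _ => by positivity

theorem map_inner_gaussianInput (v : Fin t → EuclideanSpace ℂ (Fin t))
    (w : EuclideanSpace ℂ (Fin t)) :
    (gaussianInput v).map (fun x => ⟪w, x⟫_ℂ) = complexNormal 0 (vectorPower v w) := by
  rw [gaussianInput, Measure.map_map (by fun_prop) (by fun_prop), vectorPower,
    ← map_sum_complexGaussian]
  congr 1
  funext q
  exact inner_sum_smul v w q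

theorem lintegral_norm_inner_sq_gaussianInput (v : Fin t → EuclideanSpace ℂ (Fin t))
    (w : EuclideanSpace ℂ (Fin t)) :
    ∫⁻ x, ENNReal.ofReal (‖⟪w, x⟫_ℂ‖ ^ 2) ∂gaussianInput v = ENNReal.ofReal (vectorPower v w) := by
  rw [← lintegral_map (f := fun y : ℂ => ENNReal.ofReal (‖y‖ ^ 2)) (g := fun x => ⟪w, x⟫_ℂ)
    (by fun_prop) (by fun_prop), map_inner_gaussianInput,
    lintegral_complexNormal _ _ (by fun_prop), lintegral_norm_sq_add_mul]
  congr 1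
  rw [Complex.norm_real, Real.norm_eq_abs, sq_abs, Real.sq_sqrt (vectorPower_nonneg v w)]
  simp

theorem integral_norm_inner_sq_gaussianInput (v : Fin t → EuclideanSpace ℂ (Fin t))
    (w : EuclideanSpace ℂ (Fin t)) :
    Integrable (fun x => ‖⟪w, x⟫_ℂ‖ ^ 2) (gaussianInput v) ∧
      ∫ x, ‖⟪w, x⟫_ℂ‖ ^ 2 ∂gaussianInput v = vectorPower v w :=
  integrable_of_lintegral_ofReal (by fun_prop) (fun _ => by positivity) (vectorPower_nonneg v w)
    (lintegral_norm_inner_sq_gaussianInput v w)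

theorem lintegral_enorm_sq_gaussianInput (v : Fin t → EuclideanSpace ℂ (Fin t)) :
    ∫⁻ x, ‖x‖ₑ ^ 2 ∂gaussianInput v = ENNReal.ofReal (∑ j, ‖v j‖ ^ 2) := by
  have he (x : EuclideanSpace ℂ (Fin t)) : ‖x‖ₑ ^ 2 =
      ∑ a, ENNReal.ofReal (‖⟪EuclideanSpace.single a (1 : ℂ), x⟫_ℂ‖ ^ 2) := by
    rw [← ofReal_norm, ← ENNReal.ofReal_pow (norm_nonneg _), EuclideanSpace.norm_sq_eq,
      ENNReal.ofReal_sum_of_nonneg fun _ _ => by positivity]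
    simp [EuclideanSpace.inner_single_left]
  simp only [he]
  rw [lintegral_finsetSum _ fun _ _ => by fun_prop]
  simp only [lintegral_norm_inner_sq_gaussianInput]
  rw [← ENNReal.ofReal_sum_of_nonneg fun _ _ => vectorPower_nonneg _ _]
  simp only [vectorPower, EuclideanSpace.inner_single_left, EuclideanSpace.norm_sq_eq]
  rw [Finset.sum_comm]
  simp

/-- The exponential of `coupledLogDensity`, with the degrading channel matched to the Gaussian
input, has mean one for every degraded output law. -/
theorem lintegral_exp_coupledLogDensity (v : Fin t → EuclideanSpace ℂ (Fin t))
    (Q : Kernel (EuclideanSpace ℂ (Fin t)) (ℂ × ℂ)) [IsMarkovKernel Q]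
    {h g : EuclideanSpace ℂ (Fin t)} (hQ : Q.fst = gaussianLink g) (r : Kernel ℂ ℂ)
    [IsMarkovKernel r] (ρ : ℂ) {d : ℝ} (hd : 0 < d) {b : ℂ}
    (hb : ∑ j, ⟪h - starRingEnd ℂ ρ • g, v j⟫_ℂ * starRingEnd ℂ ⟪g, v j⟫_ℂ =
      b * (1 + vectorPower v g : ℝ)) :
    ∫⁻ ω, ENNReal.ofReal (Real.exp (coupledLogDensity h g ρ d (ρ + b)
      (d + (vectorPower v (h - starRingEnd ℂ (ρ + b) • g) + ‖b‖ ^ 2)) ω))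
      ∂(gaussianInput v ⊗ₘ degraded Q r) = 1 := by
  set w := h - starRingEnd ℂ ρ • g with hw
  set τ := vectorPower v (h - starRingEnd ℂ (ρ + b) • g) + ‖b‖ ^ 2 with hτ
  have hτ0 : 0 ≤ τ := add_nonneg (vectorPower_nonneg _ _) (by positivity)
  have hs : 0 < d + τ := by positivity
  -- The exponential in new variables: the first output `y₂`, and the error `m = ⟪w, x⟫ - b y₂` of
  -- estimating `⟪w, x⟫` linearly from `y₂`. Under the coupled channel the second output has
  -- conditional mean `(ρ + b) y₂ + m`.
  set Φ : ℂ → ℂ → ℂ → ℝ≥0∞ := fun y₂ m y => ENNReal.ofReal (Real.exp (Real.log ((d + τ) / d) -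
    ‖y - (ρ + b) * y₂ - m‖ ^ 2 / d + ‖y - (ρ + b) * y₂‖ ^ 2 / (d + τ))) with hΦ
  have hΦm : Measurable fun q : (ℂ × ℂ) × ℂ => Φ q.1.1 q.1.2 q.2 := by
    simp only [hΦ]; fun_prop
  have hΨm : Measurable fun q : ℂ × ℂ => ∫⁻ y, Φ q.1 q.2 y ∂r q.1 :=
    Measurable.lintegral_kernel_prod_right' (κ := r.comap Prod.fst measurable_fst) hΦm
  -- Averaging the variance-`d` kernel over an error of variance `τ` yields the variance-`(d + τ)`
  -- kernel, which the last term cancels. It holds for each fixed `y`, hence for every kernel `r`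
  -- that produces `y`.
  have hinner (y₂ y : ℂ) : ∫⁻ m, Φ y₂ m y ∂complexNormal 0 τ = 1 := by
    have hpt (m : ℂ) : Φ y₂ m y = ENNReal.ofReal ((d + τ) / d *
        Real.exp (‖y - (ρ + b) * y₂‖ ^ 2 / (d + τ))) *
        ENNReal.ofReal (Real.exp (-‖y - (ρ + b) * y₂ - m‖ ^ 2 / d)) := by
      rw [← ENNReal.ofReal_mul (by positivity)]
      simp only [hΦ]
      congr 1
      rw [Real.exp_add, Real.exp_sub, Real.exp_log (by positivity), neg_div, Real.exp_neg]
      ring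
    simp only [hpt]
    rw [lintegral_const_mul _ (by fun_prop), lintegral_exp_complexNormal _ hd hτ0,
      ← ENNReal.ofReal_mul (by positivity), ← ENNReal.ofReal_one]
    congr 1
    rw [neg_div, Real.exp_neg]
    have := Real.exp_pos (‖y - (ρ + b) * y₂‖ ^ 2 / (d + τ))
    field_simp
  -- The hypothesis on `b` is the orthogonality of the estimation error to `y₂`. For a Gaussian
  -- input this makes them independent, so that `m` may be integrated out before `y`.
  have hlaw := map_pairCombination (fun j => ⟪g, v j⟫_ℂ) (fun j => ⟪w, v j⟫_ℂ - b * ⟪g, v j⟫_ℂ)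
    1 (-b) (by
      have hc := congrArg (starRingEnd ℂ) hb
      simp only [map_sum, map_mul, Complex.conj_conj, Complex.conj_ofReal] at hc
      have hN : ((vectorPower v g : ℝ) : ℂ) = ∑ j, ⟪g, v j⟫_ℂ * starRingEnd ℂ ⟪g, v j⟫_ℂ := by
        rw [vectorPower, Complex.ofReal_sum]
        exact Finset.sum_congr rfl fun j _ => by
          rw [Complex.mul_conj, Complex.normSq_eq_norm_sq]
      simp only [map_sub, map_mul, mul_sub, Finset.sum_sub_distrib, map_neg, one_mul]
      have h1 : ∑ j, ⟪g, v j⟫_ℂ * starRingEnd ℂ ⟪w, v j⟫_ℂ =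
          ∑ j, starRingEnd ℂ ⟪w, v j⟫_ℂ * ⟪g, v j⟫_ℂ :=
        Finset.sum_congr rfl fun _ _ => mul_comm _ _
      have h2 : ∑ j, ⟪g, v j⟫_ℂ * (starRingEnd ℂ b * starRingEnd ℂ ⟪g, v j⟫_ℂ) =
          starRingEnd ℂ b * ∑ j, ⟪g, v j⟫_ℂ * starRingEnd ℂ ⟪g, v j⟫_ℂ := by
        rw [Finset.mul_sum]; exact Finset.sum_congr rfl fun _ _ => by ring
      rw [h1, hc, h2, ← hN]
      push_cast
      ring)
  have hτe : ∑ j, ‖⟪w, v j⟫_ℂ - b * ⟪g, v j⟫_ℂ‖ ^ 2 + ‖-b‖ ^ 2 = τ := by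
    rw [hτ, vectorPower, norm_neg]
    congr 1
    refine Finset.sum_congr rfl fun j _ => ?_
    rw [hw, inner_sub_conj_smul, inner_sub_conj_smul]
    ring_nf
  rw [hτe] at hlaw
  rw [lintegral_compProd_degraded _ Q hQ r (by fun_prop), gaussianInput,
    lintegral_map _ (by fun_prop)]
  · have hpt (q : Fin t → ℂ) (z y : ℂ) :
        ENNReal.ofReal (Real.exp (coupledLogDensity h g ρ d (ρ + b) (d + τ)
          (∑ j, q j • v j, ∑ j, ⟪g, v j⟫_ℂ * q j + 1 * z, y))) =
        Φ (∑ j, ⟪g, v j⟫_ℂ * q j + 1 * z)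
          (∑ j, (⟪w, v j⟫_ℂ - b * ⟪g, v j⟫_ℂ) * q j + -b * z) y := by
      have h1 : ∑ j, (⟪w, v j⟫_ℂ - b * ⟪g, v j⟫_ℂ) * q j =
          ∑ j, ⟪h, v j⟫_ℂ * q j - (ρ + b) * ∑ j, ⟪g, v j⟫_ℂ * q j := by
        rw [Finset.mul_sum, ← Finset.sum_sub_distrib]
        refine Finset.sum_congr rfl fun j _ => ?_
        rw [hw, inner_sub_conj_smul]; ring
      simp only [hΦ, coupledLogDensity, inner_sum_smul, h1]
      ring_nf
    have hg (q : Fin t → ℂ) (z : ℂ) : ⟪g, ∑ j, q j • v j⟫_ℂ + z =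
        ∑ j, ⟪g, v j⟫_ℂ * q j + 1 * z := by rw [inner_sum_smul, one_mul]
    simp only [hg, hpt]
    rw [← lintegral_prod (μ := Measure.pi fun _ : Fin t => complexGaussian) (ν := complexGaussian)
        (f := fun q => ∫⁻ y, Φ (∑ j, ⟪g, v j⟫_ℂ * q.1 j + 1 * q.2)
          (∑ j, (⟪w, v j⟫_ℂ - b * ⟪g, v j⟫_ℂ) * q.1 j + -b * q.2) y
            ∂r (∑ j, ⟪g, v j⟫_ℂ * q.1 j + 1 * q.2))
        (hΨm.comp (g := fun q : ℂ × ℂ => ∫⁻ y, Φ q.1 q.2 y ∂r q.1) (f := fun q :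
          (Fin t → ℂ) × ℂ => (∑ j, ⟪g, v j⟫_ℂ * q.1 j + 1 * q.2,
            ∑ j, (⟪w, v j⟫_ℂ - b * ⟪g, v j⟫_ℂ) * q.1 j + -b * q.2)) (by fun_prop)).aemeasurable,
      ← lintegral_map (f := fun q : ℂ × ℂ => ∫⁻ y, Φ q.1 q.2 y ∂r q.1) (g := fun q :
          (Fin t → ℂ) × ℂ => (∑ j, ⟪g, v j⟫_ℂ * q.1 j + 1 * q.2,
            ∑ j, (⟪w, v j⟫_ℂ - b * ⟪g, v j⟫_ℂ) * q.1 j + -b * q.2)) hΨm (by fun_prop),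
      hlaw, lintegral_prod _ hΨm.aemeasurable]
    have hswap (y₂ : ℂ) : ∫⁻ m, ∫⁻ y, Φ y₂ m y ∂r y₂ ∂complexNormal 0 τ = 1 := by
      rw [lintegral_lintegral_swap]
      · simp [hinner]
      · simp only [Function.uncurry_def, hΦ]; fun_prop
    simp [hswap]
  · refine Measurable.lintegral_prod_right' (f := fun p : EuclideanSpace ℂ (Fin t) × ℂ =>
      ∫⁻ y, ENNReal.ofReal (Real.exp (coupledLogDensity h g ρ d (ρ + b) (d + τ)
        (p.1, ⟪g, p.1⟫_ℂ + p.2, y))) ∂r (⟪g, p.1⟫_ℂ + p.2)) ?_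
    exact Measurable.lintegral_kernel_prod_right' (κ := r.comap (fun p : EuclideanSpace ℂ (Fin t)
      × ℂ => ⟪g, p.1⟫_ℂ + p.2) (by fun_prop)) (f := fun q : (EuclideanSpace ℂ (Fin t) × ℂ) × ℂ =>
        ENNReal.ofReal (Real.exp (coupledLogDensity h g ρ d (ρ + b) (d + τ)
        (q.1.1, ⟪g, q.1.1⟫_ℂ + q.1.2, q.2)))) (by fun_prop)

end GaussianInput

/-! ### Arbitrarily correlated Gaussian noises -/

section NoiseMoments

variable {t : ℕ}

theorem integrable_id_complexGaussian : Integrable (fun z : ℂ => z) complexGaussian := by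
  have := (integrable_re_complexGaussian.ofReal (𝕜 := ℂ)).add
    ((integrable_im_complexGaussian.ofReal (𝕜 := ℂ)).mul_const Complex.I)
  refine this.congr (.of_forall fun z => ?_)
  simp [Complex.re_add_im]

theorem integral_id_complexGaussian : ∫ z, z ∂complexGaussian = 0 := by
  have h1 := Complex.reCLM.integral_comp_comm integrable_id_complexGaussian
  have h2 := Complex.imCLM.integral_comp_comm integrable_id_complexGaussian
  simp only [Complex.reCLM_apply, Complex.imCLM_apply, integral_re_complexGaussian,
    integral_im_complexGaussian] at h1 h2
  exact Complex.ext h1.symm h2.symm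

theorem map_noise_fst (p : Measure (EuclideanSpace ℂ (Fin t))) [IsProbabilityMeasure p]
    (Q : Kernel (EuclideanSpace ℂ (Fin t)) (ℂ × ℂ)) [IsMarkovKernel Q]
    {g : EuclideanSpace ℂ (Fin t)} (hQ : Q.fst = gaussianLink g) :
    (p ⊗ₘ Q).map (fun ω => (ω.1, ω.2.1 - ⟪g, ω.1⟫_ℂ)) = p.prod complexGaussian := by
  refine Measure.ext_of_lintegral _ fun φ hφ => ?_
  rw [lintegral_map hφ (by fun_prop), Measure.lintegral_compProd (by fun_prop),
    lintegral_prod _ hφ.aemeasurable]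
  refine lintegral_congr fun x => ?_
  rw [← Kernel.lintegral_fst Q x (g := fun y => φ (x, y - ⟪g, x⟫_ℂ)) (by fun_prop), hQ,
    lintegral_gaussianLink _ _ (by fun_prop)]
  simp

theorem map_noise_snd (p : Measure (EuclideanSpace ℂ (Fin t))) [IsProbabilityMeasure p]
    (Q : Kernel (EuclideanSpace ℂ (Fin t)) (ℂ × ℂ)) [IsMarkovKernel Q]
    {h : EuclideanSpace ℂ (Fin t)} (hQ : Q.snd = gaussianLink h) :
    (p ⊗ₘ Q).map (fun ω => (ω.1, ω.2.2 - ⟪h, ω.1⟫_ℂ)) = p.prod complexGaussian := by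
  refine Measure.ext_of_lintegral _ fun φ hφ => ?_
  rw [lintegral_map hφ (by fun_prop), Measure.lintegral_compProd (by fun_prop),
    lintegral_prod _ hφ.aemeasurable]
  refine lintegral_congr fun x => ?_
  rw [← Kernel.lintegral_snd Q x (g := fun y => φ (x, y - ⟪h, x⟫_ℂ)) (by fun_prop), hQ,
    lintegral_gaussianLink _ _ (by fun_prop)]
  simp

theorem integral_noise_sq {p : Measure (EuclideanSpace ℂ (Fin t))} [IsProbabilityMeasure p]
    {Ω : Type*} [MeasurableSpace Ω] {μ : Measure Ω} {X : Ω → EuclideanSpace ℂ (Fin t)} {Z : Ω → ℂ}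
    (hX : Measurable X) (hZ : Measurable Z)
    (hlaw : μ.map (fun ω => (X ω, Z ω)) = p.prod complexGaussian) :
    Integrable (fun ω => ‖Z ω‖ ^ 2) μ ∧ ∫ ω, ‖Z ω‖ ^ 2 ∂μ = 1 := by
  have hZl : μ.map Z = complexGaussian := by
    have := congrArg Measure.snd hlaw
    rwa [Measure.snd_prod, Measure.snd, Measure.map_map (by fun_prop) (by fun_prop)] at this
  obtain ⟨hi, he⟩ := integral_norm_sq_complexGaussian
  rw [← hZl] at hi he
  rw [integral_map hZ.aemeasurable (by fun_prop)] at he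
  exact ⟨hi.comp_measurable hZ, he⟩

theorem integral_input_sq {p : Measure (EuclideanSpace ℂ (Fin t))} [IsProbabilityMeasure p]
    {Ω : Type*} [MeasurableSpace Ω] {μ : Measure Ω} {X : Ω → EuclideanSpace ℂ (Fin t)}
    (hX : Measurable X) (hlaw : μ.map X = p) {w : EuclideanSpace ℂ (Fin t)}
    (hp : Integrable (fun x => ‖⟪w, x⟫_ℂ‖ ^ 2) p) :
    Integrable (fun ω => ‖⟪w, X ω⟫_ℂ‖ ^ 2) μ ∧
      ∫ ω, ‖⟪w, X ω⟫_ℂ‖ ^ 2 ∂μ = ∫ x, ‖⟪w, x⟫_ℂ‖ ^ 2 ∂p := by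
  rw [← hlaw] at hp ⊢
  exact ⟨hp.comp_measurable hX, (integral_map (f := fun x => ‖⟪w, x⟫_ℂ‖ ^ 2) hX.aemeasurable
    (by fun_prop)).symm⟩

theorem integral_inner_mul_conj_noise {p : Measure (EuclideanSpace ℂ (Fin t))}
    [IsProbabilityMeasure p] {Ω : Type*} [MeasurableSpace Ω] {μ : Measure Ω}
    {X : Ω → EuclideanSpace ℂ (Fin t)} {Z : Ω → ℂ} (hX : Measurable X) (hZ : Measurable Z)
    (hlaw : μ.map (fun ω => (X ω, Z ω)) = p.prod complexGaussian)
    (w : EuclideanSpace ℂ (Fin t)) :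
    ∫ ω, ⟪w, X ω⟫_ℂ * starRingEnd ℂ (Z ω) ∂μ = 0 := by
  rw [← integral_map (φ := fun ω => (X ω, Z ω)) (f := fun q => ⟪w, q.1⟫_ℂ * starRingEnd ℂ q.2)
    (by fun_prop) (by fun_prop), hlaw, integral_prod_mul (fun x => ⟪w, x⟫_ℂ)
    (fun z => starRingEnd ℂ z), integral_conj, integral_id_complexGaussian]
  simp

theorem integrable_mul_conj {Ω : Type*} [MeasurableSpace Ω] {μ : Measure Ω} {A B : Ω → ℂ}
    (hA : Measurable A) (hB : Measurable B) (hAi : Integrable (fun ω => ‖A ω‖ ^ 2) μ)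
    (hBi : Integrable (fun ω => ‖B ω‖ ^ 2) μ) :
    Integrable (fun ω => A ω * starRingEnd ℂ (B ω)) μ := by
  refine (hAi.add hBi).mono' (by fun_prop) (.of_forall fun ω => ?_)
  rw [norm_mul, RCLike.norm_conj, Pi.add_apply]
  nlinarith [sq_nonneg (‖A ω‖ - ‖B ω‖), sq_nonneg ‖A ω‖, sq_nonneg ‖B ω‖]

theorem integral_norm_add_sq {Ω : Type*} [MeasurableSpace Ω] {μ : Measure Ω} {A B : Ω → ℂ}
    (hA : Measurable A) (hB : Measurable B) (hAi : Integrable (fun ω => ‖A ω‖ ^ 2) μ)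
    (hBi : Integrable (fun ω => ‖B ω‖ ^ 2) μ) :
    Integrable (fun ω => ‖A ω + B ω‖ ^ 2) μ ∧ ∫ ω, ‖A ω + B ω‖ ^ 2 ∂μ =
      ∫ ω, ‖A ω‖ ^ 2 ∂μ + ∫ ω, ‖B ω‖ ^ 2 ∂μ +
        2 * (∫ ω, A ω * starRingEnd ℂ (B ω) ∂μ).re := by
  have hi := integrable_mul_conj hA hB hAi hBi
  have hpt (ω : Ω) : ‖A ω + B ω‖ ^ 2 =
      ‖A ω‖ ^ 2 + ‖B ω‖ ^ 2 + 2 * (A ω * starRingEnd ℂ (B ω)).re := by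
    rw [← Complex.normSq_eq_norm_sq, Complex.normSq_add, Complex.normSq_eq_norm_sq,
      Complex.normSq_eq_norm_sq]
  simp only [hpt]
  have hre : Integrable (fun ω => 2 * (A ω * starRingEnd ℂ (B ω)).re) μ :=
    (Complex.reCLM.integrable_comp hi).const_mul 2
  refine ⟨(hAi.add hBi).add hre, ?_⟩
  have h2 := Complex.reCLM.integral_comp_comm hi
  simp only [Complex.reCLM_apply] at h2
  have hAB : Integrable (fun ω => ‖A ω‖ ^ 2 + ‖B ω‖ ^ 2) μ := hAi.add hBi
  rw [integral_add hAB hre, integral_add hAi hBi, integral_const_mul, h2]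

theorem integral_norm_sub_mul_sq {Ω : Type*} [MeasurableSpace Ω] {μ : Measure Ω} {A B : Ω → ℂ}
    (hA : Measurable A) (hB : Measurable B) (hAi : Integrable (fun ω => ‖A ω‖ ^ 2) μ)
    (hBi : Integrable (fun ω => ‖B ω‖ ^ 2) μ) (a : ℂ) :
    Integrable (fun ω => ‖A ω - a * B ω‖ ^ 2) μ ∧ ∫ ω, ‖A ω - a * B ω‖ ^ 2 ∂μ =
      ∫ ω, ‖A ω‖ ^ 2 ∂μ + ‖a‖ ^ 2 * ∫ ω, ‖B ω‖ ^ 2 ∂μ -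
        2 * (starRingEnd ℂ a * ∫ ω, A ω * starRingEnd ℂ (B ω) ∂μ).re := by
  have hn (ω : Ω) : ‖-a * B ω‖ ^ 2 = ‖a‖ ^ 2 * ‖B ω‖ ^ 2 := by
    rw [norm_mul, norm_neg, mul_pow]
  have hBi' : Integrable (fun ω => ‖-a * B ω‖ ^ 2) μ := by
    simp only [hn]; exact hBi.const_mul _
  obtain ⟨h1, h2⟩ := integral_norm_add_sq hA (hB.const_mul (-a)) hAi hBi'
  have hc (ω : Ω) : A ω * starRingEnd ℂ (-a * B ω) =
      -starRingEnd ℂ a * (A ω * starRingEnd ℂ (B ω)) := by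
    rw [map_mul, map_neg]; ring
  simp only [hn, hc, integral_const_mul] at h2
  have hs (ω : Ω) : A ω - a * B ω = A ω + -a * B ω := by ring
  simp only [hs]
  refine ⟨h1, h2.trans ?_⟩
  rw [neg_mul, Complex.neg_re]
  ring

/-- The two noises may depend on each other in any way, even one that varies with the input, but
each of them alone is centred and independent of the input. Only their mutual correlation survives
in the second moment. -/
theorem integral_norm_inner_add_sq {p : Measure (EuclideanSpace ℂ (Fin t))}
    [IsProbabilityMeasure p] {Ω : Type*} [MeasurableSpace Ω] {μ : Measure Ω}
    {X : Ω → EuclideanSpace ℂ (Fin t)} {Z₁ Z₂ : Ω → ℂ} (hX : Measurable X) (hZ₁ : Measurable Z₁)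
    (hZ₂ : Measurable Z₂) (hlaw₁ : μ.map (fun ω => (X ω, Z₁ ω)) = p.prod complexGaussian)
    (hlaw₂ : μ.map (fun ω => (X ω, Z₂ ω)) = p.prod complexGaussian)
    {w : EuclideanSpace ℂ (Fin t)} (hp : Integrable (fun x => ‖⟪w, x⟫_ℂ‖ ^ 2) p) (a : ℂ) :
    Integrable (fun ω => ‖⟪w, X ω⟫_ℂ + (Z₁ ω - a * Z₂ ω)‖ ^ 2) μ ∧
      ∫ ω, ‖⟪w, X ω⟫_ℂ + (Z₁ ω - a * Z₂ ω)‖ ^ 2 ∂μ = ∫ x, ‖⟪w, x⟫_ℂ‖ ^ 2 ∂p +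
        (1 + ‖a‖ ^ 2 - 2 * (starRingEnd ℂ a * ∫ ω, Z₁ ω * starRingEnd ℂ (Z₂ ω) ∂μ).re) := by
  have hXl : μ.map X = p := by
    have := congrArg Measure.fst hlaw₁
    rwa [Measure.fst_prod, Measure.fst, Measure.map_map (by fun_prop) (by fun_prop)] at this
  obtain ⟨hi1, he1⟩ := integral_noise_sq hX hZ₁ hlaw₁
  obtain ⟨hi2, he2⟩ := integral_noise_sq hX hZ₂ hlaw₂
  obtain ⟨hiX, heX⟩ := integral_input_sq hX hXl hp
  obtain ⟨hi3, he3⟩ := integral_norm_sub_mul_sq hZ₁ hZ₂ hi1 hi2 a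
  have hXm : Measurable fun ω => ⟪w, X ω⟫_ℂ := by fun_prop
  obtain ⟨hi4, he4⟩ := integral_norm_add_sq hXm (hZ₁.sub (hZ₂.const_mul a)) hiX hi3
  refine ⟨hi4, ?_⟩
  have hc : ∫ ω, ⟪w, X ω⟫_ℂ * starRingEnd ℂ (Z₁ ω - a * Z₂ ω) ∂μ = 0 := by
    have hpt (ω : Ω) : ⟪w, X ω⟫_ℂ * starRingEnd ℂ (Z₁ ω - a * Z₂ ω) =
        ⟪w, X ω⟫_ℂ * starRingEnd ℂ (Z₁ ω) -
          starRingEnd ℂ a * (⟪w, X ω⟫_ℂ * starRingEnd ℂ (Z₂ ω)) := by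
      rw [map_sub, map_mul]; ring
    simp only [hpt]
    rw [integral_sub (integrable_mul_conj hXm hZ₁ hiX hi1)
      ((integrable_mul_conj hXm hZ₂ hiX hi2).const_mul _), integral_const_mul,
      integral_inner_mul_conj_noise hX hZ₁ hlaw₁, integral_inner_mul_conj_noise hX hZ₂ hlaw₂]
    simp
  refine he4.trans ?_
  simp only [Pi.sub_apply] at *
  rw [hc, heX, he3, he1, he2, Complex.zero_re]
  ring

end NoiseMoments

/-! ### The Gaussian broadcast channel -/

section GaussianChannel

variable {t : ℕ}

/-- The correlation of the two noises of a channel with the marginals of a Gaussian broadcast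
channel. -/
def noiseCorrelation (p : Measure (EuclideanSpace ℂ (Fin t)))
    (Q : Kernel (EuclideanSpace ℂ (Fin t)) (ℂ × ℂ)) (h g : EuclideanSpace ℂ (Fin t)) : ℂ :=
  ∫ ω, (ω.2.2 - ⟪h, ω.1⟫_ℂ) * starRingEnd ℂ (ω.2.1 - ⟪g, ω.1⟫_ℂ) ∂(p ⊗ₘ Q)

/-- Subtracting from the second noise `ρ` times the first leaves the power `1 - ‖ρ‖ ^ 2`, which
cannot be negative. -/
theorem norm_noiseCorrelation_le_one (p : Measure (EuclideanSpace ℂ (Fin t)))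
    [IsProbabilityMeasure p] (Q : Kernel (EuclideanSpace ℂ (Fin t)) (ℂ × ℂ)) [IsMarkovKernel Q]
    {h g : EuclideanSpace ℂ (Fin t)} (hg : Q.fst = gaussianLink g) (hh : Q.snd = gaussianLink h) :
    ‖noiseCorrelation p Q h g‖ ≤ 1 := by
  set ρ := noiseCorrelation p Q h g with hρ
  obtain ⟨hi1, he1⟩ := integral_noise_sq (by fun_prop) (by fun_prop) (map_noise_snd p Q hh)
  obtain ⟨hi2, he2⟩ := integral_noise_sq (by fun_prop) (by fun_prop) (map_noise_fst p Q hg)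
  have he := (integral_norm_sub_mul_sq (by fun_prop) (by fun_prop) hi1 hi2 ρ).2
  rw [he1, he2, ← noiseCorrelation, ← hρ, mul_comm _ ρ, Complex.mul_conj,
    Complex.normSq_eq_norm_sq, Complex.ofReal_re] at he
  have h0 : 0 ≤ 1 + ‖ρ‖ ^ 2 * 1 - 2 * ‖ρ‖ ^ 2 := he ▸ integral_nonneg fun _ => by positivity
  nlinarith [norm_nonneg ρ]

/-- A lower bound on the divergence from the degraded channels for a Gaussian input and an
arbitrary coupling of the two Gaussian noises. -/
theorem exists_ofReal_le_degradedDiv_gaussianInput (v : Fin t → EuclideanSpace ℂ (Fin t))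
    (Q : Kernel (EuclideanSpace ℂ (Fin t)) (ℂ × ℂ)) [IsMarkovKernel Q]
    {h g : EuclideanSpace ℂ (Fin t)} (hg : Q.fst = gaussianLink g) (hh : Q.snd = gaussianLink h)
    (r : Kernel ℂ ℂ) [IsMarkovKernel r] (ρ : ℂ) {d : ℝ} (hd : 0 < d) :
    ∃ a : ℂ, ∃ s : ℝ, s = d + (vectorPower v (h - starRingEnd ℂ a • g) + ‖a - ρ‖ ^ 2) ∧
      ENNReal.ofReal (Real.log (s / d) - (1 + ‖ρ‖ ^ 2 -
          2 * (starRingEnd ℂ ρ * noiseCorrelation (gaussianInput v) Q h g).re) / d +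
        (vectorPower v (h - starRingEnd ℂ a • g) + (1 + ‖a‖ ^ 2 -
          2 * (starRingEnd ℂ a * noiseCorrelation (gaussianInput v) Q h g).re)) / s) ≤
      degradedDiv (gaussianInput v) Q r := by
  have hS : 0 < 1 + vectorPower v g := by linarith [vectorPower_nonneg v g]
  -- The linear least-squares coefficient for estimating `⟪h - conj ρ • g, X⟫` from the first
  -- output, whose power is the denominator.
  set b : ℂ := (∑ j, ⟪h - starRingEnd ℂ ρ • g, v j⟫_ℂ * starRingEnd ℂ ⟪g, v j⟫_ℂ) /
    (1 + vectorPower v g : ℝ) with hb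
  have hexp := lintegral_exp_coupledLogDensity v Q hg r ρ hd (b := b)
    (div_mul_cancel₀ _ (Complex.ofReal_ne_zero.2 hS.ne')).symm
  refine ⟨ρ + b, _, rfl, ?_⟩
  rw [add_sub_cancel_left]
  set s := d + (vectorPower v (h - starRingEnd ℂ (ρ + b) • g) + ‖b‖ ^ 2)
  have h1 := map_noise_snd (gaussianInput v) Q hh
  have h2 := map_noise_fst (gaussianInput v) Q hg
  obtain ⟨hi1, he1⟩ := integral_noise_sq (by fun_prop) (by fun_prop) h1
  obtain ⟨hi2, he2⟩ := integral_noise_sq (by fun_prop) (by fun_prop) h2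
  obtain ⟨hi3, he3⟩ := integral_norm_sub_mul_sq (by fun_prop) (by fun_prop) hi1 hi2 ρ
  obtain ⟨hiw, hew⟩ := integral_norm_inner_sq_gaussianInput v (h - starRingEnd ℂ (ρ + b) • g)
  obtain ⟨hi4, he4⟩ := integral_norm_inner_add_sq (by fun_prop) (by fun_prop) (by fun_prop) h1 h2
    hiw (ρ + b)
  have hpt1 (ω : EuclideanSpace ℂ (Fin t) × ℂ × ℂ) :
      ω.2.2 - ⟪h, ω.1⟫_ℂ - ρ * (ω.2.1 - ⟪g, ω.1⟫_ℂ) =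
      ω.2.2 - (⟪h, ω.1⟫_ℂ + ρ * (ω.2.1 - ⟪g, ω.1⟫_ℂ)) := by ring
  have hpt2 (ω : EuclideanSpace ℂ (Fin t) × ℂ × ℂ) :
      ⟪h - starRingEnd ℂ (ρ + b) • g, ω.1⟫_ℂ +
        (ω.2.2 - ⟪h, ω.1⟫_ℂ - (ρ + b) * (ω.2.1 - ⟪g, ω.1⟫_ℂ)) = ω.2.2 - (ρ + b) * ω.2.1 := by
    rw [inner_sub_conj_smul]; ring
  simp only [hpt1] at hi3 he3
  simp only [hpt2] at hi4 he4
  obtain ⟨hint, heq⟩ := integrable_coupledLogDensity d s hi3 hi4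
  have hmar : IsMarkovKernel (degraded Q r) := by unfold degraded; infer_instance
  have key := ofReal_integral_le_klDiv (by fun_prop) hint hexp.le
  rw [heq, he3, he4, he1, he2, hew, mul_one] at key
  exact key

/-- If `ρ` is the actual noise correlation of `Q` and `d = 1 - ‖ρ‖ ^ 2`, the quadratic test function
has the same mean under `Q` as under the Gaussian coupling, namely `log (s / d)`. The Gaussian bound
with the same parameters has that very value. For `‖ρ‖ = 1` this `d` would be zero, and the argument
is run with `κ ρ`, `κ → 1`. -/
theorem GaussianBound.le_degradedDiv {h g : EuclideanSpace ℂ (Fin t)}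
    {v : Fin t → EuclideanSpace ℂ (Fin t)} {R : ℝ} (hR : GaussianBound h g v R)
    (Q : Kernel (EuclideanSpace ℂ (Fin t)) (ℂ × ℂ)) [IsMarkovKernel Q]
    (hg : Q.fst = gaussianLink g) (hh : Q.snd = gaussianLink h)
    (r : Kernel ℂ ℂ) [IsMarkovKernel r] :
    ENNReal.ofReal (R * Real.log 2) ≤ degradedDiv (gaussianInput v) Q r := by
  have hρ1 := norm_noiseCorrelation_le_one (gaussianInput v) Q hg hh
  have hlow := exists_ofReal_le_degradedDiv_gaussianInput v Q hg hh r
  set ρ := noiseCorrelation (gaussianInput v) Q h g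
  have hns (a : ℂ) : 1 + ‖a‖ ^ 2 - 2 * (starRingEnd ℂ a * ρ).re =
      ‖a - ρ‖ ^ 2 + (1 - ‖ρ‖ ^ 2) := by
    rw [← Complex.normSq_eq_norm_sq (a - ρ), Complex.normSq_sub, Complex.normSq_eq_norm_sq,
      Complex.normSq_eq_norm_sq]
    have : (starRingEnd ℂ a * ρ).re = (a * starRingEnd ℂ ρ).re := by
      simp [Complex.mul_re]
    rw [this]; ring
  simp only [hns] at hlow
  -- With `s` matched to the residual power, the terms `-1` and `s / s` of the Gaussian bound
  -- cancel.
  have hup {ρ' a : ℂ} {d s : ℝ} (hd : 0 < d) (hρ : ‖ρ'‖ ^ 2 + d = 1)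
      (hs : s = d + (vectorPower v (h - starRingEnd ℂ a • g) + ‖a - ρ'‖ ^ 2)) :
      0 < s ∧ ENNReal.ofReal (R * Real.log 2) ≤ ENNReal.ofReal (Real.log (s / d)) := by
    have hs0 : 0 < s := by
      rw [hs]; have := vectorPower_nonneg v (h - starRingEnd ℂ a • g); positivity
    refine ⟨hs0, (hR ρ' d a s hd hρ hs0).trans_eq ?_⟩
    rw [norm_sub_rev, show vectorPower v (h - starRingEnd ℂ a • g) + ‖a - ρ'‖ ^ 2 + d = s by
      rw [hs]; ring, div_self hs0.ne', sub_add_cancel]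
  rcases hρ1.lt_or_eq with hlt | heq
  · have hd : 0 < 1 - ‖ρ‖ ^ 2 := by nlinarith [norm_nonneg ρ]
    obtain ⟨a, s, hs, hle⟩ := hlow ρ hd
    obtain ⟨hs0, hu⟩ := hup hd (by ring) hs
    refine hu.trans (le_of_eq_of_le ?_ hle)
    rw [show vectorPower v (h - starRingEnd ℂ a • g) + (‖a - ρ‖ ^ 2 + (1 - ‖ρ‖ ^ 2)) = s by
      rw [hs]; ring, div_self hs0.ne', sub_self, norm_zero]
    congr 1
    rw [zero_pow two_ne_zero, zero_add, div_self hd.ne']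
    ring
  -- Using `κ ρ` for a coupling of correlation `ρ` costs the mismatch `(1 - κ)² / (1 - κ²) = (1 - κ)
  -- / (1 + κ)`, which vanishes as `κ → 1`. The last term of the lower bound is nonnegative and is
  -- discarded.
  · have hstep (κ : ℝ) (hκ : κ ∈ Set.Ioo (0 : ℝ) 1) :
        ENNReal.ofReal (R * Real.log 2 - (1 - κ) / (1 + κ)) ≤
          degradedDiv (gaussianInput v) Q r := by
      obtain ⟨hκ0, hκ1⟩ := hκ
      have hd : 0 < 1 - κ ^ 2 := by nlinarith
      have hnorm : ‖(κ : ℂ) * ρ‖ ^ 2 = κ ^ 2 := by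
        rw [norm_mul, heq, mul_one, Complex.norm_real, Real.norm_eq_abs, sq_abs]
      have hdiff : ‖(κ : ℂ) * ρ - ρ‖ ^ 2 = (1 - κ) ^ 2 := by
        have : (κ : ℂ) * ρ - ρ = ((κ - 1 : ℝ) : ℂ) * ρ := by push_cast; ring
        rw [this, norm_mul, heq, mul_one, Complex.norm_real, Real.norm_eq_abs, sq_abs]
        ring
      obtain ⟨a, s, hs, hle⟩ := hlow (κ * ρ) hd
      obtain ⟨hs0, hu⟩ := hup hd (by rw [hnorm]; ring) hs
      refine le_trans ?_ hle
      rw [heq, hdiff]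
      have hfrac : ((1 - κ) ^ 2 + (1 - 1 ^ 2)) / (1 - κ ^ 2) = (1 - κ) / (1 + κ) := by
        have h1 : 1 - κ ^ 2 = (1 - κ) * (1 + κ) := by ring
        have h2 : 1 - κ ≠ 0 := by linarith
        have h3 : 1 + κ ≠ 0 := by linarith
        rw [h1]
        field_simp
        ring
      have hlast : 0 ≤ (vectorPower v (h - starRingEnd ℂ a • g) +
          (‖a - ρ‖ ^ 2 + (1 - 1 ^ 2))) / s := by
        have := vectorPower_nonneg v (h - starRingEnd ℂ a • g)
        have h4 : (0 : ℝ) ≤ ‖a - ρ‖ ^ 2 + (1 - 1 ^ 2) := by nlinarith [sq_nonneg ‖a - ρ‖]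
        positivity
      have hq : 0 ≤ (1 - κ) / (1 + κ) := div_nonneg (by linarith) (by linarith)
      rw [hfrac]
      -- Truncation at zero allows a second case, `R * log 2 ≤ 0`, in which nothing is left to
      -- prove.
      rcases ENNReal.ofReal_le_ofReal_iff'.1 hu with hu | hu
      · exact ENNReal.ofReal_le_ofReal (by linarith)
      · rw [ENNReal.ofReal_of_nonpos (by linarith)]; exact zero_le
    have hc : Filter.Tendsto (fun κ : ℝ => ENNReal.ofReal (R * Real.log 2 - (1 - κ) / (1 + κ)))
        (nhdsWithin 1 (Set.Iio 1)) (nhds (ENNReal.ofReal (R * Real.log 2))) := by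
      have h1 : ContinuousAt (fun κ : ℝ => R * Real.log 2 - (1 - κ) / (1 + κ)) 1 := by
        refine continuousAt_const.sub (ContinuousAt.div (by fun_prop) (by fun_prop) (by norm_num))
      have h2 := ENNReal.tendsto_ofReal h1.tendsto
      simp only [sub_self, zero_div, sub_zero] at h2
      exact h2.mono_left nhdsWithin_le_nhds
    refine le_of_tendsto hc ?_
    filter_upwards [Ioo_mem_nhdsLT (zero_lt_one' ℝ)] with κ hκ using hstep κ hκ

/-- The vectors `v` are found before `Q` is used, so one Gaussian input law attains the bound for
both users and for all couplings of the noises. -/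
theorem secrecyCapacityRegion_gaussianBC_subset (h g : EuclideanSpace ℂ (Fin t)) (P : ℝ≥0)
    (Q : Kernel (EuclideanSpace ℂ (Fin t)) (ℂ × ℂ)) [IsMarkovKernel Q]
    (hQ : Q ∈ sameMarginals (gaussianBC h g)) :
    secrecyCapacityRegion (gaussianBC h g) (fun x => ‖x‖ₑ ^ 2) P ⊆
      ⋃ p ∈ admissibleInputs (fun x => ‖x‖ₑ ^ 2) P, satoRegion Q p := by
  intro R hR
  obtain ⟨h1, h2, v, hv, hb1, hb2⟩ := exists_vectors_gaussianBound h g P hR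
  have hfst : Q.fst = gaussianLink h := hQ.1.trans (Kernel.fst_prod _ _)
  have hsnd : Q.snd = gaussianLink g := hQ.2.trans (Kernel.snd_prod _ _)
  refine Set.mem_biUnion (x := (⟨gaussianInput v, inferInstance⟩ :
    ProbabilityMeasure (EuclideanSpace ℂ (Fin t)))) ?_ (mem_satoRegion h1 h2 ?_ ?_)
  · change ∫⁻ x, ‖x‖ₑ ^ 2 ∂gaussianInput v ≤ P
    rw [lintegral_enorm_sq_gaussianInput]
    exact (ENNReal.ofReal_le_ofReal hv).trans_eq (ENNReal.ofReal_coe_nnreal)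
  · exact hb1.le_degradedDiv Q.swapRight ((Kernel.fst_swapRight Q).trans hsnd)
      ((Kernel.snd_swapRight Q).trans hfst) _
  · exact hb2.le_degradedDiv Q hfst hsnd _

end GaussianChannel

end

theorem theorem2 :
    -- the multi-antenna Gaussian broadcast channel with power limitation `P`
    (∀ (t : ℕ) (h g : EuclideanSpace ℂ (Fin t)) (P : ℝ≥0),
      secrecyCapacityRegion (gaussianBC h g) (fun x => ‖x‖ₑ ^ 2) P ⊆
        ⋂ (Q : Kernel (EuclideanSpace ℂ (Fin t)) (ℂ × ℂ)) (_ : IsMarkovKernel Q)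
          (_ : Q ∈ sameMarginals (gaussianBC h g)),
          ⋃ p ∈ admissibleInputs (fun x => ‖x‖ₑ ^ 2) P, satoRegion Q p) ∧
    -- memoryless broadcast channels with a finite input alphabet
    (∀ (𝒳 𝒴₁ 𝒴₂ : Type*) [Finite 𝒳] [Nonempty 𝒳] [Nonempty 𝒴₁] [Nonempty 𝒴₂]
      [MeasurableSpace 𝒳] [MeasurableSpace 𝒴₁] [MeasurableSpace 𝒴₂]
      [StandardBorelSpace 𝒳] [StandardBorelSpace 𝒴₁] [StandardBorelSpace 𝒴₂]
      (W : Kernel 𝒳 (𝒴₁ × 𝒴₂)) [IsMarkovKernel W] (c : 𝒳 → ℝ≥0∞) (Γ : ℝ≥0∞),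
      secrecyCapacityRegion W c Γ ⊆
        ⋂ (Q : Kernel 𝒳 (𝒴₁ × 𝒴₂)) (_ : IsMarkovKernel Q) (_ : Q ∈ sameMarginals W),
          ⋃ p ∈ admissibleInputs c Γ, satoRegion Q p) ∧
    -- arbitrary memoryless broadcast channels, where the suprema over input laws may not be attained
    (∀ (𝒳 𝒴₁ 𝒴₂ : Type*) [Nonempty 𝒳] [Nonempty 𝒴₁] [Nonempty 𝒴₂]
      [MeasurableSpace 𝒳] [MeasurableSpace 𝒴₁] [MeasurableSpace 𝒴₂]
      [StandardBorelSpace 𝒳] [StandardBorelSpace 𝒴₁] [StandardBorelSpace 𝒴₂]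
      (W : Kernel 𝒳 (𝒴₁ × 𝒴₂)) [IsMarkovKernel W] (c : 𝒳 → ℝ≥0∞) (_ : Measurable c) (Γ : ℝ≥0∞),
      secrecyCapacityRegion W c Γ ⊆
        ⋂ (Q : Kernel 𝒳 (𝒴₁ × 𝒴₂)) (_ : IsMarkovKernel Q) (_ : Q ∈ sameMarginals W),
          closure (⋃ p ∈ admissibleInputs c Γ, satoRegion Q p)) := by
  refine ⟨?_, ?_, ?_⟩
  · intro t h g P
    exact Set.subset_iInter fun Q => Set.subset_iInter fun _ => Set.subset_iInter fun hQ =>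
      secrecyCapacityRegion_gaussianBC_subset h g P Q hQ
  · intro 𝒳 𝒴₁ 𝒴₂ _ _ _ _ _ _ _ _ _ _ W _ c Γ
    exact Set.subset_iInter fun Q => Set.subset_iInter fun _ => Set.subset_iInter fun hQ =>
      secrecyCapacityRegion_subset_of_finite c Γ Q hQ
  · intro 𝒳 𝒴₁ 𝒴₂ _ _ _ _ _ _ _ _ _ W _ c hc Γ
    exact Set.subset_iInter fun Q => Set.subset_iInter fun _ => Set.subset_iInter fun hQ =>
      secrecyCapacityRegion_subset_closure hc Q hQ
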